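/- **Setting.** For $q\in\mathbb C$ let $H_n(q)$ be the $\mathbb C$-algebra generated by $T_{s_1},\dots,T_{s_{n-1}}$ with relations $T_{s_i}^2=(q-1)T_{s_i}+q$, $T_{s_i}T_{s_j}=T_{s_j}T_{s_i}$ for $|i-j|\ge 2$, and $T_{s_i}T_{s_{i+1}}T_{s_i}=T_{s_{i+1}}T_{s_i}T_{s_{i+1}}$; for $m\le n$ regard $H_m(q)\subseteq H_n(q)$ via $T_{s_i}\mapsto T_{s_i}$. It acts from the right on the span of all words $\mathbf w=w_1\cdots w_n$ by $\mathbf w T_{s_i}=q\mathbf w$ if $w_i=w_{i+1}$, $\mathbf w T_{s_i}=\mathbf w s_i$ if $w_i<w_{i+1}$, and $\mathbf w T_{s_i}=q\,\mathbf w s_i+(q-1)\mathbf w$ if $w_i>w_{i+1}$, where $\mathbf w s_i$ is $\mathbf w$ with the letters in positions $i,i+1$ exchanged. Put $$\mathcal B_m=\sum_{i=1}^m T_{s_{m-1}}T_{s_{m-2}}\cdots T_{s_i},\qquad \mathcal B_m^*=\sum_{i=1}^m T_{s_i}T_{s_{i+1}}\cdots T_{s_{m-1}},$$ $$\mathcal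 R_m=\mathcal B_m^*\mathcal B_m,\qquad \mathcal C_j^{(n)}=\mathcal B_{j+1}\mathcal B_{j+2}\cdots\mathcal B_n,$$ and, for $q\ne0$, $J_k=\sum_{i=1}^{k-1}q^{i-k}T_{(i,k)}$ with $T_{(i,k)}=T_{s_i}\cdots T_{s_{k-2}}T_{s_{k-1}}T_{s_{k-2}}\cdots T_{s_i}$. For $m\in\mathbb Z$ let $[m]_q=1+q+\dots+q^{m-1}$ if $m\ge0$ and $[m]_q=-q^{-1}-\dots-q^{m}$ if $m<0$. For partitions $\mu\subseteq\lambda$, $\mathrm{SYT}(\lambda\setminus\mu)$ is the set of standard fillings of $\lambda\setminus\mu$ by $|\mu|+1,\dots,|\lambda|$ (each used once, increasing along rows and down columns), and $\mathrm{SYT}(\lambda)=\mathrm{SYT}(\lambda\setminus\emptyset)$. For $t\in\mathrm{SYT}(\lambda\setminus\mu)$ and $s\in\mathrm{SYT}(\mu)$, $t(s)\in\mathrm{SYT}(\lambda)$ is the tableau that restricts to $s$ on $\mu$ and to $t$ on $\lambda\setminus\mu$; $\mathrm{shape}(t|_k)$ is the partition consisting of $\mu$ and the cells of $t$ with entry at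 most $k$. The tableau $t^{\lambda\setminus\mu}$ is the largest element of $\mathrm{SYT}(\lambda\setminus\mu)$ in dominance order; it is obtained by writing $|\mu|+1,\dots,|\lambda|$ in increasing order into the rows of $\lambda\setminus\mu$, from left to right and from top to bottom. For $t\in\mathrm{SYT}(\lambda)$, $|\lambda|=n$, let $\mathrm{word}(t)$ be the word whose $i$-th letter is the row of $t$ containing $i$, let $c_{t,m}$ be the column index minus the row index of the entry $m$, let $\mathfrak C(m)=\{k\in\mathbb Z:-m<k<m\}$ with $0$ removed if $m\in\{2,3\}$, and put $$p_t=\prod_{m=1}^n\ \prod_{x\in\{[d]_q\,:\,d\in\mathfrak C(m)\}\setminus\{[c_{t,m}]_q\}}\frac{J_m-x}{[c_{t,m}]_q-x}\in H_n(q),\qquad w_t=\mathrm{word}(t)\,p_t .$$ The Specht module $S^\lambda$ is the span of the seminormal units $w_t$, $t\in\mathrm{SYT}(\lambda)$. Let $p_\nu\in H_{|\nu|}(q)$ be the central idempotent projecting onto the $S^\nu$-isotypic component (the identity on $S^\nu$, zero on $S^\rho$ for every other partition $\rho$ of $|\nu|$), and for $t\in\mathrm{SYT}(\lambda\setminus\mu)$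 put $p_t=p_{\mathrm{shape}(t|_{|\mu|+1})}\cdots p_{\mathrm{shape}(t|_{|\lambda|})}$. Let $\Phi_t$ be the linear map that sends a word of length $|\mu|$ to the word of length $|\lambda|$ obtained by appending the letters $r_{|\mu|+1},\dots,r_{|\lambda|}$, where $r_i$ is the row of $t$ containing $i$. **Theorem.** (1) (Straightening Lemma) Let $q\in\mathbb C$ with $q\neq 0$, let $\mu\subseteq\lambda$ be partitions with $|\mu|=j$, $|\lambda|=n$, and suppose that $H_n(q)$ is semisimple. Let $t\in \mathrm{SYT}(\lambda\setminus\mu)$. Then there is a constant $\alpha\in\mathbb C$ such that for every $s\in\mathrm{SYT}(\mu)$ $$w_{t(s)}\,\mathcal C_j^{(n)}=\alpha\; w_{t^{\lambda\setminus\mu}(s)}\,\mathcal C_j^{(n)} .$$ (2) Let $q\in\mathbb R$, $q>0$, and let $\lambda$ be a partition of $n$. For every $\mu\subseteq\lambda$ let $\kappa_\mu$ be any basis of the kernel of $\mathcal R_{|\mu|}$ acting on $S^\mu$. Then the set $$\mathfrak B_\lambda=\{\,u\,\Phi_{t^{\lambda\setminus\mu}}\;p_{t^{\lambda\setminus\mu}}\;\mathcal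 C_{|\mu|}^{(n)} : \mu\subseteq\lambda,\ u\in\kappa_\mu\,\}$$ is contained in $S^\lambda$ and spans $S^\lambda$. -/

import Mathlib

open scoped BigOperators

noncomputable section

namespace QShuffle

/-! ## The Hecke algebra of type A and its action on words

All generators are numbered from `0`: the generator `i` (with `i + 1 < n`) is the one usually
written `T_{s_{i+1}}`, and it exchanges the (0-based) positions `i` and `i + 1`. -/

/-- The defining relations of the Hecke algebra. -/
inductive HeckeRel (n : ℕ) (q : ℂ) :
    FreeAlgebra ℂ {i : ℕ // i + 1 < n} → FreeAlgebra ℂ {i : ℕ // i + 1 < n} → Prop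
  | quadratic (i : {i : ℕ // i + 1 < n}) :
      HeckeRel n q (FreeAlgebra.ι ℂ i * FreeAlgebra.ι ℂ i)
        ((q - 1) • FreeAlgebra.ι ℂ i + algebraMap ℂ _ q)
  | comm (i j : {i : ℕ // i + 1 < n}) (h : i.1 + 2 ≤ j.1) :
      HeckeRel n q (FreeAlgebra.ι ℂ i * FreeAlgebra.ι ℂ j)
        (FreeAlgebra.ι ℂ j * FreeAlgebra.ι ℂ i)
  | braid (i j : {i : ℕ // i + 1 < n}) (h : j.1 = i.1 + 1) :
      HeckeRel n q (FreeAlgebra.ι ℂ i * FreeAlgebra.ι ℂ j * FreeAlgebra.ι ℂ i)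
        (FreeAlgebra.ι ℂ j * FreeAlgebra.ι ℂ i * FreeAlgebra.ι ℂ j)

/-- The Hecke algebra `H_n(q)` over `ℂ`. -/
abbrev Hecke (n : ℕ) (q : ℂ) : Type := RingQuot (HeckeRel n q)

/-- The generators of `H_n(q)`. -/
def gen (n : ℕ) (q : ℂ) (i : {i : ℕ // i + 1 < n}) : Hecke n q :=
  RingQuot.mkAlgHom ℂ (HeckeRel n q) (FreeAlgebra.ι ℂ i)

/-- The generators with a total index (the value `0` for `i + 1 ≥ n` is never used). -/
def heckeT (n : ℕ) (q : ℂ) (i : ℕ) : Hecke n q :=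
  if h : i + 1 < n then gen n q ⟨i, h⟩ else 0

theorem gen_quadratic (n : ℕ) (q : ℂ) (i : {i : ℕ // i + 1 < n}) :
    gen n q i * gen n q i = (q - 1) • gen n q i + algebraMap ℂ _ q := by
  have h := RingQuot.mkAlgHom_rel ℂ (HeckeRel.quadratic (n := n) (q := q) i)
  simpa only [map_mul, map_add, map_smul, AlgHom.commutes, gen] using h

theorem gen_comm (n : ℕ) (q : ℂ) (i j : {i : ℕ // i + 1 < n}) (hij : i.1 + 2 ≤ j.1) :
    gen n q i * gen n q j = gen n q j * gen n q i := by
  have h := RingQuot.mkAlgHom_rel ℂ (HeckeRel.comm (n := n) (q := q) i j hij)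
  simpa only [map_mul, gen] using h

theorem gen_braid (n : ℕ) (q : ℂ) (i j : {i : ℕ // i + 1 < n}) (hij : j.1 = i.1 + 1) :
    gen n q i * gen n q j * gen n q i = gen n q j * gen n q i * gen n q j := by
  have h := RingQuot.mkAlgHom_rel ℂ (HeckeRel.braid (n := n) (q := q) i j hij)
  simpa only [map_mul, gen] using h

/-- The standard embedding `H_m(q) → H_n(q)` for `m ≤ n`, sending each generator to the generator
with the same index. -/
def heckeIncl {m n : ℕ} (q : ℂ) (hmn : m ≤ n) : Hecke m q →ₐ[ℂ] Hecke n q :=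
  RingQuot.liftAlgHom ℂ
    ⟨FreeAlgebra.lift ℂ fun i : {i : ℕ // i + 1 < m} => gen n q ⟨i.1, i.2.trans_le hmn⟩, by
      intro x y h
      cases h with
      | quadratic i =>
        simp only [map_mul, map_add, map_smul, AlgHom.commutes, FreeAlgebra.lift_ι_apply]
        exact gen_quadratic n q _
      | comm i j h =>
        simp only [map_mul, FreeAlgebra.lift_ι_apply]
        exact gen_comm n q _ _ h
      | braid i j h =>
        simp only [map_mul, FreeAlgebra.lift_ι_apply]
        exact gen_braid n q _ _ h⟩

/-- The space with basis the words of length `n` in the alphabet `ℕ`. -/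
abbrev Words (n : ℕ) : Type := (Fin n → ℕ) →₀ ℂ

/-- The word `w` with the letters in positions `i` and `i + 1` exchanged. -/
def swapWord {n : ℕ} (i : {i : ℕ // i + 1 < n}) (w : Fin n → ℕ) : Fin n → ℕ :=
  w ∘ Equiv.swap (⟨i.1, by have := i.2; omega⟩ : Fin n) ⟨i.1 + 1, i.2⟩

/-- The operator by which the generator `i` acts on words from the right. -/
def wordOp (n : ℕ) (q : ℂ) (i : {i : ℕ // i + 1 < n}) : Module.End ℂ (Words n) :=
  Finsupp.linearCombination ℂ fun w : Fin n → ℕ =>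
    let a := w ⟨i.1, by have := i.2; omega⟩
    let b := w ⟨i.1 + 1, i.2⟩
    if a = b then Finsupp.single w q
    else if a < b then Finsupp.single (swapWord i w) 1
    else Finsupp.single (swapWord i w) q + Finsupp.single w (q - 1)

/-- Coefficient of `w` in the action of a generator on a word `w` with adjacent letters `a`, `b`. -/
def cA (q : ℂ) (a b : ℕ) : ℂ := if a = b then q else if a < b then 0 else q - 1
/-- Coefficient of the swapped word in the same action. -/
def cB (q : ℂ) (a b : ℕ) : ℂ := if a = b then 0 else if a < b then 1 else q

theorem wordOp_single (n : ℕ) (q : ℂ) (i : {i : ℕ // i + 1 < n}) (w : Fin n → ℕ) (c : ℂ) :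
    wordOp n q i (Finsupp.single w c) =
      (c * cA q (w ⟨i.1, by have := i.2; omega⟩) (w ⟨i.1 + 1, i.2⟩)) • Finsupp.single w 1 +
      (c * cB q (w ⟨i.1, by have := i.2; omega⟩) (w ⟨i.1 + 1, i.2⟩)) •
        Finsupp.single (swapWord i w) 1 := by
  simp only [wordOp, Finsupp.linearCombination_single, cA, cB]
  split_ifs <;> simp [Finsupp.smul_single, smul_eq_mul, add_comm, -Finsupp.single_sub, smul_add]

theorem swapWord_swapWord {n : ℕ} (i : {i : ℕ // i + 1 < n}) (w : Fin n → ℕ) :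
    swapWord i (swapWord i w) = w := by
  ext k; simp [swapWord]

theorem swapWord_apply {n : ℕ} (i : {i : ℕ // i + 1 < n}) (w : Fin n → ℕ) (k : ℕ) (hk : k < n) :
    swapWord i w ⟨k, hk⟩ = if k = i.1 then w ⟨i.1 + 1, i.2⟩
      else if k = i.1 + 1 then w ⟨i.1, by have := i.2; omega⟩ else w ⟨k, hk⟩ := by
  simp only [swapWord, Function.comp, Equiv.swap_apply_def, Fin.mk.injEq]
  split_ifs <;> rfl

theorem wordOp_quadratic (n : ℕ) (q : ℂ) (i : {i : ℕ // i + 1 < n}) :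
    wordOp n q i * wordOp n q i = (q - 1) • wordOp n q i + algebraMap ℂ _ q := by
  refine Finsupp.lhom_ext' fun w => LinearMap.ext_ring ?_
  simp only [LinearMap.comp_apply, Finsupp.lsingle_apply, Module.End.mul_apply,
    LinearMap.add_apply, LinearMap.smul_apply, Module.algebraMap_end_apply, wordOp_single,
    map_add, map_smul, swapWord_swapWord, swapWord_apply]
  simp only [if_true, Nat.succ_ne_self, if_false]
  generalize w ⟨i.1, _⟩ = a
  generalize w ⟨i.1 + 1, _⟩ = b
  match_scalars
  all_goals
    simp only [cA, cB]
    split_ifs <;> first | omega | ring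

theorem wordOp_comm (n : ℕ) (q : ℂ) (i j : {i : ℕ // i + 1 < n}) (h : i.1 + 2 ≤ j.1) :
    wordOp n q i * wordOp n q j = wordOp n q j * wordOp n q i := by
  have hc : ∀ w, swapWord i (swapWord j w) = swapWord j (swapWord i w) := by
    intro w; ext ⟨k, hk⟩; simp only [swapWord_apply]
    split_ifs <;> omega
  refine Finsupp.lhom_ext' fun w => LinearMap.ext_ring ?_
  have e1 : i.1 ≠ j.1 := by omega
  have e2 : i.1 ≠ j.1 + 1 := by omega
  have e3 : i.1 + 1 ≠ j.1 := by omega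
  have e4 : i.1 + 1 ≠ j.1 + 1 := by omega
  simp only [LinearMap.comp_apply, Finsupp.lsingle_apply, Module.End.mul_apply, wordOp_single,
    map_add, map_smul, swapWord_apply, hc, e1, e2, e3, e4, e1.symm, e2.symm, e3.symm, e4.symm,
    if_false]
  module

theorem wordOp_braid (n : ℕ) (q : ℂ) (i j : {i : ℕ // i + 1 < n}) (h : j.1 = i.1 + 1) :
    wordOp n q i * wordOp n q j * wordOp n q i = wordOp n q j * wordOp n q i * wordOp n q j := by
  obtain ⟨i, hi⟩ := i
  obtain ⟨j, hj⟩ := j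
  simp only at h
  subst h
  have hc : ∀ w, swapWord ⟨i, hi⟩ (swapWord ⟨i + 1, hj⟩ (swapWord ⟨i, hi⟩ w)) =
      swapWord ⟨i + 1, hj⟩ (swapWord ⟨i, hi⟩ (swapWord ⟨i + 1, hj⟩ w)) := by
    intro w; ext ⟨k, hk⟩; simp only [swapWord_apply]
    split_ifs <;> omega
  refine Finsupp.lhom_ext' fun w => LinearMap.ext_ring ?_
  have e1 : i ≠ i + 1 := by omega
  have e2 : i ≠ i + 1 + 1 := by omega
  have e3 : i + 1 + 1 ≠ i + 1 := by omega
  simp only [LinearMap.comp_apply, Finsupp.lsingle_apply, Module.End.mul_apply, wordOp_single,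
    map_add, map_smul, swapWord_apply, swapWord_swapWord, hc, e1, e2, e3, e1.symm, e2.symm, e3.symm,
    if_false, if_true]
  generalize w ⟨i, _⟩ = a
  generalize w ⟨i + 1, _⟩ = b
  generalize w ⟨i + 1 + 1, _⟩ = c
  match_scalars
  all_goals
    simp only [cA, cB]
    split_ifs <;> first | omega | ring

/-- The right action of `H_n(q)` on words, as an algebra homomorphism into the opposite of the
endomorphism algebra. -/
def wordRep (n : ℕ) (q : ℂ) : Hecke n q →ₐ[ℂ] (Module.End ℂ (Words n))ᵐᵒᵖ :=
  RingQuot.liftAlgHom ℂ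
    ⟨FreeAlgebra.lift ℂ fun i : {i : ℕ // i + 1 < n} => MulOpposite.op (wordOp n q i), by
      intro x y h
      cases h with
      | quadratic i =>
        simp only [map_mul, map_add, map_smul, AlgHom.commutes, FreeAlgebra.lift_ι_apply,
          MulOpposite.algebraMap_apply, ← MulOpposite.op_mul, ← MulOpposite.op_smul,
          ← MulOpposite.op_add, wordOp_quadratic]
      | comm i j h =>
        simp only [map_mul, FreeAlgebra.lift_ι_apply, ← MulOpposite.op_mul, wordOp_comm n q i j h]
      | braid i j h =>
        simp only [map_mul, FreeAlgebra.lift_ι_apply, ← MulOpposite.op_mul, ← mul_assoc,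
          wordOp_braid n q i j h]⟩

/-- Right multiplication by `x ∈ H_n(q)` on words: `rightMul x v` is `v · x`. -/
def rightMul {n : ℕ} {q : ℂ} (x : Hecke n q) : Words n →ₗ[ℂ] Words n :=
  (wordRep n q x).unop

theorem rightMul_gen {n : ℕ} {q : ℂ} (i : {i : ℕ // i + 1 < n}) :
    rightMul (gen n q i) = wordOp n q i := by
  simp [rightMul, wordRep, gen]

theorem rightMul_mul {n : ℕ} {q : ℂ} (x y : Hecke n q) (v : Words n) :
    rightMul (x * y) v = rightMul y (rightMul x v) := by
  simp [rightMul]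

/-! ## Elements of the Hecke algebra -/

/-- The `q`-integer `[m]_q`, `m ∈ ℤ` (for `q ≠ 0`): `1 + q + ⋯ + q^(m-1)` for `m ≥ 0` and
`-q^(-1) - ⋯ - q^m` for `m < 0`. -/
def qInt (q : ℂ) : ℤ → ℂ
  | Int.ofNat m => ∑ i ∈ Finset.range m, q ^ i
  | Int.negSucc m => -∑ i ∈ Finset.range (m + 1), (q ^ (i + 1))⁻¹

/-- The product of the generators numbered `a, a + 1, …, b - 1` (from `0`), in this order. -/
def ascProd (n : ℕ) (q : ℂ) (a b : ℕ) : Hecke n q := ((List.Ico a b).map (heckeT n q)).prod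

/-- The product of the generators numbered `b - 1, …, a + 1, a` (from `0`), in this order. -/
def descProd (n : ℕ) (q : ℂ) (a b : ℕ) : Hecke n q := ((List.Ico a b).reverse.map (heckeT n q)).prod

/-- `q`-bottom-to-random `B_m(q)`, viewed in `H_n(q)` (used for `m ≤ n`). -/
def bottomToRandom (n : ℕ) (q : ℂ) (m : ℕ) : Hecke n q :=
  ∑ i ∈ Finset.range m, descProd n q i (m - 1)

/-- `q`-random-to-bottom `B_m^*(q)`, viewed in `H_n(q)` (used for `m ≤ n`). -/
def randomToBottom (n : ℕ) (q : ℂ) (m : ℕ) : Hecke n q :=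
  ∑ i ∈ Finset.range m, ascProd n q i (m - 1)

/-- `q`-random-to-random `R_n(q) = B_n^*(q) B_n(q)`. -/
def randomToRandom (n : ℕ) (q : ℂ) : Hecke n q := randomToBottom n q n * bottomToRandom n q n

/-- `C_j^{(n)} = B_{j+1}(q) B_{j+2}(q) ⋯ B_n(q) ∈ H_n(q)`. -/
def cProd (n : ℕ) (q : ℂ) (j : ℕ) : Hecke n q :=
  ((List.Ico (j + 1) (n + 1)).map (bottomToRandom n q)).prod

/-- The Jucys-Murphy element `J_k(q) = ∑_{1 ≤ i < k} q^{i-k} T_{(i,k)}` of `H_n(q)`, where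
`T_{(i,k)} = T_{s_i} ⋯ T_{s_{k-2}} T_{s_{k-1}} T_{s_{k-2}} ⋯ T_{s_i}`. -/
def jucysMurphy (n : ℕ) (q : ℂ) (k : ℕ) : Hecke n q :=
  ∑ i ∈ Finset.range (k - 1),
    (q ^ (k - (i + 1)))⁻¹ • (ascProd n q i (k - 1) * descProd n q i (k - 2))

/-- The set of contents of the entry `m` in standard tableaux. -/
def contents (m : ℕ) : Finset ℤ :=
  if m = 2 ∨ m = 3 then (Finset.Ioo (-(m : ℤ)) m).erase 0 else Finset.Ioo (-(m : ℤ)) m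

/-! ## Tableaux -/

/-- Standard tableaux of skew shape `la ∖ mu`: fillings of the cells of `la ∖ mu` by the numbers
`|mu| + 1, …, |la|`, each used once, increasing along rows and down columns. Cells are pairs
(row, column), both numbered from `0`; the entry outside the shape is set to `0`. -/
@[ext]
structure SkewSYT (mu la : YoungDiagram) where
  entry : ℕ × ℕ → ℕ
  bij : Set.BijOn entry ↑(la.cells \ mu.cells) (Set.Ioc mu.card la.card)
  row_lt : ∀ i j₁ j₂, j₁ < j₂ → (i, j₁) ∈ la.cells \ mu.cells → (i, j₂) ∈ la.cells \ mu.cells →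
    entry (i, j₁) < entry (i, j₂)
  col_lt : ∀ i₁ i₂ j, i₁ < i₂ → (i₁, j) ∈ la.cells \ mu.cells → (i₂, j) ∈ la.cells \ mu.cells →
    entry (i₁, j) < entry (i₂, j)
  zero : ∀ c, c ∉ la.cells \ mu.cells → entry c = 0

/-- Standard Young tableaux of shape `la`. -/
abbrev SYT (la : YoungDiagram) : Type := SkewSYT ⊥ la

namespace SkewSYT

variable {mu la : YoungDiagram}

/-- The cell containing the entry `k` (for `|mu| < k ≤ |la|`). -/
def cell (t : SkewSYT mu la) (k : ℕ) : ℕ × ℕ :=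
  Function.invFunOn t.entry ↑(la.cells \ mu.cells) k

theorem cell_mem (t : SkewSYT mu la) {k : ℕ} (hk : k ∈ Set.Ioc mu.card la.card) :
    t.cell k ∈ la.cells \ mu.cells := by
  exact Finset.mem_coe.1 (Function.invFunOn_mem (t.bij.surjOn hk))

theorem entry_cell (t : SkewSYT mu la) {k : ℕ} (hk : k ∈ Set.Ioc mu.card la.card) :
    t.entry (t.cell k) = k :=
  Function.invFunOn_eq (t.bij.surjOn hk)

theorem entry_lt (t : SkewSYT mu la) {c d : ℕ × ℕ} (hc : c ∈ la.cells \ mu.cells)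
    (hd : d ∈ la.cells \ mu.cells) (h : c < d) : t.entry c < t.entry d := by
  obtain ⟨i, j⟩ := c
  obtain ⟨i', j'⟩ := d
  obtain ⟨h1, h2⟩ := Prod.mk_le_mk.1 h.le
  have hm : (i, j') ∈ la.cells \ mu.cells := by
    simp only [Finset.mem_sdiff, YoungDiagram.mem_cells] at hc hd ⊢
    exact ⟨la.up_left_mem h1 le_rfl hd.1, fun hh => hc.2 (mu.up_left_mem le_rfl h2 hh)⟩
  rcases h1.lt_or_eq with h1 | rfl
  · rcases h2.lt_or_eq with h2 | rfl
    · exact (t.row_lt _ _ _ h2 hc hm).trans (t.col_lt _ _ _ h1 hm hd)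
    · exact t.col_lt _ _ _ h1 hc hd
  · rcases h2.lt_or_eq with h2 | rfl
    · exact t.row_lt _ _ _ h2 hc hd
    · exact absurd h (lt_irrefl _)

/-- The partition `shape(t|_k)`: the cells of `mu` together with the cells of `t` whose entry is at
most `k`. -/
def shape (t : SkewSYT mu la) (k : ℕ) : YoungDiagram where
  cells := mu.cells ∪ {c ∈ la.cells \ mu.cells | t.entry c ≤ k}
  isLowerSet := by
    intro d c hcd hd
    simp only [Finset.coe_union, Set.mem_union, Finset.mem_coe, Finset.mem_filter] at hd ⊢
    by_cases hc : c ∈ mu.cells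
    · exact Or.inl hc
    · right
      rcases hd with hd | ⟨hd, hk⟩
      · exact absurd (mu.isLowerSet hcd hd) hc
      · have hcl : c ∈ la.cells \ mu.cells :=
          Finset.mem_sdiff.2 ⟨la.isLowerSet hcd (Finset.mem_sdiff.1 hd).1, hc⟩
        refine ⟨hcl, ?_⟩
        rcases eq_or_lt_of_le hcd with rfl | hlt
        · exact hk
        · exact (t.entry_lt hcl hd hlt).le.trans hk

theorem shape_le (t : SkewSYT mu la) (h : mu ≤ la) (k : ℕ) : t.shape k ≤ la := by
  rw [← YoungDiagram.cells_subset_iff]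
  intro c hc
  simp only [shape, Finset.mem_union, Finset.mem_filter] at hc
  rcases hc with hc | hc
  · exact YoungDiagram.cells_subset_iff.2 h hc
  · exact (Finset.mem_sdiff.1 hc.1).1

theorem card_shape_le (t : SkewSYT mu la) (h : mu ≤ la) (k : ℕ) :
    (t.shape k).card ≤ la.card :=
  Finset.card_le_card (YoungDiagram.cells_subset_iff.2 (t.shape_le h k))

theorem mem_bot_sdiff {c : ℕ × ℕ} : c ∈ mu.cells \ (⊥ : YoungDiagram).cells ↔ c ∈ mu.cells := by
  simp

theorem entry_mem (t : SkewSYT mu la) {c : ℕ × ℕ} (hc : c ∈ la.cells \ mu.cells) :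
    mu.card < t.entry c ∧ t.entry c ≤ la.card :=
  t.bij.mapsTo (Finset.mem_coe.2 hc)

/-- The entries of the tableau `t(s)`. -/
def glueEntry (t : SkewSYT mu la) (s : SYT mu) (c : ℕ × ℕ) : ℕ :=
  if c ∈ mu.cells then s.entry c else t.entry c

theorem glueEntry_lt (t : SkewSYT mu la) (s : SYT mu) {c d : ℕ × ℕ}
    (hc : c ∈ la.cells) (hd : d ∈ la.cells) (h : c < d) :
    glueEntry t s c < glueEntry t s d := by
  unfold glueEntry
  by_cases hdm : d ∈ mu.cells
  · have hcm : c ∈ mu.cells := mu.isLowerSet h.le hdm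
    rw [if_pos hcm, if_pos hdm]
    exact s.entry_lt (mem_bot_sdiff.2 hcm) (mem_bot_sdiff.2 hdm) h
  · have hd' := Finset.mem_sdiff.2 ⟨hd, hdm⟩
    by_cases hcm : c ∈ mu.cells
    · rw [if_pos hcm, if_neg hdm]
      exact (s.entry_mem (mem_bot_sdiff.2 hcm)).2.trans_lt (t.entry_mem hd').1
    · rw [if_neg hcm, if_neg hdm]
      exact t.entry_lt (Finset.mem_sdiff.2 ⟨hc, hcm⟩) hd' h

/-- The tableau `t(s)` of shape `la` that restricts to `s` on `mu` and to `t` on `la ∖ mu`. -/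
def glue (h : mu ≤ la) (t : SkewSYT mu la) (s : SYT mu) : SYT la where
  entry := glueEntry t s
  bij := by
    have hsub := YoungDiagram.cells_subset_iff.2 h
    have hs : Set.BijOn (glueEntry t s) ↑mu.cells (Set.Ioc 0 mu.card) := by
      have := s.bij
      simp only [YoungDiagram.cells_bot, Finset.sdiff_empty] at this
      refine Set.BijOn.congr (f₁ := s.entry) (by simpa [YoungDiagram.card] using this) ?_
      intro c hc
      simp [glueEntry, Finset.mem_coe.1 hc]
    have ht : Set.BijOn (glueEntry t s) ↑(la.cells \ mu.cells) (Set.Ioc mu.card la.card) := by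
      refine Set.BijOn.congr t.bij ?_
      intro c hc
      simp [glueEntry, (Finset.mem_sdiff.1 (Finset.mem_coe.1 hc)).2]
    have hd : Disjoint (↑mu.cells : Set (ℕ × ℕ)) ↑(la.cells \ mu.cells) :=
      Finset.disjoint_coe.2 Finset.disjoint_sdiff
    have hu := hs.union ht ((Set.injOn_union hd).2 ⟨hs.injOn, ht.injOn, fun c hc d hd => by
      have h1 := (hs.mapsTo hc).2
      have h2 := (ht.mapsTo hd).1
      omega⟩)
    rw [← Finset.coe_union, Finset.union_sdiff_of_subset hsub,
      Set.Ioc_union_Ioc_eq_Ioc (Nat.zero_le _) (Finset.card_le_card hsub)] at hu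
    simpa [YoungDiagram.card] using hu
  row_lt := fun i j₁ j₂ hj h₁ h₂ =>
    glueEntry_lt t s (mem_bot_sdiff.1 h₁) (mem_bot_sdiff.1 h₂) (Prod.mk_lt_mk_iff_right.2 hj)
  col_lt := fun i₁ i₂ j hi h₁ h₂ =>
    glueEntry_lt t s (mem_bot_sdiff.1 h₁) (mem_bot_sdiff.1 h₂) (Prod.mk_lt_mk_iff_left.2 hi)
  zero := by
    intro c hc
    have hc' : c ∉ la.cells := fun hh => hc (mem_bot_sdiff.2 hh)
    have hcm : c ∉ mu.cells := fun hh => hc' (YoungDiagram.cells_subset_iff.2 h hh)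
    rw [glueEntry, if_neg hcm]
    exact t.zero c fun hh => hc' (Finset.mem_sdiff.1 hh).1

/-! ### Dominance order and its largest element -/

/-- The dominance order on partitions. -/
def DominatedBy (mu nu : YoungDiagram) : Prop :=
  ∀ r, ∑ i ∈ Finset.range r, mu.rowLen i ≤ ∑ i ∈ Finset.range r, nu.rowLen i

/-- The dominance order on standard tableaux of a skew shape. -/
def Dominated (q t : SkewSYT mu la) : Prop :=
  ∀ k, DominatedBy (q.shape k) (t.shape k)

/-- `d` is weakly before `c` when rows are read from left to right, from top to bottom. -/
def ReadLE (d c : ℕ × ℕ) : Prop := d.1 < c.1 ∨ (d.1 = c.1 ∧ d.2 ≤ c.2)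

instance (d c : ℕ × ℕ) : Decidable (ReadLE d c) := by unfold ReadLE; infer_instance

/-- The position of a cell of `la ∖ mu` in row reading order. -/
def readRank (mu la : YoungDiagram) (c : ℕ × ℕ) : ℕ :=
  Finset.card {d ∈ la.cells \ mu.cells | ReadLE d c}

theorem readRank_lt {c d : ℕ × ℕ} (hd : d ∈ la.cells \ mu.cells) (h : ReadLE c d) (hne : c ≠ d) :
    readRank mu la c < readRank mu la d := by
  refine Finset.card_lt_card ((Finset.ssubset_iff_of_subset ?_).2 ⟨d, ?_, ?_⟩)
  · intro e he
    rw [Finset.mem_filter] at he ⊢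
    refine ⟨he.1, ?_⟩
    have h2 := he.2
    unfold ReadLE at h h2 ⊢
    omega
  · rw [Finset.mem_filter]
    exact ⟨hd, Or.inr ⟨rfl, le_rfl⟩⟩
  · rw [Finset.mem_filter]
    rintro ⟨_, hh⟩
    unfold ReadLE at h hh
    exact hne (Prod.ext (by omega) (by omega))

/-- The tableau `t^{la ∖ mu}`: the entries `|mu| + 1, …, |la|` are written in increasing order into
the rows of `la ∖ mu`, from left to right and from top to bottom. By `dominated_maxTableau` it is
the largest element of the dominance order. -/
def maxTableau (h : mu ≤ la) : SkewSYT mu la where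
  entry c := if c ∈ la.cells \ mu.cells then mu.card + readRank mu la c else 0
  bij := by
    have hsub := YoungDiagram.cells_subset_iff.2 h
    have hmaps : Set.MapsTo
        (fun c => if c ∈ la.cells \ mu.cells then mu.card + readRank mu la c else 0)
        ↑(la.cells \ mu.cells) ↑(Finset.Ioc mu.card la.card) := by
      intro c hc
      have hc := Finset.mem_coe.1 hc
      have h0 : 0 < readRank mu la c :=
        Finset.card_pos.2 ⟨c, Finset.mem_filter.2 ⟨hc, Or.inr ⟨rfl, le_rfl⟩⟩⟩
      have h1 : readRank mu la c ≤ (la.cells \ mu.cells).card :=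
        Finset.card_le_card (Finset.filter_subset _ _)
      have h2 := Finset.card_sdiff_add_card_eq_card hsub
      simp only [if_pos hc, Finset.coe_Ioc, Set.mem_Ioc, YoungDiagram.card]
      omega
    have hinj : Set.InjOn
        (fun c => if c ∈ la.cells \ mu.cells then mu.card + readRank mu la c else 0)
        ↑(la.cells \ mu.cells) := by
      intro c hc d hd hcd
      have hc := Finset.mem_coe.1 hc
      have hd := Finset.mem_coe.1 hd
      simp only [if_pos hc, if_pos hd] at hcd
      by_contra hne
      have htot : ReadLE c d ∨ ReadLE d c := by unfold ReadLE; omega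
      rcases htot with hr | hr
      · have := readRank_lt hd hr hne; omega
      · have := readRank_lt hc hr (Ne.symm hne); omega
    have h2 := Finset.card_sdiff_add_card_eq_card hsub
    have hcard : (Finset.Ioc mu.card la.card).card ≤ (la.cells \ mu.cells).card := by
      simp only [Nat.card_Ioc, YoungDiagram.card]; omega
    have hsurj := Finset.surjOn_of_injOn_of_card_le _ hmaps hinj hcard
    rw [Finset.coe_Ioc] at hsurj hmaps
    exact ⟨hmaps, hinj, hsurj⟩
  row_lt := by
    intro i j₁ j₂ hj h₁ h₂
    rw [if_pos h₁, if_pos h₂]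
    exact Nat.add_lt_add_left (readRank_lt (c := (i, j₁)) h₂ (Or.inr ⟨rfl, hj.le⟩) (by simp [hj.ne])) _
  col_lt := by
    intro i₁ i₂ j hi h₁ h₂
    rw [if_pos h₁, if_pos h₂]
    exact Nat.add_lt_add_left (readRank_lt (c := (i₁, j)) h₂ (Or.inl hi) (by simp [hi.ne])) _
  zero := fun c hc => if_neg hc

theorem sum_rowLen (nu : YoungDiagram) (r : ℕ) :
    ∑ i ∈ Finset.range r, nu.rowLen i = Finset.card {c ∈ nu.cells | c.1 < r} := by
  rw [Finset.card_eq_sum_card_fiberwise (f := Prod.fst) (t := Finset.range r)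
    (by intro c hc; simpa using (Finset.mem_filter.1 (Finset.mem_coe.1 hc)).2)]
  refine Finset.sum_congr rfl fun i hi => ?_
  rw [YoungDiagram.rowLen_eq_card, YoungDiagram.row, Finset.filter_filter]
  congr 1
  refine Finset.filter_congr fun c _ => ?_
  have := Finset.mem_range.1 hi
  omega

theorem card_rows_shape (t : SkewSYT mu la) (k r : ℕ) :
    Finset.card {c ∈ (t.shape k).cells | c.1 < r} = Finset.card {c ∈ mu.cells | c.1 < r} +
      Finset.card {c ∈ la.cells \ mu.cells | t.entry c ≤ k ∧ c.1 < r} := by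
  rw [shape, Finset.filter_union, Finset.filter_filter, Finset.card_union_of_disjoint]
  refine Finset.disjoint_left.2 fun c hc hc' => ?_
  exact (Finset.mem_sdiff.1 (Finset.mem_filter.1 hc').1).2 (Finset.mem_filter.1 hc).1

/-- `maxTableau` is the largest element for the dominance order. -/
theorem dominated_maxTableau (h : mu ≤ la) (t : SkewSYT mu la) : Dominated t (maxTableau h) := by
  intro k r
  rw [sum_rowLen, sum_rowLen, card_rows_shape, card_rows_shape]
  refine Nat.add_le_add_left ?_ _
  set M := maxTableau h with hM
  -- either all cells of the first `r` rows have entry at most `k` in `M`, or all entries up to `k`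
  -- are in the first `r` rows of `M`
  by_cases hall : ∀ c ∈ la.cells \ mu.cells, c.1 < r → M.entry c ≤ k
  · refine Finset.card_le_card fun c hc => ?_
    simp only [Finset.mem_filter] at hc ⊢
    exact ⟨hc.1, hall c hc.1 hc.2.2, hc.2.2⟩
  · push Not at hall
    obtain ⟨e, he, her, hek⟩ := hall
    have hM' : ∀ c ∈ la.cells \ mu.cells, M.entry c ≤ k → c.1 < r := by
      intro c hc hck
      by_contra hcr
      have hlt := readRank_lt (mu := mu) (la := la) hc (c := e) (Or.inl (by omega))
        (by rintro rfl; omega)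
      simp only [hM, maxTableau, if_pos he, if_pos hc] at hek hck
      omega
    have key : ∀ s : SkewSYT mu la,
        Finset.card {c ∈ la.cells \ mu.cells | s.entry c ≤ k} =
          Finset.card {m ∈ Finset.Ioc mu.card la.card | m ≤ k} := by
      intro s
      refine Finset.card_nbij s.entry ?_ ?_ ?_
      · intro c hc
        rw [Finset.mem_coe, Finset.mem_filter] at hc
        rw [Finset.mem_coe, Finset.mem_filter, Finset.mem_Ioc]
        exact ⟨s.entry_mem hc.1, hc.2⟩
      · exact s.bij.injOn.mono fun c hc => (Finset.mem_filter.1 (Finset.mem_coe.1 hc)).1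
      · intro m hm
        rw [Finset.mem_coe, Finset.mem_filter, Finset.mem_Ioc] at hm
        refine ⟨s.cell m, ?_, s.entry_cell hm.1⟩
        rw [Finset.mem_coe, Finset.mem_filter, s.entry_cell hm.1]
        exact ⟨s.cell_mem hm.1, hm.2⟩
    calc Finset.card {c ∈ la.cells \ mu.cells | t.entry c ≤ k ∧ c.1 < r}
        ≤ Finset.card {c ∈ la.cells \ mu.cells | t.entry c ≤ k} :=
          Finset.card_le_card fun c hc => by
            simp only [Finset.mem_filter] at hc ⊢
            exact ⟨hc.1, hc.2.1⟩
      _ = Finset.card {c ∈ la.cells \ mu.cells | M.entry c ≤ k} := by rw [key t, key M]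
      _ ≤ _ := Finset.card_le_card fun c hc => by
            simp only [Finset.mem_filter] at hc ⊢
            exact ⟨hc.1, hc.2, hM' c hc.1 hc.2⟩

end SkewSYT

open SkewSYT

/-! ## Young idempotents, seminormal units, Specht modules -/

variable {mu la : YoungDiagram}

/-- The content (column minus row) of the entry `k` of `t`. -/
def content (t : SYT la) (k : ℕ) : ℤ := ((t.cell k).2 : ℤ) - (t.cell k).1

/-- Young's idempotent `p_t ∈ H_n(q)`, `n = |la|`, for a standard tableau `t` of shape `la`: the
product over `m = 1, …, n` of the Lagrange interpolation factors
`∏_x (J_m(q) - x) / ([c]_q - x)`, where `c` is the content of `m` in `t` and `x ≠ [c]_q` runs over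
the values `[d]_q`, `d ∈ contents m`. -/
def youngIdempotent (q : ℂ) (t : SYT la) : Hecke la.card q :=
  ((List.Ico 1 (la.card + 1)).map fun m =>
    Polynomial.aeval (jucysMurphy la.card q m)
      (∏ x ∈ ((contents m).image (qInt q)).erase (qInt q (content t m)),
        Polynomial.C (qInt q (content t m) - x)⁻¹ * (Polynomial.X - Polynomial.C x))).prod

/-- `word(t)`: its letter in (0-based) position `k` is the row of `t` containing `k + 1`. -/
def word (t : SYT la) : Fin la.card → ℕ := fun k => (t.cell (k.1 + 1)).1

/-- Young's seminormal unit `w_t = word(t) p_t`. -/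
def seminormalUnit (q : ℂ) (t : SYT la) : Words la.card :=
  rightMul (youngIdempotent q t) (Finsupp.single (word t) 1)

/-- The Specht module `S^la`, realized as the span of the seminormal units of shape `la`. -/
def specht (q : ℂ) (la : YoungDiagram) : Submodule ℂ (Words la.card) :=
  Submodule.span ℂ (Set.range fun t : SYT la => seminormalUnit q t)

/-- `e ∈ H_n(q)`, `n = |nu|`, is the projector onto the `S^nu`-isotypic component: it is central,
acts as the identity on `S^nu`, and annihilates `S^rho` for every other partition `rho` of `n`. -/
structure IsIsotypicProjector (q : ℂ) (nu : YoungDiagram) (e : Hecke nu.card q) : Prop where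
  central : ∀ x, x * e = e * x
  act_self : ∀ v ∈ specht q nu, rightMul e v = v
  act_other : ∀ (rho : YoungDiagram) (h : rho.card = nu.card), rho ≠ nu → ∀ v ∈ specht q rho,
    rightMul (heckeIncl q h.ge e) v = 0

open Classical in
/-- The central idempotent `p_nu ∈ H_n(q)`, `n = |nu|`: the projector onto the `S^nu`-isotypic
component. It exists and is unique when `H_n(q)` is semisimple and `q ≠ 0`. -/
def isotypicProjector (q : ℂ) (nu : YoungDiagram) : Hecke nu.card q :=
  if h : ∃ e, IsIsotypicProjector q nu e then h.choose else 0

/-- `p_t = p_{shape(t|_{|mu|+1})} ⋯ p_{shape(t|_{|la|})} ∈ H_{|la|}(q)` for a skew tableau `t` of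
shape `la ∖ mu`. -/
def skewIdempotent (q : ℂ) (h : mu ≤ la) (t : SkewSYT mu la) : Hecke la.card q :=
  ((List.Ico (mu.card + 1) (la.card + 1)).map fun k =>
    heckeIncl q (t.card_shape_le h k) (isotypicProjector q (t.shape k))).prod

/-- The concatenation operator `Φ_t`: it appends to a word of length `|mu|` the rows of `t`
containing `|mu| + 1, …, |la|`. -/
def Phi (t : SkewSYT mu la) : Words mu.card →ₗ[ℂ] Words la.card :=
  Finsupp.lmapDomain ℂ ℂ fun w k =>
    if h : k.1 < mu.card then w ⟨k.1, h⟩ else (t.cell (k.1 + 1)).1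

/-- `K` is a basis of the kernel of `R_{|mu|}(q)` acting on `S^mu`. -/
def IsKernelBasis (q : ℂ) (mu : YoungDiagram) (K : Set (Words mu.card)) : Prop :=
  LinearIndepOn ℂ id K ∧
    Submodule.span ℂ K = specht q mu ⊓ LinearMap.ker (rightMul (randomToRandom mu.card q))

/-- The set `B_la` of all `x_{mu(u)}^la = u Φ_{t^{la ∖ mu}} p_{t^{la ∖ mu}} C_{|mu|}^{(n)}`, for
`mu ⊆ la` and `u ∈ κ_mu`. -/
def spanningSet (q : ℂ) (κ : ∀ mu : YoungDiagram, Set (Words mu.card)) (la : YoungDiagram) :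
    Set (Words la.card) :=
  {x | ∃ (mu : YoungDiagram) (h : mu ≤ la), ∃ u ∈ κ mu,
    x = rightMul (cProd la.card q mu.card)
      (rightMul (skewIdempotent q h (maxTableau h)) (Phi (maxTableau h) u))}

end QShuffle

end

/-! Everything rests on Young's seminormal form, obtained from the spectral theory of the
Jucys-Murphy elements in the manner of Okounkov and Vershik. A standard tableau is encoded by the
lattice word of the rows of its entries, and the only facts needed about `q` are `q ≠ 0` and the
nonvanishing of `[1]_q, …, [n]_q` (`QNonzero`). The latter follows from semisimplicity
(`qNonzero_of_isSemisimpleRing`) and is immediate for `q > 0`. Under it, on a joint eigenspace of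
the earlier elements, the next Jucys-Murphy element has as eigenvalues only q-contents of addable
cells, and it has no Jordan blocks (`IsHeckeFamily.spectrum`). Hence the space of words is the sum
of joint eigenspaces indexed by standard tableaux, and `p_t` acts as the projection `proj`. The
generator `T_k` acts on the eigenspace of `t` by a scalar `τ`, up to a term in the eigenspace of the
tableau with two consecutive entries exchanged (`T_sub_mem`, `T_eq`).

Straightening. The word of a tableau has components only at tableaux that dominate it. From this, if
an exchange of consecutive entries turns `t` into a less dominant `t'`, then `w_{t'} = w_t (T_k -
τ)` (`unit_sw`). On the other hand `T_k C_j = q C_j` for every generator that exchanges positions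
beyond the first `j` (`heckeT_mul_cProd`). So `w_{t'} C_j = (q - τ) w_t C_j`, where `q - τ ≠ 0`. Any
two standard fillings of the skew shape are connected by such exchanges (`lattice_connected`). The
scalar `τ` depends only on contents of cells outside the inner shape, so the constant is the same
for all `s`.

Spanning. For `q > 0` the words carry a positive definite Hermitian form for which the generators
are self-adjoint, so `B` and `B*` are adjoint and `R = B* B` is self-adjoint. Therefore `S^μ = ker
R_j + S^μ B_j` with `j = |μ|` (`exists_ker_add_bottomToRandom`). Given `w_t C_j`, let `μ` be the
shape of the first `j` entries of `t`. Straightening replaces the outer part of `t` by the maximal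
filling, and the inner unit is written as `a + b B_j` with `a` in the kernel. The part from `a` lies
in the span of `𝔅_λ`. In the part from `b`, the element `B_j` commutes with the idempotents of the
outer part and joins `C_j` to form `C_{j-1}`. Descending from `C_n = 1` to `j = 0`, where `B_0 = 0`,
exhausts `S^λ`. The projectors `p_ν` used here exist because `∏ (x - J_k)` is central and its
eigenvalues, the content polynomials, separate partitions. The scalars by which they act are read
off on seminormal units, which do not vanish (`unit_ne_zero`). -/

open scoped BigOperators

noncomputable section

namespace QShuffle

/-! ## Families satisfying the Hecke relations and their Jucys-Murphy elements -/

section Family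

variable {A : Type*} [Ring A] [Algebra ℂ A]

/-- The elements `T 0, …, T (n - 2)` satisfy the relations of the Hecke algebra `H_n(q)`. -/
structure IsHeckeFamily (n : ℕ) (q : ℂ) (T : ℕ → A) : Prop where
  quad : ∀ i, i + 1 < n → T i * T i = (q - 1) • T i + q • (1 : A)
  comm : ∀ i j, i + 2 ≤ j → j + 1 < n → T i * T j = T j * T i
  braid : ∀ i, i + 2 < n → T i * T (i + 1) * T i = T (i + 1) * T i * T (i + 1)

/-- The Jucys-Murphy elements of a family, numbered from `0`. -/
def murphy (q : ℂ) (T : ℕ → A) : ℕ → A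
  | 0 => 0
  | k + 1 => q⁻¹ • (T k * murphy q T k * T k + T k)

variable {n : ℕ} {q : ℂ} {T : ℕ → A}

theorem IsHeckeFamily.commute (H : IsHeckeFamily n q T) {i j : ℕ} (hi : i + 1 < n)
    (hj : j + 1 < n) (h : i + 2 ≤ j ∨ j + 2 ≤ i) : Commute (T i) (T j) := by
  rcases h with h | h
  · exact H.comm i j h hj
  · exact (H.comm j i h hi).symm

theorem smul_murphy_succ (hq : q ≠ 0) (k : ℕ) :
    q • murphy q T (k + 1) = T k * murphy q T k * T k + T k := by
  rw [murphy, smul_smul, mul_inv_cancel₀ hq, one_smul]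

theorem IsHeckeFamily.commute_murphy_of_lt (H : IsHeckeFamily n q T) {i m : ℕ} (hi : i + 1 < n)
    (hm : m < i) : Commute (T i) (murphy q T m) := by
  induction m with
  | zero => exact Commute.zero_right _
  | succ m ih =>
    have h1 : Commute (T i) (T m) := H.commute hi (by omega) (Or.inr (by omega))
    have h2 := ih (by omega)
    exact (((h1.mul_right h2).mul_right h1).add_right h1).smul_right _

/-- Only the element of index `i + 2` needs an argument. With `a = T_i`, `b = T_{i+1}` and `J =
J_i`, its multiple by `q²` is `b a J a b + (b a b + q b)`. The braid relation carries `a` through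
the first term, and the quadratic relation shows that `a` commutes with the bracket. -/
theorem IsHeckeFamily.commute_murphy_of_gt (H : IsHeckeFamily n q T) (hq : q ≠ 0) {i m : ℕ}
    (hm : m < n) (hi : i + 1 < m) : Commute (T i) (murphy q T m) := by
  induction m with
  | zero => omega
  | succ m ih =>
    rcases (Nat.lt_succ_iff.1 hi).lt_or_eq with h | h
    · have h1 : Commute (T i) (T m) := H.commute (by omega) (by omega) (Or.inl (by omega))
      have h2 := ih (by omega) h
      exact (((h1.mul_right h2).mul_right h1).add_right h1).smul_right _
    · subst h
      have hJ : Commute (T (i + 1)) (murphy q T i) := H.commute_murphy_of_lt hm (by omega)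
      have hb := H.braid i (by omega)
      have hqa := H.quad i (by omega)
      set a := T i
      set b := T (i + 1)
      set J := murphy q T i
      have key : q • (b * murphy q T (i + 1) * b + b)
          = b * a * J * a * b + (b * a * b + q • b) := by
        have := smul_murphy_succ (T := T) hq i
        calc q • (b * murphy q T (i + 1) * b + b)
            = b * (q • murphy q T (i + 1)) * b + q • b := by
              rw [smul_add, mul_smul_comm, smul_mul_assoc]
          _ = _ := by rw [this]; noncomm_ring
      have c1 : Commute a (b * a * J * a * b) := by
        have e1 : b * a * b = a * b * a := hb.symm
        calc a * (b * a * J * a * b) = (a * b * a) * J * a * b := by noncomm_ring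
          _ = b * a * (b * J) * a * b := by rw [← e1]; noncomm_ring
          _ = b * a * J * (b * a * b) := by rw [hJ.eq]; noncomm_ring
          _ = b * a * J * a * b * a := by rw [e1]; noncomm_ring
      have c2 : Commute a (b * a * b + q • b) := by
        have e1 : b * a * b = a * b * a := hb.symm
        have l : a * (b * a * b + q • b) = (a * a) * b * a + q • (a * b) := by
          rw [e1, mul_add, mul_smul_comm]; noncomm_ring
        have r : (b * a * b + q • b) * a = a * b * (a * a) + q • (b * a) := by
          rw [e1, add_mul, smul_mul_assoc]; noncomm_ring
        change a * _ = _ * a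
        rw [l, r, hqa]
        simp only [add_mul, mul_add, smul_mul_assoc, mul_smul_comm, one_mul, mul_one]
        abel
      have h3 : Commute a (q • (b * murphy q T (i + 1) * b + b)) := by
        rw [key]; exact c1.add_right c2
      have h4 := h3.smul_right q⁻¹
      rw [smul_smul, inv_mul_cancel₀ hq, one_smul] at h4
      exact h4.smul_right q⁻¹

theorem IsHeckeFamily.commute_murphy (H : IsHeckeFamily n q T) (hq : q ≠ 0) {a b : ℕ}
    (ha : a < n) (hb : b < n) : Commute (murphy q T a) (murphy q T b) := by
  have key : ∀ a b, a < b → b < n → Commute (murphy q T a) (murphy q T b) := by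
    intro a b hab hbn
    induction a with
    | zero => exact Commute.zero_left _
    | succ a ih =>
      have h1 : Commute (T a) (murphy q T b) := H.commute_murphy_of_gt hq hbn (by omega)
      have h2 := ih (by omega)
      exact (((h1.mul_left h2).mul_left h1).add_left h1).smul_left _
  rcases lt_trichotomy a b with h | rfl | h
  · exact key a b h hb
  · exact Commute.refl _
  · exact (key b a h ha).symm

/-- Multiplying `q J_{i+1} = T_i J_i T_i + T_i` by `T_i` and reducing `T_i²` by the quadratic
relation avoids any use of the inverse of `T_i`. -/
theorem IsHeckeFamily.mul_murphy (H : IsHeckeFamily n q T) (hq : q ≠ 0) {i : ℕ} (hi : i + 1 < n) :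
    T i * murphy q T i = murphy q T (i + 1) * T i - (1 + (q - 1) • murphy q T (i + 1)) := by
  have h1 := smul_murphy_succ (T := T) hq i
  have h2 := H.quad i hi
  have h3 : q • (murphy q T (i + 1) * T i) =
      q • (T i * murphy q T i) + (q - 1) • (q • murphy q T (i + 1)) + q • (1 : A) := by
    rw [← smul_mul_assoc, h1, add_mul, mul_assoc, h2]
    simp only [mul_add, mul_smul_comm, mul_one]
    module
  have h4 := congrArg (q⁻¹ • ·) h3
  simp only [smul_add, smul_smul, inv_mul_cancel₀ hq, one_smul] at h4
  rw [h4, mul_comm (q - 1) q, inv_mul_cancel_left₀ hq]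
  abel

theorem IsHeckeFamily.murphy_mul (H : IsHeckeFamily n q T) (hq : q ≠ 0) {i : ℕ} (hi : i + 1 < n) :
    murphy q T i * T i = T i * murphy q T (i + 1) - (1 + (q - 1) • murphy q T (i + 1)) := by
  have h1 := smul_murphy_succ (T := T) hq i
  have h2 := H.quad i hi
  have h3 : q • (T i * murphy q T (i + 1)) =
      q • (murphy q T i * T i) + (q - 1) • (q • murphy q T (i + 1)) + q • (1 : A) := by
    rw [← mul_smul_comm, h1, mul_add, mul_assoc, ← mul_assoc, h2]
    simp only [add_mul, smul_mul_assoc, one_mul]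
    module
  have h4 := congrArg (q⁻¹ • ·) h3
  simp only [smul_add, smul_smul, inv_mul_cancel₀ hq, one_smul] at h4
  rw [h4, mul_comm (q - 1) q, inv_mul_cancel_left₀ hq]
  abel

/-- The product `∏_{k < m} (x - J_k)`. -/
def murphyChar (q : ℂ) (T : ℕ → A) (x : ℂ) : ℕ → A
  | 0 => 1
  | k + 1 => murphyChar q T x k * (x • (1 : A) - murphy q T k)

/-- All factors except those of index `i` and `i + 1` commute with `T_i` one by one. The product of
these two is a combination of `1`, `J_i + J_{i+1}` and `J_i J_{i+1}`, all of which commute with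
`T_i`. These central elements later provide the isotypic projectors. -/
theorem IsHeckeFamily.commute_murphyChar (H : IsHeckeFamily n q T) (hq : q ≠ 0) (x : ℂ) {i : ℕ}
    (hi : i + 1 < n) : Commute (T i) (murphyChar q T x n) := by
  have hx : ∀ a : A, Commute a (x • (1 : A)) := fun a => (Commute.one_right a).smul_right x
  have h1 : ∀ m, m ≤ i → Commute (T i) (murphyChar q T x m) := by
    intro m hm
    induction m with
    | zero => exact Commute.one_right _
    | succ m ih =>
      exact (ih (by omega)).mul_right ((hx _).sub_right (H.commute_murphy_of_lt hi (by omega)))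
  have h2 : ∀ m, i + 2 ≤ m → m ≤ n → Commute (T i) (murphyChar q T x m) := by
    intro m hm hmn
    induction m, hm using Nat.le_induction with
    | base =>
      rw [murphyChar, murphyChar, mul_assoc]
      refine (h1 i le_rfl).mul_right ?_
      have e1 := H.mul_murphy hq hi
      have e2 := H.murphy_mul hq hi
      have e3 : Commute (murphy q T i) (murphy q T (i + 1)) :=
        H.commute_murphy hq (by omega) hi
      set J := murphy q T i
      set J' := murphy q T (i + 1)
      set a := T i
      have s1 : Commute a (J + J') := by
        change a * (J + J') = (J + J') * a
        rw [mul_add, add_mul, e1, e2]; abel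
      have s2 : Commute a (J * J') := by
        change a * (J * J') = J * J' * a
        calc a * (J * J') = J' * (a * J' - (1 + (q - 1) • J')) := by
              rw [← mul_assoc, e1]
              simp only [sub_mul, mul_sub, add_mul, mul_add, smul_mul_assoc, mul_smul_comm,
                one_mul, mul_one, mul_assoc]
          _ = J * J' * a := by rw [← e2, ← mul_assoc, e3.eq]
      have e4 : (x • (1 : A) - J) * (x • (1 : A) - J') =
          (x * x) • (1 : A) - x • (J + J') + J * J' := by
        simp only [sub_mul, mul_sub, smul_mul_assoc, mul_smul_comm, one_mul, mul_one]
        module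
      rw [e4]
      exact ((((Commute.one_right a).smul_right _).sub_right (s1.smul_right x)).add_right s2)
    | succ m hm ih =>
      exact (ih (by omega)).mul_right ((hx _).sub_right (H.commute_murphy_of_gt hq (by omega) (by omega)))
  exact h2 n (by omega) le_rfl

end Family

/-! ## `q`-integers -/

theorem qInt_zero (q : ℂ) : qInt q 0 = 0 := by
  simp [qInt]

theorem qInt_natCast (q : ℂ) (m : ℕ) : qInt q m = ∑ i ∈ Finset.range m, q ^ i := rfl

theorem qInt_add_one {q : ℂ} (hq : q ≠ 0) (c : ℤ) : qInt q (c + 1) = q * qInt q c + 1 := by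
  rcases c with m | m
  · change ∑ i ∈ Finset.range (m + 1), q ^ i = q * ∑ i ∈ Finset.range m, q ^ i + 1
    rw [Finset.sum_range_succ', Finset.mul_sum]
    simp [pow_succ']
  · rcases m with _ | m
    · change qInt q 0 = _
      rw [qInt_zero, qInt]; simp [hq]
    · have e : Int.negSucc (m + 1) + 1 = Int.negSucc m := by omega
      rw [e]
      change -∑ i ∈ Finset.range (m + 1), (q ^ (i + 1))⁻¹ =
        q * -∑ i ∈ Finset.range (m + 1 + 1), (q ^ (i + 1))⁻¹ + 1
      rw [Finset.sum_range_succ' _ (m + 1), mul_neg, mul_add, Finset.mul_sum]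
      have : ∀ i, q * (q ^ (i + 1 + 1))⁻¹ = (q ^ (i + 1))⁻¹ := by
        intro i; field_simp; ring
      simp only [this]; field_simp; ring

theorem qInt_one {q : ℂ} (hq : q ≠ 0) : qInt q 1 = 1 := by
  have := qInt_add_one hq 0
  rwa [zero_add, qInt_zero, mul_zero, zero_add] at this

/-- This takes the place of `[c]_q = (q^c - 1) / (q - 1)` and holds at `q = 1` too. -/
theorem one_add_qInt {q : ℂ} (hq : q ≠ 0) (c : ℤ) : 1 + (q - 1) * qInt q c = q ^ c := by
  induction c using Int.induction_on with
  | zero => simp [qInt_zero]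
  | succ c ih => rw [qInt_add_one hq, zpow_add_one₀ hq, ← ih]; ring
  | pred c ih =>
    have h := qInt_add_one hq (-(c : ℤ) - 1)
    rw [sub_add_cancel] at h
    rw [h] at ih
    rw [zpow_sub_one₀ hq, ← ih]; field_simp; ring

theorem qInt_sub {q : ℂ} (hq : q ≠ 0) (a b : ℤ) :
    qInt q a - qInt q b = q ^ b * qInt q (a - b) := by
  have h : ∀ d : ℤ, qInt q (b + d) = qInt q b + q ^ b * qInt q d := by
    intro d
    induction d using Int.induction_on with
    | zero => simp [qInt_zero]
    | succ d ih =>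
      rw [← add_assoc, qInt_add_one hq, ih, qInt_add_one hq d, ← one_add_qInt hq b]; ring
    | pred d ih =>
      have h1 := qInt_add_one hq (-(d : ℤ) - 1)
      have h2 := qInt_add_one hq (b + (-(d : ℤ) - 1))
      rw [sub_add_cancel] at h1
      rw [show b + (-(d : ℤ) - 1) + 1 = b + -(d : ℤ) by ring] at h2
      rw [h1, h2, ← one_add_qInt hq b] at ih
      rw [← one_add_qInt hq b]
      have : q * qInt q (b + (-(d : ℤ) - 1)) =
        q * (qInt q b + (1 + (q - 1) * qInt q b) * qInt q (-(d : ℤ) - 1)) := by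
        linear_combination ih
      exact mul_left_cancel₀ hq this
  have := h (a - b)
  rw [add_sub_cancel] at this
  rw [this]; ring

/-- The `q`-integers `[1]_q, …, [n]_q` do not vanish. -/
def QNonzero (n : ℕ) (q : ℂ) : Prop := ∀ k : ℕ, 1 ≤ k → k ≤ n → qInt q k ≠ 0

theorem QNonzero.mono {n m : ℕ} {q : ℂ} (h : QNonzero n q) (hm : m ≤ n) : QNonzero m q :=
  fun k h1 h2 => h k h1 (h2.trans hm)

theorem QNonzero.ne_zero {n : ℕ} {q : ℂ} (h : QNonzero n q) (hq : q ≠ 0) {d : ℤ} (hd : d ≠ 0)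
    (h1 : -(n : ℤ) ≤ d) (h2 : d ≤ n) : qInt q d ≠ 0 := by
  rcases lt_or_gt_of_ne hd with hd | hd
  · have e := qInt_sub hq 0 d
    rw [qInt_zero, zero_sub, zero_sub] at e
    have h3 := h (-d).toNat (by omega) (by omega)
    rw [Int.toNat_of_nonneg (by omega)] at h3
    intro h0
    rw [h0, neg_zero] at e
    exact (mul_ne_zero (zpow_ne_zero d hq) h3) e.symm
  · have h3 := h d.toNat (by omega) (by omega)
    rwa [Int.toNat_of_nonneg (by omega)] at h3

/-- Contents that have to be told apart never differ by more than `n`, so their q-integers determine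
them. -/
theorem QNonzero.inj {n : ℕ} {q : ℂ} (h : QNonzero n q) (hq : q ≠ 0) {a b : ℤ}
    (h1 : -(n : ℤ) ≤ a - b) (h2 : a - b ≤ n) (hab : qInt q a = qInt q b) : a = b := by
  by_contra hne
  have e := qInt_sub hq a b
  rw [hab, sub_self] at e
  exact mul_ne_zero (zpow_ne_zero b hq) (h.ne_zero hq (sub_ne_zero.2 hne) h1 h2) e.symm


/-! ## Lattice words -/

/-- The number of letters `i` among the first `k` letters of `r`. -/
def cnt (r : ℕ → ℕ) (k i : ℕ) : ℕ := Finset.card {m ∈ Finset.range k | r m = i}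

/-- The first `n` letters of `r` form a lattice word: they are the rows of the entries of a standard
tableau. -/
def IsLattice (n : ℕ) (r : ℕ → ℕ) : Prop := ∀ k ≤ n, ∀ i, cnt r k (i + 1) ≤ cnt r k i

/-- A cell can be added to the row `i` of the partition `a`. -/
def Addable (a : ℕ → ℕ) (i : ℕ) : Prop := ∀ j, j + 1 = i → a i < a j

/-- The content of the `k`-th cell of the tableau given by a lattice word. -/
def cont (r : ℕ → ℕ) (k : ℕ) : ℤ := (cnt r k (r k) : ℤ) - r k

/-- The word `r` with the letters in the positions `k` and `k + 1` exchanged. -/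
def sw (k : ℕ) (r : ℕ → ℕ) : ℕ → ℕ := r ∘ Equiv.swap k (k + 1)

variable {n : ℕ} {r : ℕ → ℕ}

@[simp] theorem cnt_zero (r : ℕ → ℕ) (i : ℕ) : cnt r 0 i = 0 := by simp [cnt]

theorem cnt_succ (r : ℕ → ℕ) (k i : ℕ) : cnt r (k + 1) i = cnt r k i + if r k = i then 1 else 0 := by
  rw [cnt, Finset.range_add_one, Finset.filter_insert]
  split_ifs with h
  · rw [Finset.card_insert_of_notMem (by simp)]; rfl
  · rfl

theorem cnt_congr {r r' : ℕ → ℕ} {k : ℕ} (h : ∀ m < k, r m = r' m) : cnt r k = cnt r' k := by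
  funext i
  exact congrArg _ (Finset.filter_congr fun m hm => by rw [h m (Finset.mem_range.1 hm)])

theorem cnt_mono (r : ℕ → ℕ) {k l : ℕ} (h : k ≤ l) (i : ℕ) : cnt r k i ≤ cnt r l i :=
  Finset.card_le_card (Finset.filter_subset_filter _ (Finset.range_subset_range.2 h))

theorem sum_cnt (r : ℕ → ℕ) (k b : ℕ) :
    ∑ i ∈ Finset.range b, cnt r k i = Finset.card {m ∈ Finset.range k | r m < b} := by
  rw [Finset.card_eq_sum_card_fiberwise (f := r) (t := Finset.range b)
    (by intro c hc; simpa using (Finset.mem_filter.1 (Finset.mem_coe.1 hc)).2)]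
  refine Finset.sum_congr rfl fun i hi => ?_
  rw [cnt, Finset.filter_filter]
  congr 1
  refine Finset.filter_congr fun c _ => ?_
  have := Finset.mem_range.1 hi
  omega

theorem sum_cnt_le (r : ℕ → ℕ) (k b : ℕ) : ∑ i ∈ Finset.range b, cnt r k i ≤ k := by
  rw [sum_cnt]
  exact (Finset.card_filter_le _ _).trans (by simp)

theorem IsLattice.mono (h : IsLattice n r) {m : ℕ} (hm : m ≤ n) : IsLattice m r :=
  fun k hk => h k (hk.trans hm)

theorem IsLattice.congr {r' : ℕ → ℕ} (h : IsLattice n r) (e : ∀ m < n, r m = r' m) :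
    IsLattice n r' := by
  intro k hk i
  rw [← cnt_congr fun m hm => e m (hm.trans_le hk)]
  exact h k hk i

theorem IsLattice.antitone (h : IsLattice n r) {k : ℕ} (hk : k ≤ n) : Antitone (cnt r k) :=
  antitone_nat_of_succ_le (h k hk)

theorem isLattice_succ {n : ℕ} {r : ℕ → ℕ} :
    IsLattice (n + 1) r ↔ IsLattice n r ∧ Addable (cnt r n) (r n) := by
  constructor
  · refine fun h => ⟨h.mono (Nat.le_succ n), fun j hj => ?_⟩
    have := h (n + 1) le_rfl j
    rw [cnt_succ, cnt_succ, hj] at this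
    split_ifs at this <;> omega
  · rintro ⟨h, ha⟩ k hk i
    rcases hk.lt_or_eq with hk | rfl
    · exact h k (by omega) i
    · have h1 := h n le_rfl i
      have h2 := ha i
      rw [cnt_succ, cnt_succ]
      split_ifs with e1 e2
      · omega
      · rw [← e1] at h1 h2 ⊢; have := h2 rfl; omega
      · omega
      · omega

theorem IsLattice.addable (h : IsLattice n r) {k : ℕ} (hk : k < n) : Addable (cnt r k) (r k) :=
  (isLattice_succ.1 (h.mono hk)).2

/-- If row `j` can be extended, the rows above it are nonempty, so together they contain at least
`cnt r m i + (j - 1)` cells. -/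
theorem Addable.add_le {m : ℕ} (h : IsLattice m r) {i j : ℕ} (hj : Addable (cnt r m) j)
    (hij : i < j) : cnt r m i + j ≤ m + 1 := by
  obtain ⟨l, rfl⟩ : ∃ l, j = l + 1 := ⟨j - 1, by omega⟩
  have hl := hj l rfl
  have h1 := sum_cnt_le r m (l + 1)
  have h2 : ∑ x ∈ Finset.range (l + 1), (if x = i then cnt r m i - 1 else 0) + (l + 1) ≤
      ∑ x ∈ Finset.range (l + 1), cnt r m x := by
    have h0 : ∑ x ∈ Finset.range (l + 1), 1 = l + 1 := by simp
    refine le_trans (le_of_eq ?_) (Finset.sum_le_sum (s := Finset.range (l + 1))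
      (f := fun x => (if x = i then cnt r m i - 1 else 0) + 1) ?_)
    · rw [Finset.sum_add_distrib, h0]
    intro x hx
    have h3 := h.antitone le_rfl (Nat.lt_succ_iff.1 (Finset.mem_range.1 hx))
    split_ifs with e
    · subst e; omega
    · omega
  rw [Finset.sum_ite_eq' (Finset.range (l + 1)) i, if_pos (Finset.mem_range.2 hij)] at h2
  omega

theorem Addable.le {m : ℕ} (h : IsLattice m r) {j : ℕ} (hj : Addable (cnt r m) j) : j ≤ m := by
  rcases Nat.eq_zero_or_pos j with rfl | h0
  · omega
  · have := hj.add_le h (i := j - 1) (by omega)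
    have h2 := hj (j - 1) (by omega)
    omega

/-- The contents of distinct addable cells differ by at least two and by at most the size of the
partition plus one. -/
theorem Addable.content {m : ℕ} (h : IsLattice m r) {i j : ℕ} 
    (hj : Addable (cnt r m) j) (hij : i < j) :
    2 ≤ ((cnt r m i : ℤ) - i) - (cnt r m j - j) ∧
      ((cnt r m i : ℤ) - i) - (cnt r m j - j) ≤ m + 1 := by
  have h1 := hj.add_le h hij
  have h2 := hj (j - 1) (by omega)
  have h3 := h.antitone le_rfl (show i ≤ j - 1 by omega)
  omega

theorem IsLattice.le (h : IsLattice n r) {k : ℕ} (hk : k < n) : r k ≤ k :=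
  (h.addable hk).le (h.mono hk.le)

theorem cnt_le (r : ℕ → ℕ) (k i : ℕ) : cnt r k i ≤ k :=
  (Finset.card_filter_le _ _).trans (by simp)

/-- A later cell of content `0` is not in the first row, so it needs at least three cells before it,
those of the rest of a `2 × 2` square. This is why `0` may be left out for the second and the third
entry. -/
theorem IsLattice.cont_mem (h : IsLattice n r) {k : ℕ} (hk : k < n) :
    cont r k ∈ contents (k + 1) := by
  have h1 := h.le hk
  have h2 := cnt_le r k (r k)
  have h3 : cont r k ∈ Finset.Ioo (-((k + 1 : ℕ) : ℤ)) ((k + 1 : ℕ) : ℤ) := by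
    rw [Finset.mem_Ioo, cont]; omega
  rw [contents]
  split_ifs with h0
  · refine Finset.mem_erase.2 ⟨fun hc => ?_, h3⟩
    rw [cont] at hc
    have h4 : r 0 = 0 := by have := h.le (k := 0) (by omega); omega
    rcases Nat.eq_zero_or_pos (r k) with e | e
    · rw [e] at hc
      have h5 := cnt_mono r (show 1 ≤ k by omega) 0
      rw [cnt_succ, if_pos h4] at h5
      omega
    · have h5 := h.addable hk (r k - 1) (by omega)
      have h6 := h.antitone hk.le (Nat.zero_le (r k - 1))
      have h7 := sum_cnt_le r k (r k + 1)
      have h8 : cnt r k 0 ≤ ∑ i ∈ Finset.range (r k), cnt r k i :=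
        Finset.single_le_sum (f := cnt r k) (fun _ _ => Nat.zero_le _) (Finset.mem_range.2 e)
      rw [Finset.sum_range_succ] at h7
      omega
  · exact h3

/-! ### Exchanging adjacent letters -/

theorem sw_left (k : ℕ) (r : ℕ → ℕ) : sw k r k = r (k + 1) := by simp [sw]

theorem sw_right (k : ℕ) (r : ℕ → ℕ) : sw k r (k + 1) = r k := by simp [sw]

theorem sw_of_ne {k m : ℕ} (r : ℕ → ℕ) (h1 : m ≠ k) (h2 : m ≠ k + 1) : sw k r m = r m := by
  simp [sw, Equiv.swap_apply_of_ne_of_ne h1 h2]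

@[simp] theorem sw_sw (k : ℕ) (r : ℕ → ℕ) : sw k (sw k r) = r := by
  funext m; simp [sw]

theorem cnt_sw_of_le {k m : ℕ} (r : ℕ → ℕ) (h : m ≤ k) : cnt (sw k r) m = cnt r m :=
  cnt_congr fun x hx => sw_of_ne r (by omega) (by omega)

theorem cnt_sw_of_ge {k m : ℕ} (r : ℕ → ℕ) (h : k + 2 ≤ m) : cnt (sw k r) m = cnt r m := by
  induction m, h using Nat.le_induction with
  | base =>
    funext i
    rw [cnt_succ, cnt_succ, cnt_succ, cnt_succ, cnt_sw_of_le r le_rfl, sw_left, sw_right]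
    omega
  | succ m hm ih =>
    funext i
    rw [cnt_succ, cnt_succ, ih, sw_of_ne r (by omega) (by omega)]

theorem cont_sw_of_ne {k m : ℕ} (r : ℕ → ℕ) (h1 : m ≠ k) (h2 : m ≠ k + 1) :
    cont (sw k r) m = cont r m := by
  rw [cont, cont, sw_of_ne r h1 h2]
  rcases lt_or_gt_of_ne h1 with h | h
  · rw [cnt_sw_of_le r h.le]
  · rw [cnt_sw_of_ge r (by omega)]

theorem cont_sw_left {k : ℕ} (h : r k ≠ r (k + 1)) : cont (sw k r) k = cont r (k + 1) := by
  rw [cont, cont, sw_left, cnt_sw_of_le r le_rfl, cnt_succ, if_neg h, add_zero]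

theorem cont_sw_right {k : ℕ} (h : r k ≠ r (k + 1)) : cont (sw k r) (k + 1) = cont r k := by
  rw [cont, cont, sw_right, cnt_succ, cnt_sw_of_le r le_rfl, sw_left, if_neg (Ne.symm h), add_zero]

theorem IsLattice.sw (h : IsLattice n r) {k : ℕ} (ha : Addable (cnt r k) (r (k + 1))) :
    IsLattice n (sw k r) := by
  intro m hm i
  rcases lt_trichotomy m (k + 1) with hk | rfl | hk
  · rw [cnt_sw_of_le r (by omega)]; exact h m hm i
  · have : IsLattice (k + 1) (QShuffle.sw k r) := by
      rw [isLattice_succ, sw_left, cnt_sw_of_le r le_rfl]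
      exact ⟨(h.mono (by omega)).congr fun x hx => (sw_of_ne r (by omega) (by omega)).symm, ha⟩
    exact this _ le_rfl i
  · rw [cnt_sw_of_ge r (by omega)]; exact h m hm i

theorem IsLattice.addable_of_sw {k : ℕ} (hk : k + 1 < n) (h : IsLattice n (QShuffle.sw k r)) :
    Addable (cnt r k) (r (k + 1)) := by
  have := h.addable (k := k) (by omega)
  rwa [sw_left, cnt_sw_of_le r le_rfl] at this

/-- Whether row `r (k + 1)` can be extended depends on its length and on that of the row above it,
and a cell added in a lower row changes neither. -/
theorem IsLattice.addable_of_gt (h : IsLattice n r) {k : ℕ} (hk : k + 1 < n)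
    (hd : r (k + 1) < r k) : Addable (cnt r k) (r (k + 1)) := by
  intro j hj
  have := h.addable hk j hj
  rwa [cnt_succ, cnt_succ, if_neg (by omega), if_neg (by omega)] at this

/-- Distance of the contents of adjacent entries that can be exchanged. -/
theorem IsLattice.cont_dist (h : IsLattice n r) {k : ℕ} (hk : k + 1 < n)
    (ha : Addable (cnt r k) (r (k + 1))) (hne : r k ≠ r (k + 1)) :
    (2 ≤ cont r k - cont r (k + 1) ∨ cont r k - cont r (k + 1) ≤ -2) ∧
      -(n : ℤ) < cont r k - cont r (k + 1) ∧ cont r k - cont r (k + 1) < n := by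
  have hL := h.mono (show k ≤ n by omega)
  have hb := h.addable (k := k) (by omega)
  have e : cont r (k + 1) = (cnt r k (r (k + 1)) : ℤ) - r (k + 1) := by
    rw [cont, cnt_succ, if_neg hne, add_zero]
  rw [e, cont]
  rcases lt_or_gt_of_ne hne with hlt | hlt
  · have := ha.content hL hlt; omega
  · have := hb.content hL hlt; omega

/-- Inside a tableau the last cell can be moved to any other corner by exchanging entries. -/
theorem exists_last (R : (ℕ → ℕ) → (ℕ → ℕ) → Prop) (hrefl : ∀ r, R r r)
    (htrans : ∀ r r' r'', R r r' → R r' r'' → R r r'') {j n : ℕ}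
    (hsw : ∀ r k, j ≤ k → k + 1 < n → IsLattice n r → IsLattice n (sw k r) → r k ≠ r (k + 1) →
      R r (sw k r)) {m : ℕ} (hm : m < n) (r : ℕ → ℕ) (hr : IsLattice n r) {e : ℕ}
    (he : cnt r (m + 1) (e + 1) < cnt r (m + 1) e) (hje : cnt r j e < cnt r (m + 1) e) :
    ∃ r', IsLattice n r' ∧ R r r' ∧ (∀ x, x < j ∨ m < x → r' x = r x) ∧ r' m = e ∧
      cnt r' (m + 1) = cnt r (m + 1) := by
  induction m generalizing r with
  | zero =>
    refine ⟨r, hr, hrefl r, fun _ _ => rfl, ?_, rfl⟩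
    by_contra hne
    rw [zero_add, cnt_succ _ 0 e, if_neg hne] at he
    simp at he
  | succ m ih =>
    by_cases hre : r (m + 1) = e
    · exact ⟨r, hr, hrefl r, fun _ _ => rfl, hre, rfl⟩
    have h1 : cnt r (m + 1 + 1) e = cnt r (m + 1) e := by rw [cnt_succ, if_neg hre, add_zero]
    have h2 := cnt_mono r (show m + 1 ≤ m + 1 + 1 by omega) (e + 1)
    -- The letter in position `m + 1` is not `e`, so row `e` ends in a corner already after `m + 1`
    -- letters. Its letter is first brought to position `m` and then exchanged with its neighbour.
    obtain ⟨r1, hr1, hR, hag, hlast, hcnt⟩ := ih (by omega) r hr (by omega) (by omega)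
    have hjm : j ≤ m := by
      by_contra hjm
      have := cnt_mono r (show m + 1 ≤ j by omega) e
      omega
    have e1 : r1 (m + 1) = r (m + 1) := hag _ (Or.inr (by omega))
    have hne : r1 m ≠ r1 (m + 1) := by rw [e1, hlast]; exact Ne.symm hre
    -- Only a letter `e + 1` in position `m + 1` could depend on the cell of row `e` placed just
    -- before it. Since row `e` still exceeds row `e + 1` after both letters, there is room for
    -- either order.
    have hadd : Addable (cnt r1 m) (r1 (m + 1)) := by
      intro l hl
      have h3 := hr1.addable hm l hl
      rw [cnt_succ, cnt_succ, if_neg hne, add_zero] at h3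
      split_ifs at h3 with h4
      · have h5 : l = e := by omega
        have h6 := hcnt ▸ cnt_succ r1 m (l + 1)
        have h7 := hcnt ▸ cnt_succ r1 m l
        have h8 := cnt_succ r (m + 1) (l + 1)
        rw [if_pos h4] at h7
        rw [if_pos (by omega)] at h8
        rw [if_neg (by omega)] at h6
        subst h5
        rw [← hl]
        omega
      · omega
    have hs := hr1.sw hadd
    have hcs : cnt (sw m r1) (m + 1 + 1) = cnt r (m + 1 + 1) := by
      rw [cnt_sw_of_ge r1 (by omega)]
      funext i
      rw [cnt_succ r1 (m + 1), cnt_succ r (m + 1), e1, hcnt]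
    exact ⟨sw m r1, hs, htrans _ _ _ hR (hsw r1 m hjm hm hr1 hs hne),
      fun x hx => (sw_of_ne r1 (by omega) (by omega)).trans (hag x (by omega)),
      by rw [sw_right, hlast], hcs⟩

/-- Two standard fillings of the same skew shape are connected by exchanges of adjacent entries. -/
theorem lattice_connected (R : (ℕ → ℕ) → (ℕ → ℕ) → Prop) (hrefl : ∀ r, R r r)
    (htrans : ∀ r r' r'', R r r' → R r' r'' → R r r'') {j n : ℕ}
    (hsw : ∀ r k, j ≤ k → k + 1 < n → IsLattice n r → IsLattice n (sw k r) → r k ≠ r (k + 1) →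
      R r (sw k r)) {r r' : ℕ → ℕ} (hr : IsLattice n r) (hr' : IsLattice n r')
    (hag : ∀ x, x < j ∨ n ≤ x → r x = r' x) (hcnt : cnt r n = cnt r' n) : R r r' := by
  suffices H : ∀ m ≤ n, ∀ r, IsLattice n r → (∀ x, x < j ∨ m ≤ x → r x = r' x) →
      cnt r m = cnt r' m → R r r' from H n le_rfl r hr hag hcnt
  intro m hm
  induction m with
  | zero =>
    intro r _ hag _
    rw [show r = r' from funext fun x => hag x (Or.inr (Nat.zero_le x))]
    exact hrefl _
  | succ m ih =>
    intro r hr hag hcnt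
    rcases lt_or_ge m j with hj | hj
    · rw [show r = r' from funext fun x => hag x (by omega)]
      exact hrefl _
    have step : ∀ r1, IsLattice n r1 → (∀ x, x < j ∨ m < x → r1 x = r' x) →
        cnt r1 (m + 1) = cnt r' (m + 1) → r1 m = r' m → R r1 r' := by
      intro r1 hr1 hag1 hcnt1 hlast
      refine ih (by omega) r1 hr1 (fun x hx => ?_) (funext fun i => ?_)
      · rcases hx with hx | hx
        · exact hag1 x (Or.inl hx)
        · rcases hx.lt_or_eq with hx | rfl
          · exact hag1 x (Or.inr hx)
          · exact hlast
      · have := congrFun hcnt1 i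
        rw [cnt_succ, cnt_succ, hlast] at this
        omega
    have h1 := hr' m (by omega) (r' m)
    have h2 : cnt r' (m + 1) (r' m) = cnt r' m (r' m) + 1 := by rw [cnt_succ, if_pos rfl]
    have h3 : cnt r' (m + 1) (r' m + 1) = cnt r' m (r' m + 1) := by
      rw [cnt_succ, if_neg (by omega), add_zero]
    have h4 : cnt r j (r' m) = cnt r' j (r' m) := by
      rw [cnt_congr fun x hx => hag x (Or.inl hx)]
    have h5 := cnt_mono r' hj (r' m)
    -- The last letter of `r'` marks a corner of the common shape, and this cell is not among the
    -- first `j`. It can therefore be moved to the end of `r` without touching the first `j`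
    -- positions.
    obtain ⟨r1, hr1, hR, hag1, hlast, hcnt1⟩ := exists_last R hrefl htrans hsw (m := m) (by omega) r hr
      (e := r' m) (by rw [hcnt]; omega) (by rw [hcnt]; omega)
    exact htrans _ _ _ hR (step r1 hr1 (fun x hx => (hag1 x hx).trans (hag x (by omega)))
      (hcnt1.trans hcnt) hlast)

/-! ### The column reading tableau -/

/-- Every partition has a standard tableau whose entries run down the columns. -/
theorem exists_column_lattice (n : ℕ) (r : ℕ → ℕ) (hr : IsLattice n r) :
    ∃ c, IsLattice n c ∧ cnt c n = cnt r n ∧ (∀ p, p + 1 < n →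
        (c (p + 1) = c p + 1 ∧ cnt c p (c p + 1) = cnt c p (c p)) ∨ c (p + 1) = 0) ∧
      ∀ m, n = m + 1 → cnt c n (c m) = cnt c n 0 ∧ cnt c n (c m + 1) < cnt c n 0 := by
  induction n generalizing r with
  | zero => exact ⟨r, hr, rfl, by omega, by omega⟩
  | succ n ih =>
    have hex : ∃ e, cnt r (n + 1) (e + 1) < cnt r (n + 1) 0 := by
      refine ⟨n, ?_⟩
      have h0 : r 0 = 0 := by have := hr.le (k := 0) (by omega); omega
      have h1 := cnt_mono r (show 1 ≤ n + 1 by omega) 0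
      rw [cnt_succ, if_pos h0] at h1
      have h2 : cnt r (n + 1) (n + 1) = 0 := by
        refine Finset.card_eq_zero.2 (Finset.filter_eq_empty_iff.2 fun x hx => ?_)
        have hx := Finset.mem_range.1 hx
        have := hr.le hx
        omega
      omega
    classical
    -- Row `e` contains the bottom cell of the last column: rows `0, …, e` have full length and row
    -- `e + 1` is shorter. Giving this cell the largest entry and recursing fills the columns from
    -- left to right.
    obtain ⟨e, he, hmin⟩ : ∃ e, cnt r (n + 1) (e + 1) < cnt r (n + 1) 0 ∧
        ∀ x < e, ¬ cnt r (n + 1) (x + 1) < cnt r (n + 1) 0 :=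
      ⟨Nat.find hex, Nat.find_spec hex, fun x hx => Nat.find_min hex hx⟩
    have hanti := hr.antitone le_rfl
    have heq : ∀ x ≤ e, cnt r (n + 1) x = cnt r (n + 1) 0 := by
      intro x hx
      rcases Nat.eq_zero_or_pos x with rfl | h0
      · rfl
      · have h1 := hmin (x - 1) (by omega)
        rw [show x - 1 + 1 = x by omega] at h1
        have := hanti (Nat.zero_le x)
        omega
    obtain ⟨r1, hr1, -, -, hlast, hcnt1⟩ := exists_last (fun _ _ => True) (fun _ => trivial)
      (fun _ _ _ _ _ => trivial) (j := 0) (fun _ _ _ _ _ _ _ => trivial) (m := n) (Nat.lt_succ_self n) r hr (e := e)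
      (by rw [heq e le_rfl]; exact he) (by rw [heq e le_rfl, cnt_zero]; omega)
    obtain ⟨c', hc', hcc, hblock, hend⟩ := ih r1 (hr1.mono (Nat.le_succ n))
    have hag : ∀ x < n, c' x = Function.update c' n e x := fun x hx => by
      rw [Function.update_of_ne hx.ne]
    have hcn : cnt (Function.update c' n e) n = cnt r1 n := by rw [← cnt_congr hag, hcc]
    have hcn1 : cnt (Function.update c' n e) (n + 1) = cnt r (n + 1) := by
      rw [← hcnt1]
      funext i
      rw [cnt_succ, cnt_succ, hcn, Function.update_self, hlast]
    refine ⟨Function.update c' n e, isLattice_succ.2 ⟨hc'.congr hag, ?_⟩, hcn1, fun p hp => ?_,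
      fun m hm => ?_⟩
    · rw [hcn, Function.update_self, ← hlast]
      exact hr1.addable (Nat.lt_succ_self n)
    · rw [← cnt_congr fun x (hx : x < p) => hag x (by omega)]
      rcases (Nat.lt_succ_iff.1 hp).lt_or_eq with hp | hp
      · rw [← hag _ hp, ← hag p (by omega)]
        exact hblock p hp
      · rw [hp, Function.update_self, ← hag p (by omega)]
        rcases Nat.eq_zero_or_pos e with h0 | h0
        · exact Or.inr h0
        left
        obtain ⟨h1, h2⟩ := hend p hp.symm
        rw [hcc] at h1 h2
        have hb : ∀ i, cnt r (n + 1) i = cnt r1 n i + if e = i then 1 else 0 := fun i => by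
          rw [← hcnt1, cnt_succ, hlast]
        have b0 := hb 0
        have be := hb e
        have bx := hb (c' p + 1)
        rw [if_neg (by omega)] at b0
        rw [if_pos rfl, heq e le_rfl] at be
        have hlt : c' p < e := by
          by_contra hge
          have := hr1.antitone (Nat.le_succ n) (not_lt.1 hge)
          omega
        have hce : e = c' p + 1 := by
          by_contra hne
          have := heq (c' p + 1) hlt
          rw [if_neg (by omega)] at bx
          omega
        refine ⟨hce, ?_⟩
        have e1 := cnt_succ c' p (c' p)
        have e2 := cnt_succ c' p (c' p + 1)
        rw [if_pos rfl, hp, hcc] at e1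
        rw [if_neg (by omega), hp, hcc] at e2
        rw [if_pos hce] at bx
        have := heq (c' p + 1) (by omega)
        omega
    · obtain rfl : m = n := by omega
      rw [hcn1, Function.update_self]
      exact ⟨heq e le_rfl, he⟩

/-- Positions of a column reading tableau in the same column are joined by steps down. -/
theorem column_steps {n : ℕ} {c : ℕ → ℕ} (hc : ∀ p < n, c p ≤ p)
    (hblock : ∀ p, p + 1 < n → c (p + 1) = c p + 1 ∨ c (p + 1) = 0) {p p' : ℕ} (hp : p' < n)
    (h : p - c p = p' - c p') : ∀ j, p ≤ j → j < p' → c (j + 1) = c j + 1 := by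
  -- The number `p - c p` is the position at which the column through `p` begins. It is constant
  -- along steps down and increases strictly when a new column starts.
  have hmono : ∀ a b, a ≤ b → b < n → a - c a ≤ b - c b := by
    intro a b hab hb
    induction b, hab using Nat.le_induction with
    | base => exact le_rfl
    | succ b hab ih =>
      have := ih (by omega)
      have := hc b (by omega)
      have := hblock b hb
      omega
  intro j hj hjp
  have h1 := hmono p j hj (by omega)
  have h2 := hmono (j + 1) p' hjp hp
  have h3 := hblock j (by omega)
  have h4 := hc j (by omega)
  omega

/-- If the letters of `x` in each column of a column reading tableau are distinct, then at most as
many of them are less than `b` as there are cells in the first `b` rows. -/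
theorem card_lt_le_of_columns {n : ℕ} {c x : ℕ → ℕ} (hc : ∀ p < n, c p ≤ p)
    (hblock : ∀ p, p + 1 < n → c (p + 1) = c p + 1 ∨ c (p + 1) = 0)
    (hx : ∀ p p', p < p' → p' < n → p - c p = p' - c p' → x p ≠ x p') (b : ℕ) :
    Finset.card {p ∈ Finset.range n | x p < b} ≤ Finset.card {p ∈ Finset.range n | c p < b} := by
  suffices H : ∀ N ≤ n, Finset.card {p ∈ Finset.range N | x p < b} ≤
      Finset.card {p ∈ Finset.range N | c p < b} from H n le_rfl
  intro N
  induction N using Nat.strong_induction_on with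
  | _ N ih =>
    intro hN
    rcases Nat.eq_zero_or_pos N with rfl | h0
    · simp
    obtain ⟨p, rfl⟩ : ∃ p, N = p + 1 := ⟨N - 1, by omega⟩
    have hdown : ∀ d ≤ c p, c (p - d) = c p - d := by
      intro d hd
      induction d with
      | zero => simp
      | succ d ihd =>
        have h1 := ihd (by omega)
        have h2 := hc p (by omega)
        have h3 := hblock (p - (d + 1)) (by omega)
        rw [show p - (d + 1) + 1 = p - d by omega] at h3
        omega
    have hcp := hc p (by omega)
    -- The last column occupies the positions `a, …, p`. Its `c p + 1` distinct letters include at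
    -- most `min (c p + 1) b` that are less than `b`, and the column reading word attains this
    -- number. The earlier columns are covered by induction.
    set a := p - c p with ha
    have hca : ∀ i < c p + 1, c (a + i) = i := by
      intro i hi
      have := hdown (c p - i) (by omega)
      rw [show p - (c p - i) = a + i by omega] at this
      omega
    have hsplit : ∀ f : ℕ → ℕ, Finset.card {i ∈ Finset.range (p + 1) | f i < b} =
        Finset.card {i ∈ Finset.range a | f i < b} +
          Finset.card {i ∈ Finset.range (c p + 1) | f (a + i) < b} := by
      intro f
      simp only [Finset.card_filter]
      rw [show p + 1 = a + (c p + 1) by omega, Finset.sum_range_add]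
    rw [hsplit, hsplit]
    refine Nat.add_le_add (ih a (by omega) (by omega)) ?_
    have e1 : Finset.card {i ∈ Finset.range (c p + 1) | c (a + i) < b} = min (c p + 1) b := by
      rw [← Finset.card_range (min (c p + 1) b)]
      congr 1
      ext i
      simp only [Finset.mem_filter, Finset.mem_range, lt_min_iff]
      exact and_congr_right fun hi => by rw [hca i hi]
    rw [e1]
    refine le_min ((Finset.card_filter_le _ _).trans (by simp)) ?_
    rw [← Finset.card_range b]
    refine Finset.card_le_card_of_injOn (fun i => x (a + i)) ?_ ?_
    · intro i hi
      rw [Finset.mem_coe, Finset.mem_filter] at hi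
      simpa using hi.2
    · intro i hi i' hi' hii
      rw [Finset.mem_coe, Finset.mem_filter, Finset.mem_range] at hi hi'
      by_contra hne
      rcases lt_or_gt_of_ne hne with h | h
      · exact hx (a + i) (a + i') (by omega) (by omega)
          (by rw [hca i hi.1, hca i' hi'.1]; omega) hii
      · exact hx (a + i') (a + i) (by omega) (by omega)
          (by rw [hca i hi.1, hca i' hi'.1]; omega) hii.symm


/-! ## Elements of the Hecke algebra -/

section Elements

variable {n : ℕ} {q : ℂ}

theorem heckeT_of_lt {i : ℕ} (h : i + 1 < n) : heckeT n q i = gen n q ⟨i, h⟩ := dif_pos h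

theorem isHeckeFamily_heckeT (n : ℕ) (q : ℂ) : IsHeckeFamily n q (heckeT n q) where
  quad i hi := by
    rw [heckeT_of_lt hi, gen_quadratic, Algebra.algebraMap_eq_smul_one]
  comm i j hij hj := by
    rw [heckeT_of_lt (show i + 1 < n by omega), heckeT_of_lt hj]
    exact gen_comm n q _ _ hij
  braid i hi := by
    rw [heckeT_of_lt (show i + 1 < n by omega), heckeT_of_lt (show i + 1 + 1 < n by omega)]
    exact gen_braid n q _ _ rfl

/-! ### Recursions for the shuffling elements -/

theorem descProd_self (n : ℕ) (q : ℂ) (i : ℕ) : descProd n q i i = 1 := by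
  simp [descProd]

theorem ascProd_self (n : ℕ) (q : ℂ) (i : ℕ) : ascProd n q i i = 1 := by
  simp [ascProd]

theorem descProd_succ (n : ℕ) (q : ℂ) {i m : ℕ} (h : i ≤ m) :
    descProd n q i (m + 1) = heckeT n q m * descProd n q i m := by
  simp [descProd, List.Ico.succ_top h]

theorem ascProd_succ (n : ℕ) (q : ℂ) {i m : ℕ} (h : i ≤ m) :
    ascProd n q i (m + 1) = ascProd n q i m * heckeT n q m := by
  simp [ascProd, List.Ico.succ_top h]

theorem bottomToRandom_one (n : ℕ) (q : ℂ) : bottomToRandom n q 1 = 1 := by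
  simp [bottomToRandom, descProd_self]

theorem bottomToRandom_succ (n : ℕ) (q : ℂ) (m : ℕ) :
    bottomToRandom n q (m + 2) = 1 + heckeT n q m * bottomToRandom n q (m + 1) := by
  rw [bottomToRandom, bottomToRandom, Finset.sum_range_succ, add_comm, Finset.mul_sum]
  congr 1
  · exact descProd_self n q _
  · refine Finset.sum_congr rfl fun i hi => ?_
    have := Finset.mem_range.1 hi
    exact descProd_succ n q (by omega)

theorem commute_bottomToRandom {i m : ℕ} (hi : i + 1 < n) (hm : m ≤ i) :
    Commute (heckeT n q i) (bottomToRandom n q m) := by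
  have H := isHeckeFamily_heckeT n q
  rcases m with _ | m
  · simp [bottomToRandom]
  · induction m with
    | zero => rw [zero_add, bottomToRandom_one]; exact Commute.one_right _
    | succ m ih =>
      rw [bottomToRandom_succ]
      exact (Commute.one_right _).add_right
        ((H.commute hi (by omega) (Or.inr (by omega))).mul_right (ih (by omega)))

/-- At `q = 1` this says that exchanging the last two cards before both are reinserted at random
changes nothing. For general `q`, the recursion `B_{m+1} = 1 + T B_m` and the braid relation expose
the same product one index lower inside `t B t B`, where the induction hypothesis applies. -/
theorem heckeT_mul_bottomToRandom {i : ℕ} (hi : i + 1 < n) :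
    heckeT n q i * (bottomToRandom n q (i + 1) * bottomToRandom n q (i + 2)) =
      q • (bottomToRandom n q (i + 1) * bottomToRandom n q (i + 2)) := by
  have H := isHeckeFamily_heckeT n q
  induction i with
  | zero =>
    rw [bottomToRandom_succ, zero_add, bottomToRandom_one, one_mul, mul_one, mul_add, mul_one,
      H.quad 0 hi]
    module
  | succ i ih =>
    have ih := ih (by omega)
    have hB : bottomToRandom n q (i + 1 + 1) = 1 + heckeT n q i * bottomToRandom n q (i + 1) :=
      bottomToRandom_succ n q i
    have hc : Commute (heckeT n q (i + 1)) (bottomToRandom n q (i + 1)) :=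
      commute_bottomToRandom hi le_rfl
    rw [bottomToRandom_succ n q (i + 1)]
    have hb := H.braid i (by omega)
    have hq := H.quad (i + 1) hi
    rw [show i + 2 = i + 1 + 1 from rfl] at ih
    set t := heckeT n q (i + 1)
    set s := heckeT n q i
    set B := bottomToRandom n q (i + 1 + 1)
    set B' := bottomToRandom n q (i + 1)
    have e1 : t * B * t * B = t * t * B + q • (s * B' * (t * B)) := by
      calc t * B * t * B = t * (1 + s * B') * t * B := by rw [← hB]
        _ = t * t * B + t * s * (B' * t) * B := by noncomm_ring
        _ = t * t * B + (t * s * t) * B' * B := by rw [← hc.eq]; noncomm_ring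
        _ = t * t * B + s * t * (s * (B' * B)) := by rw [← hb]; noncomm_ring
        _ = t * t * B + q • (s * (t * B') * B) := by rw [ih, mul_smul_comm]; noncomm_ring
        _ = _ := by rw [hc.eq]; noncomm_ring
    have e2 : s * B' = B - 1 := by rw [hB]; abel
    calc t * (B * (1 + t * B)) = t * B + t * B * t * B := by noncomm_ring
      _ = t * B + ((q - 1) • t + q • 1) * B + q • ((B - 1) * (t * B)) := by
        rw [e1, e2, hq]; abel
      _ = q • (B * (1 + t * B)) := by
        simp only [add_mul, mul_add, sub_mul, smul_mul_assoc, one_mul, mul_one]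
        module

theorem cProd_self (n : ℕ) (q : ℂ) : cProd n q n = 1 := by
  simp [cProd]

theorem cProd_eq_mul {j : ℕ} (hj : j < n) :
    cProd n q j = bottomToRandom n q (j + 1) * cProd n q (j + 1) := by
  rw [cProd, List.Ico.eq_cons (by omega)]
  simp [cProd]

/-- This identity drives the straightening. The generator commutes with `B_{j+1}, …, B_i`, whose
generators are not adjacent to it, and is then absorbed by `B_{i+1} B_{i+2}`. -/
theorem heckeT_mul_cProd {i j : ℕ} (hi : i + 1 < n) (hj : j ≤ i) :
    heckeT n q i * cProd n q j = q • cProd n q j := by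
  induction hj using Nat.decreasingInduction with
  | self =>
    rw [cProd_eq_mul (j := i) (by omega), cProd_eq_mul hi, ← mul_assoc (bottomToRandom n q _),
      ← mul_assoc, heckeT_mul_bottomToRandom hi, smul_mul_assoc]
  | of_succ j hj ih =>
    rw [cProd_eq_mul (by omega), ← mul_assoc, (commute_bottomToRandom hi (by omega)).eq, mul_assoc,
      ih, mul_smul_comm]

/-- Conjugation by the next generator turns every transposition term of one Jucys-Murphy element
into a term of the next one. The one new term is that generator itself. -/
theorem jucysMurphy_eq (n : ℕ) (q : ℂ) {m : ℕ} (hm : m < n) :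
    jucysMurphy n q (m + 1) = murphy q (heckeT n q) m := by
  have H := isHeckeFamily_heckeT n q
  have conj : ∀ i m, i < m → m + 1 < n →
      heckeT n q m * (ascProd n q i m * descProd n q i (m - 1)) * heckeT n q m =
        ascProd n q i (m + 1) * descProd n q i m := by
    intro i m him hm
    obtain ⟨l, rfl⟩ : ∃ l, m = l + 1 := ⟨m - 1, by omega⟩
    have hc : ∀ k, i ≤ k → k ≤ l → Commute (heckeT n q (l + 1)) (ascProd n q i k) ∧
        Commute (heckeT n q (l + 1)) (descProd n q i k) := by
      intro k hk hkl
      induction k, hk using Nat.le_induction with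
      | base => rw [ascProd_self, descProd_self]; exact ⟨Commute.one_right _, Commute.one_right _⟩
      | succ k hk ih =>
        have hT : Commute (heckeT n q (l + 1)) (heckeT n q k) :=
          H.commute hm (by omega) (Or.inr (by omega))
        have h := ih (by omega)
        rw [ascProd_succ n q hk, descProd_succ n q hk]
        exact ⟨h.1.mul_right hT, hT.mul_right h.2⟩
    obtain ⟨h1, h2⟩ := hc l (by omega) le_rfl
    have hb := H.braid l (by omega)
    rw [Nat.add_sub_cancel, ascProd_succ n q (show i ≤ l + 1 by omega),
      ascProd_succ n q (show i ≤ l by omega), descProd_succ n q (show i ≤ l by omega)]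
    set t := heckeT n q (l + 1)
    set s := heckeT n q l
    set a := ascProd n q i l
    set d := descProd n q i l
    calc t * (a * s * d) * t = (t * a) * s * (d * t) := by noncomm_ring
      _ = a * (t * s * t) * d := by rw [h1.eq, ← h2.eq]; noncomm_ring
      _ = a * s * t * (s * d) := by rw [← hb]; noncomm_ring
  induction m with
  | zero => simp [jucysMurphy, murphy]
  | succ m ih =>
    have ih := ih (by omega)
    rw [murphy, ← ih, jucysMurphy, jucysMurphy]
    simp only [Nat.add_sub_cancel, Nat.add_sub_add_right, show m + 1 + 1 - 2 = m from rfl]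
    rw [Finset.sum_range_succ, ascProd_succ n q le_rfl, ascProd_self, descProd_self, one_mul,
      mul_one, smul_add, Finset.mul_sum, Finset.sum_mul, Finset.smul_sum]
    congr 1
    · refine Finset.sum_congr rfl fun i hi => ?_
      have hi := Finset.mem_range.1 hi
      rw [mul_smul_comm, smul_mul_assoc, show m + 1 - 2 = m - 1 by omega, conj i m hi hm, smul_smul,
        show m + 1 - i = m - i + 1 by omega, pow_succ', mul_inv]
    · rw [show m + 1 - m = 1 by omega, pow_one]

/-! ### Compatibility with the embeddings, and induction over the algebra -/

theorem heckeIncl_heckeT {m : ℕ} (hmn : m ≤ n) {i : ℕ} (hi : i + 1 < m) :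
    heckeIncl q hmn (heckeT m q i) = heckeT n q i := by
  rw [heckeT_of_lt hi, heckeT_of_lt (show i + 1 < n by omega), heckeIncl, gen,
    RingQuot.liftAlgHom_mkAlgHom_apply, FreeAlgebra.lift_ι_apply]

theorem heckeIncl_murphy {m : ℕ} (hmn : m ≤ n) {k : ℕ} (hk : k < m) :
    heckeIncl q hmn (murphy q (heckeT m q) k) = murphy q (heckeT n q) k := by
  induction k with
  | zero => simp [murphy]
  | succ k ih =>
    simp only [murphy, map_smul, map_add, map_mul, ih (by omega), heckeIncl_heckeT hmn hk]

theorem heckeIncl_bottomToRandom {m : ℕ} (hmn : m ≤ n) {k : ℕ} (hk : k ≤ m) :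
    heckeIncl q hmn (bottomToRandom m q k) = bottomToRandom n q k := by
  rcases k with _ | k
  · simp [bottomToRandom]
  · induction k with
    | zero => simp only [zero_add, bottomToRandom_one, map_one]
    | succ k ih =>
      rw [bottomToRandom_succ, bottomToRandom_succ, map_add, map_mul, map_one,
        heckeIncl_heckeT hmn (by omega), ih (by omega)]

/-- Induction over the Hecke algebra. -/
theorem hecke_induction {P : Hecke n q → Prop} (h1 : P 1)
    (hadd : ∀ x y, P x → P y → P (x + y)) (hsmul : ∀ (c : ℂ) x, P x → P (c • x))
    (hmul : ∀ x i, i + 1 < n → P x → P (x * heckeT n q i)) (x : Hecke n q) : P x := by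
  obtain ⟨y, rfl⟩ := RingQuot.mkAlgHom_surjective ℂ (HeckeRel n q) x
  suffices H : ∀ z, P z → P (z * RingQuot.mkAlgHom ℂ (HeckeRel n q) y) by
    simpa using H 1 h1
  induction y using FreeAlgebra.induction with
  | grade0 c =>
    intro z hz
    rw [AlgHom.commutes, Algebra.algebraMap_eq_smul_one, mul_smul_comm, mul_one]
    exact hsmul c z hz
  | grade1 i =>
    intro z hz
    have := hmul z i.1 i.2 hz
    rwa [heckeT_of_lt i.2] at this
  | mul a b ha hb =>
    intro z hz
    rw [map_mul, ← mul_assoc]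
    exact hb _ (ha _ hz)
  | add a b ha hb =>
    intro z hz
    rw [map_add, mul_add]
    exact hadd _ _ (ha _ hz) (hb _ hz)

end Elements


/-! ## Spectral theory of the Jucys-Murphy elements -/

section Spectral

variable {V : Type*} [AddCommGroup V] [Module ℂ V] {n : ℕ} {q : ℂ} {T : ℕ → Module.End ℂ V}

theorem IsHeckeFamily.T_murphy (H : IsHeckeFamily n q T) (hq : q ≠ 0) {i : ℕ} (hi : i + 1 < n)
    (v : V) : murphy q T (i + 1) (T i v) =
      T i (murphy q T i v) + (v + (q - 1) • murphy q T (i + 1) v) := by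
  have := LinearMap.congr_fun (H.mul_murphy hq hi) v
  simp only [Module.End.mul_apply, LinearMap.sub_apply, LinearMap.add_apply, Module.End.one_apply,
    LinearMap.smul_apply] at this
  rw [this]; abel

theorem IsHeckeFamily.murphy_T (H : IsHeckeFamily n q T) (hq : q ≠ 0) {i : ℕ} (hi : i + 1 < n)
    (v : V) : murphy q T i (T i v) =
      T i (murphy q T (i + 1) v) - (v + (q - 1) • murphy q T (i + 1) v) := by
  have := LinearMap.congr_fun (H.murphy_mul hq hi) v
  simpa only [Module.End.mul_apply, LinearMap.sub_apply, LinearMap.add_apply, Module.End.one_apply,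
    LinearMap.smul_apply] using this

theorem IsHeckeFamily.murphy_T_of_ne (H : IsHeckeFamily n q T) (hq : q ≠ 0) {i m : ℕ}
    (hi : i + 1 < n) (hm : m < n) (h1 : m ≠ i) (h2 : m ≠ i + 1) (v : V) :
    murphy q T m (T i v) = T i (murphy q T m v) := by
  have : Commute (T i) (murphy q T m) := by
    rcases lt_or_gt_of_ne h1 with h | h
    · exact H.commute_murphy_of_lt hi h
    · exact H.commute_murphy_of_gt hq hm (by omega)
  exact (LinearMap.congr_fun this.eq v).symm

theorem IsHeckeFamily.murphy_comm (H : IsHeckeFamily n q T) (hq : q ≠ 0) {a b : ℕ}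
    (ha : a < n) (hb : b < n) (v : V) :
    murphy q T a (murphy q T b v) = murphy q T b (murphy q T a v) :=
  LinearMap.congr_fun (H.commute_murphy hq ha hb).eq v

theorem IsHeckeFamily.T_T (H : IsHeckeFamily n q T) {i : ℕ} (hi : i + 1 < n) (v : V) :
    T i (T i v) = (q - 1) • T i v + q • v :=
  LinearMap.congr_fun (H.quad i hi) v

/-- The intertwiner `T_i (J_i - J_{i+1}) + 1 + (q - 1) J_{i+1}` on a common eigenvector. -/
def twine (q : ℂ) (T : ℕ → Module.End ℂ V) (i : ℕ) (a b : ℂ) (v : V) : V :=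
  (a - b) • T i v + (1 + (q - 1) * b) • v

/-- The eigenvalues are exchanged whether or not the intertwiner vanishes. If it does not vanish, it
is a new eigenvector; if it does, this constrains the two eigenvalues. -/
theorem IsHeckeFamily.murphy_twine (H : IsHeckeFamily n q T) (hq : q ≠ 0) {i : ℕ}
    (hi : i + 1 < n) {a b : ℂ} {v : V} (ha : murphy q T i v = a • v)
    (hb : murphy q T (i + 1) v = b • v) :
    murphy q T i (twine q T i a b v) = b • twine q T i a b v ∧
      murphy q T (i + 1) (twine q T i a b v) = a • twine q T i a b v := by
  constructor
  · rw [twine, map_add, map_smul, map_smul, H.murphy_T hq hi, ha, hb, map_smul]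
    module
  · rw [twine, map_add, map_smul, map_smul, H.T_murphy hq hi, ha, hb, map_smul]
    module

/-- If the intertwiner kills `v`, then `T_i` acts on `v` by a scalar, which the quadratic relation
forces to be `q` or `-1`. Substituting the scalar back gives the two relations, which express that
contents differ by one. -/
theorem IsHeckeFamily.twine_eq_zero (H : IsHeckeFamily n q T) {i : ℕ}
    (hi : i + 1 < n) {a b : ℂ} {v : V} (hv : v ≠ 0) (hab : a ≠ b) (h0 : twine q T i a b v = 0) :
    (T i v = q • v ∧ b = q * a + 1) ∨ (T i v = (-1 : ℂ) • v ∧ q * b = a - 1) := by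
  have hab' := sub_ne_zero.2 hab
  obtain ⟨t, ht⟩ : ∃ t : ℂ, t * (a - b) = -(1 + (q - 1) * b) :=
    ⟨-(1 + (q - 1) * b) / (a - b), div_mul_cancel₀ _ hab'⟩
  have hT : T i v = t • v := by
    have h1 : (a - b) • (T i v - t • v) = 0 := by
      rw [smul_sub, smul_smul, mul_comm _ t, ht, ← h0, twine]; module
    exact sub_eq_zero.1 ((smul_eq_zero.1 h1).resolve_left hab')
  have h2 := H.T_T hi v
  rw [hT, map_smul, hT] at h2
  have h3 : ((t - q) * (t + 1)) • v = 0 := by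
    have : (t * t) • v = ((q - 1) * t + q) • v := by rw [mul_smul, h2]; module
    rw [show (t - q) * (t + 1) = t * t - ((q - 1) * t + q) by ring, sub_smul, this, sub_self]
  rcases mul_eq_zero.1 ((smul_eq_zero.1 h3).resolve_right hv) with h4 | h4
  · left
    obtain rfl := sub_eq_zero.1 h4
    exact ⟨hT, by linear_combination -ht⟩
  · right
    obtain rfl := eq_neg_of_add_eq_zero_left h4
    exact ⟨hT, by linear_combination ht⟩

/-- The common eigenspace of the first `k` Jucys-Murphy elements given by the contents of a lattice
word. -/
def jmSpace (q : ℂ) (T : ℕ → Module.End ℂ V) (r : ℕ → ℕ) (k : ℕ) : Submodule ℂ V where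
  carrier := {v | ∀ m < k, murphy q T m v = qInt q (cont r m) • v}
  add_mem' := fun ha hb m hm => by rw [map_add, ha m hm, hb m hm, smul_add]
  zero_mem' := fun m _ => by simp
  smul_mem' := fun c v hv m hm => by rw [map_smul, hv m hm, smul_comm]

theorem mem_jmSpace {r : ℕ → ℕ} {k : ℕ} {v : V} :
    v ∈ jmSpace q T r k ↔ ∀ m < k, murphy q T m v = qInt q (cont r m) • v := Iff.rfl

theorem jmSpace_mono {r : ℕ → ℕ} {k l : ℕ} (h : k ≤ l) : jmSpace q T r l ≤ jmSpace q T r k :=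
  fun _ hv m hm => hv m (hm.trans_le h)

theorem mem_jmSpace_succ {r : ℕ → ℕ} {k : ℕ} {v : V} : v ∈ jmSpace q T r (k + 1) ↔
    v ∈ jmSpace q T r k ∧ murphy q T k v = qInt q (cont r k) • v := by
  simp only [mem_jmSpace, Nat.lt_succ_iff_lt_or_eq, or_imp, forall_and, forall_eq]

theorem cont_congr {r r' : ℕ → ℕ} {m : ℕ} (h : ∀ x ≤ m, r x = r' x) : cont r m = cont r' m := by
  rw [cont, cont, h m le_rfl, cnt_congr fun x hx => h x (le_of_lt hx)]

theorem jmSpace_congr {r r' : ℕ → ℕ} {k : ℕ} (h : ∀ x < k, r x = r' x) :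
    jmSpace q T r k = jmSpace q T r' k := by
  ext v
  refine forall₂_congr fun m hm => ?_
  rw [cont_congr fun x hx => h x (by omega)]

theorem IsHeckeFamily.T_mem_jmSpace (H : IsHeckeFamily n q T) (hq : q ≠ 0) {r : ℕ → ℕ} {k i : ℕ}
    (hi : i + 1 < n) (hk : k ≤ i) {v : V} (hv : v ∈ jmSpace q T r k) : T i v ∈ jmSpace q T r k := by
  intro m hm
  rw [H.murphy_T_of_ne hq hi (by omega) (by omega) (by omega), hv m hm, map_smul]

theorem IsHeckeFamily.murphy_mem_jmSpace (H : IsHeckeFamily n q T) (hq : q ≠ 0) {r : ℕ → ℕ}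
    {k i : ℕ} (hi : i < n) (hk : k ≤ n) {v : V} (hv : v ∈ jmSpace q T r k) :
    murphy q T i v ∈ jmSpace q T r k := by
  intro m hm
  rw [H.murphy_comm hq (by omega) hi, hv m hm, map_smul]

theorem IsHeckeFamily.twine_mem_prefix (H : IsHeckeFamily n q T) (hq : q ≠ 0) {r : ℕ → ℕ} {i : ℕ}
    (hi : i + 1 < n) (a b : ℂ) {v : V} (hv : v ∈ jmSpace q T r i) :
    twine q T i a b v ∈ jmSpace q T r i :=
  Submodule.add_mem _ (Submodule.smul_mem _ _ (H.T_mem_jmSpace hq hi le_rfl hv))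
    (Submodule.smul_mem _ _ hv)

/-- The intertwiner maps the eigenspace of a tableau to that of the tableau with the entries
exchanged. -/
theorem IsHeckeFamily.twine_mem (H : IsHeckeFamily n q T) (hq : q ≠ 0) {r : ℕ → ℕ} {m k : ℕ}
    (hmn : m ≤ n) (hk : k + 1 < m) (hne : r k ≠ r (k + 1)) {v : V} (hv : v ∈ jmSpace q T r m) :
    twine q T k (qInt q (cont r k)) (qInt q (cont r (k + 1))) v ∈ jmSpace q T (sw k r) m := by
  obtain ⟨h1, h2⟩ := H.murphy_twine hq (by omega) (hv k (by omega)) (hv (k + 1) hk)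
  intro l hl
  by_cases e1 : l = k
  · subst e1; rw [cont_sw_left hne]; exact h1
  by_cases e2 : l = k + 1
  · subst e2; rw [cont_sw_right hne]; exact h2
  rw [cont_sw_of_ne r e1 e2, twine, map_add, map_smul, map_smul,
    H.murphy_T_of_ne hq (by omega) (by omega) e1 e2, hv l hl, map_smul]
  module

theorem adjacent_of_eq {a b : ℤ} (hq : q ≠ 0)
    (h : qInt q b = q * qInt q a + 1 ∨ q * qInt q b = qInt q a - 1) :
    qInt q b = qInt q (a + 1) ∨ qInt q b = qInt q (a - 1) := by
  rcases h with h | h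
  · left; rw [qInt_add_one hq, h]
  · right
    have := qInt_add_one hq (a - 1)
    rw [sub_add_cancel] at this
    rw [this, add_sub_cancel_right] at h
    exact mul_left_cancel₀ hq h

/-- Vanishing would force contents that differ by one, but entries that can be exchanged have
contents at distance at least two. -/
theorem IsHeckeFamily.twine_ne_zero (H : IsHeckeFamily n q T) (hq : q ≠ 0) (hN : QNonzero n q)
    {r : ℕ → ℕ} {m k : ℕ} (hmn : m ≤ n) (hk : k + 1 < m) (hr : IsLattice m r)
    (hs : Addable (cnt r k) (r (k + 1))) (hne : r k ≠ r (k + 1)) {v : V} (hv : v ≠ 0) :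
    twine q T k (qInt q (cont r k)) (qInt q (cont r (k + 1))) v ≠ 0 := by
  intro h0
  obtain ⟨h1, h2, h3⟩ := hr.cont_dist hk hs hne
  have hab : qInt q (cont r k) ≠ qInt q (cont r (k + 1)) := fun h => by
    have := hN.inj hq (by omega) (by omega) h; omega
  rcases adjacent_of_eq hq ((H.twine_eq_zero (by omega) hv hab h0).imp And.right And.right)
    with h | h
  · have := hN.inj hq (by omega) (by omega) h; omega
  · have := hN.inj hq (by omega) (by omega) h; omega

/-- Eigenvectors can be moved to any standard tableau of the same shape. -/
theorem IsHeckeFamily.exists_transport (H : IsHeckeFamily n q T) (hq : q ≠ 0) (hN : QNonzero n q)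
    {m : ℕ} (hmn : m ≤ n) {r r' : ℕ → ℕ}
    (hrr : ∀ R : (ℕ → ℕ) → (ℕ → ℕ) → Prop, (∀ r, R r r) →
      (∀ r r' r'', R r r' → R r' r'' → R r r'') → (∀ r k, k + 1 < m → IsLattice m r →
        IsLattice m (sw k r) → r k ≠ r (k + 1) → R r (sw k r)) → R r r')
    (p : Submodule ℂ V) (hp : ∀ k, k + 1 < m → ∀ x ∈ p, T k x ∈ p) {v : V} (hv : v ≠ 0)
    (hvp : v ∈ p) (hvr : v ∈ jmSpace q T r m) :
    ∃ v' ≠ 0, v' ∈ p ∧ v' ∈ jmSpace q T r' m := by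
  -- The hypothesis `hrr` expresses that `r` and `r'` are related by the reflexive transitive
  -- closure of admissible exchanges. It is applied to the relation "a nonzero vector can be moved".
  refine hrr (fun r r' => (∃ v ≠ 0, v ∈ p ∧ v ∈ jmSpace q T r m) →
    ∃ v ≠ 0, v ∈ p ∧ v ∈ jmSpace q T r' m) (fun _ h => h) (fun _ _ _ h1 h2 h => h2 (h1 h))
    ?_ ⟨v, hv, hvp, hvr⟩
  rintro r k hk hr hs hne ⟨v, hv, hvp, hvr⟩
  exact ⟨_, H.twine_ne_zero hq hN hmn hk hr (hs.addable_of_sw hk) hne hv,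
    p.add_mem (p.smul_mem _ (hp k hk v hvp)) (p.smul_mem _ hvp), H.twine_mem hq hmn hk hne hvr⟩

/-- No addable cell lies on a diagonal next to that of another addable cell. -/
theorem not_adjacent_addable (hq : q ≠ 0) (hN : QNonzero n q) {m : ℕ} (hm : m + 2 ≤ n) {r : ℕ → ℕ}
    (hr : IsLattice m r) {i j : ℕ} (hi : Addable (cnt r m) i) (hj : Addable (cnt r m) j)
    {c' : ℤ} (hc : c' = (cnt r m j - j : ℤ) + 1 ∨ c' = (cnt r m j - j : ℤ) - 1) :
    qInt q c' ≠ qInt q (cnt r m i - i : ℤ) := by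
  intro h
  rcases lt_trichotomy i j with hij | rfl | hij
  · have h1 := hj.content hr hij
    have := hN.inj hq (by omega) (by omega) h; omega
  · have := hN.inj hq (by omega) (by omega) h; omega
  · have h1 := hi.content hr hij
    have := hN.inj hq (by omega) (by omega) h; omega

/-- The core of the spectral theory. The two halves, that eigenvalues are q-contents of addable
cells and that there are no Jordan blocks, are proved together by strong induction, since each half
at one stage uses both at earlier stages. The intertwiner carries a vector back to the previous
Jucys-Murphy element, where the induction hypothesis is available. When it vanishes, the
configurations that do not come from a tableau are excluded by the braid relation. -/
theorem IsHeckeFamily.spectrum (H : IsHeckeFamily n q T) (hq : q ≠ 0) (hN : QNonzero n q) {m : ℕ}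
    (hm : m < n) {r : ℕ → ℕ} (hr : IsLattice m r) :
    (∀ v ∈ jmSpace q T r m, v ≠ 0 → ∀ a : ℂ, murphy q T m v = a • v →
      ∃ i, Addable (cnt r m) i ∧ a = qInt q (cnt r m i - i : ℤ)) ∧
    (∀ v ∈ jmSpace q T r m, ∀ a : ℂ, murphy q T m (murphy q T m v - a • v) =
      a • (murphy q T m v - a • v) → murphy q T m v - a • v = 0) := by
  induction m using Nat.strong_induction_on generalizing r with
  | _ m ih =>
  rcases m with _ | m
  · constructor
    · intro v _ hv a ha
      refine ⟨0, fun j hj => by omega, ?_⟩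
      simp only [murphy, LinearMap.zero_apply] at ha
      simp only [cnt_zero, Nat.cast_zero, sub_zero, qInt_zero]
      exact (smul_eq_zero.1 ha.symm).resolve_right hv
    · intro v _ a ha
      simp only [murphy, LinearMap.zero_apply, zero_sub] at ha ⊢
      rw [smul_neg, eq_comm, neg_eq_zero, smul_smul] at ha
      rcases smul_eq_zero.1 ha with h | h
      · rw [mul_self_eq_zero.1 h, zero_smul, neg_zero]
      · rw [h, smul_zero, neg_zero]
  obtain ⟨hr0, hadd⟩ := isLattice_succ.1 hr
  obtain ⟨P, D⟩ := ih m (Nat.lt_succ_self m) (by omega) hr0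
  have hpow : ∀ c : ℤ, 1 + (q - 1) * qInt q c ≠ 0 := fun c => by
    rw [one_add_qInt hq]; exact zpow_ne_zero _ hq
  -- the eigenvalue of `J_{m+1}` differs from that of `J_m`
  have hne : ∀ v ∈ jmSpace q T r (m + 1), v ≠ 0 → ∀ a : ℂ, murphy q T (m + 1) v = a • v →
      qInt q (cont r m) ≠ a := by
    rintro v hv hv0 a ha rfl
    obtain ⟨hv1, hv2⟩ := mem_jmSpace_succ.1 hv
    have h1 := H.murphy_T hq hm v
    rw [ha, map_smul] at h1
    -- If the two eigenvalues were equal, then `T_m v` would be a generalized eigenvector of `J_m`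
    -- that is not an eigenvector, contrary to `D`.
    have h2 : murphy q T m (T m v) - qInt q (cont r m) • T m v =
        -(1 + (q - 1) * qInt q (cont r m)) • v := by rw [h1]; module
    have h3 := D (T m v) (H.T_mem_jmSpace hq hm le_rfl hv1) (qInt q (cont r m)) (by
      rw [h2, map_smul, hv2, smul_comm])
    rw [h2] at h3
    exact (smul_ne_zero (neg_ne_zero.2 (hpow _)) hv0) h3
  constructor
  · intro v hv hv0 a ha
    have hca := hne v hv hv0 a ha
    obtain ⟨hv1, hv2⟩ := mem_jmSpace_succ.1 hv
    by_cases hu : twine q T m (qInt q (cont r m)) a v = 0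
    swap
    -- A nonzero intertwiner is an eigenvector of `J_m` with eigenvalue `a`. So `a` belongs to a
    -- cell addable to the smaller shape, distinct from the one just filled, and that cell remains
    -- addable.
    · obtain ⟨i, hi, hai⟩ := P _ (H.twine_mem_prefix hq hm _ _ hv1) hu a
        (H.murphy_twine hq hm hv2 ha).1
      have hie : r m ≠ i := by rintro rfl; exact hca hai.symm
      refine ⟨i, fun j hj => ?_, ?_⟩
      · have := hi j hj
        rw [cnt_succ, cnt_succ, if_neg hie]
        omega
      · rw [cnt_succ, if_neg hie, add_zero, hai]
    -- a corner next to the cell of `m` leads to a contradiction with the braid relation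
    have bad : ∀ e, cnt r m (e + 1) < cnt r m e → ∀ c' : ℤ, c' = (cnt r m e : ℤ) - 1 - e →
        (c' = cont r m + 1 ∨ c' = cont r m - 1) → a = qInt q c' → False := by
      intro e he c' hc' hcc hac
      obtain ⟨l, rfl⟩ : ∃ l, m = l + 1 := by
        rcases m with _ | l
        · simp at he
        · exact ⟨l, rfl⟩
      -- The first entries are rearranged so that the corner in row `e` is filled last. On the
      -- transported vector the eigenvalues of `J_l`, `J_{l+1}`, `J_{l+2}` are then `[c']`, `[cont r
      -- (l + 1)]`, `[c']`.
      obtain ⟨r', ⟨hr', hag⟩, hT⟩ : ∃ r', (IsLattice (l + 1) r' ∧ r' l = e ∧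
          cnt r' (l + 1) = cnt r (l + 1) ∧ r' (l + 1) = r (l + 1)) ∧ _ := by
        obtain ⟨r', h1, h2, h3, h4, h5⟩ := exists_last
          (fun r r' => ∀ R : (ℕ → ℕ) → (ℕ → ℕ) → Prop, (∀ r, R r r) →
            (∀ r r' r'', R r r' → R r' r'' → R r r'') → (∀ r k, k + 1 < l + 1 →
            IsLattice (l + 1) r → IsLattice (l + 1) (sw k r) → r k ≠ r (k + 1) → R r (sw k r)) →
            R r r')
          (fun r R h _ _ => h r) (fun r r' r'' h1 h2 R a b c => b _ _ _ (h1 R a b c) (h2 R a b c))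
          (j := 0) (n := l + 1) (fun r k _ hk a b c R _ _ h => h r k hk a b c)
          (Nat.lt_succ_self l) r hr0 he (by rw [cnt_zero]; omega)
        exact ⟨r', ⟨h1, h4, h5, h3 _ (Or.inr (Nat.lt_succ_self l))⟩, h2⟩
      obtain ⟨hlast, hcnt, hnext⟩ := hag
      obtain ⟨v', hv', ⟨hva, hvb⟩, hvr⟩ := H.exists_transport hq hN (m := l + 1) (by omega) hT
        (LinearMap.ker (murphy q T (l + 1) - algebraMap ℂ _ (qInt q (cont r (l + 1)))) ⊓
          LinearMap.ker (murphy q T (l + 1 + 1) - algebraMap ℂ _ a))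
        (fun k hk x hx => by
          simp only [Submodule.mem_inf, LinearMap.mem_ker, LinearMap.sub_apply,
            Module.algebraMap_end_apply, sub_eq_zero] at hx ⊢
          rw [H.murphy_T_of_ne hq (by omega) (by omega) (by omega) (by omega),
            H.murphy_T_of_ne hq (by omega) (by omega) (by omega) (by omega), hx.1, hx.2, map_smul,
            map_smul]
          exact ⟨rfl, rfl⟩) hv0
        (by
          simp only [Submodule.mem_inf, LinearMap.mem_ker, LinearMap.sub_apply,
            Module.algebraMap_end_apply, sub_eq_zero]
          exact ⟨hv2, ha⟩) hv1
      simp only [SetLike.mem_coe, LinearMap.mem_ker, LinearMap.sub_apply,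
        Module.algebraMap_end_apply, sub_eq_zero] at hva hvb
      have hr'l := hr'.mono (Nat.le_succ l)
      have hcl : cont r' l = c' := by
        have := congrFun hcnt e
        rw [cnt_succ, if_pos hlast] at this
        rw [cont, hlast]; omega
      obtain ⟨hvl, hvl'⟩ := mem_jmSpace_succ.1 hvr
      rw [hcl] at hvl'
      have hne1 : qInt q (cont r (l + 1)) ≠ a := hca
      have hadd1 : Addable (cnt r' (l + 1)) (r (l + 1)) := by rw [hcnt]; exact hadd
      have hu1 : twine q T (l + 1) (qInt q (cont r (l + 1))) a v' = 0 := by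
        by_contra hu1
        obtain ⟨i, hi, hai⟩ := (ih (l + 1) (Nat.lt_succ_self _) (by omega) hr').1 _
          (H.twine_mem_prefix hq hm _ _ hvr) hu1 a (H.murphy_twine hq hm hva hvb).1
        refine not_adjacent_addable hq hN (by omega) hr' hi hadd1 (c' := c') ?_ (hac ▸ hai)
        rw [hcnt]; exact hcc
      have hadd2 : Addable (cnt r' l) e := hlast ▸ hr'.addable (Nat.lt_succ_self l)
      have hu2 : twine q T l (qInt q c') (qInt q (cont r (l + 1))) v' = 0 := by
        by_contra hu2
        obtain ⟨i, hi, hai⟩ := (ih l (by omega) (by omega) hr'l).1 _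
          (H.twine_mem_prefix hq (by omega) _ _ hvl) hu2 _ 
          (H.murphy_twine hq (by omega) hvl' hva).1
        refine not_adjacent_addable hq hN (by omega) hr'l hi hadd2 (c' := cont r (l + 1)) ?_ hai
        rw [cont, hlast] at hcl; omega
      have t1 := H.twine_eq_zero hm hv' hne1 hu1
      have t2 := H.twine_eq_zero (by omega) hv' (by rw [← hac]; exact hne1.symm) hu2
      have hb := LinearMap.congr_fun (H.braid l (by omega)) v'
      simp only [Module.End.mul_apply] at hb
      have hq1 : q + 1 ≠ 0 := by
        have := hN 2 (by omega) (by omega)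
        rw [show ((2 : ℕ) : ℤ) = 1 + 1 by norm_num, qInt_add_one hq, qInt_one hq, mul_one] at this
        exact this
      rw [hac] at t1 hne1
      have key : ∀ x y : ℂ, x ≠ y → (q + 1) * (x - y) ≠ 0 := fun x y h =>
        mul_ne_zero hq1 (sub_ne_zero.2 h)
      -- Both generators act on `v'` by `q` or `-1`. Equal scalars contradict the content relations,
      -- and different ones turn the braid relation into `q (q + 1) = 0`.
      rcases t1 with ⟨t1, s1⟩ | ⟨t1, s1⟩ <;> rcases t2 with ⟨t2, s2⟩ | ⟨t2, s2⟩
      · exact key _ _ hne1 (by linear_combination s2 - s1)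
      · simp only [t1, t2, map_smul, smul_smul] at hb
        have h0 : (q * (q + 1)) • v' = 0 := by
          have := sub_eq_zero.2 hb
          rw [← sub_smul] at this
          rw [← this]; congr 1; ring
        exact (smul_ne_zero (mul_ne_zero hq hq1) hv') h0
      · simp only [t1, t2, map_smul, smul_smul] at hb
        have h0 : (q * (q + 1)) • v' = 0 := by
          have := sub_eq_zero.2 hb.symm
          rw [← sub_smul] at this
          rw [← this]; congr 1; ring
        exact (smul_ne_zero (mul_ne_zero hq hq1) hv') h0
      · exact key _ _ hne1 (by linear_combination s2 - s1)
    have hcm : cont r m = (cnt r m (r m) : ℤ) - r m := rfl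
    have self_cnt : cnt r (m + 1) (r m) = cnt r m (r m) + 1 := by rw [cnt_succ, if_pos rfl]
    rcases H.twine_eq_zero hm hv0 hca hu with ⟨-, h⟩ | ⟨-, h⟩
    · rw [← qInt_add_one hq] at h
      -- The eigenvalue points to the cell to the right of the last one. If this cell is not
      -- addable, the row above ends directly above the last cell. The end of that row is a corner
      -- of the smaller shape with the same content, and `bad` applies.
      by_cases hA : Addable (cnt r (m + 1)) (r m)
      · refine ⟨r m, hA, ?_⟩
        rw [h, hcm, self_cnt]; congr 1; push_cast; ring
      · exfalso
        unfold Addable at hA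
        push Not at hA
        obtain ⟨j, hj, hlt⟩ := hA
        have h1 := hadd j hj
        rw [self_cnt, cnt_succ, if_neg (by omega), add_zero] at hlt
        refine bad j (by rw [hj]; omega) _ rfl ?_ ?_
        · left; omega
        · rw [h]; congr 1; omega
    · have h' : a = qInt q (cont r m - 1) := by
        have := qInt_add_one hq (cont r m - 1)
        rw [sub_add_cancel] at this
        rw [this, add_sub_cancel_right] at h
        exact mul_left_cancel₀ hq h
      have h2 := hr0 m le_rfl (r m)
      -- Now the eigenvalue points to the cell below the last one. If that cell is not addable, the
      -- left neighbour of the last cell is a corner of the smaller shape with the same content.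
      rcases h2.lt_or_eq with h2 | h2
      · exfalso
        refine bad (r m) h2 _ rfl ?_ ?_
        · right; omega
        · rw [h']; congr 1; omega
      · refine ⟨r m + 1, fun j hj => ?_, ?_⟩
        · obtain rfl : j = r m := by omega
          rw [self_cnt, cnt_succ, if_neg (by omega)]; omega
        · rw [h', cnt_succ, if_neg (by omega)]; congr 1; push_cast; omega
  · intro v hv a ha
    by_contra hw
    set w := murphy q T (m + 1) v - a • v with hwdef
    obtain ⟨hv1, hv2⟩ := mem_jmSpace_succ.1 hv
    have hJ : murphy q T (m + 1) v = a • v + w := by rw [hwdef]; abel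
    have hwm : w ∈ jmSpace q T r (m + 1) := Submodule.sub_mem _
      (H.murphy_mem_jmSpace hq hm (by omega) hv) (Submodule.smul_mem _ _ hv)
    obtain ⟨hw1, hw2⟩ := mem_jmSpace_succ.1 hwm
    have hca := hne w hwm hw a ha
    set c := qInt q (cont r m) with hc
    -- This is the intertwiner `T_m (J_m - J_{m+1}) + 1 + (q - 1) J_{m+1}` applied to `v`, with
    -- `J_{m+1} v = a v + w`.
    set u := (c - a) • T m v - T m w + (1 + (q - 1) * a) • v + (q - 1) • w with hu
    have hum : u ∈ jmSpace q T r m :=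
      Submodule.add_mem _ (Submodule.add_mem _ (Submodule.sub_mem _
        (Submodule.smul_mem _ _ (H.T_mem_jmSpace hq hm le_rfl hv1))
        (H.T_mem_jmSpace hq hm le_rfl hw1)) (Submodule.smul_mem _ _ hv1)) (Submodule.smul_mem _ _ hw1)
    have hJu : murphy q T m u - a • u = twine q T m c a w := by
      rw [hu, twine]
      simp only [map_add, map_sub, map_smul, H.murphy_T hq hm, hJ, ha, hv2, hw2]
      module
    have h0 : twine q T m c a w = 0 := by
      rw [← hJu]
      refine D u hum a ?_
      rw [hJu]
      exact (H.murphy_twine hq hm hw2 ha).1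
    have hu0 : u = 0 := by
      by_contra hu0
      obtain ⟨i, hi, hai⟩ := P u hum hu0 a (by rw [← sub_eq_zero, hJu, h0])
      have hadj : qInt q (cnt r m i - i : ℤ) = q * c + 1 ∨ q * qInt q (cnt r m i - i : ℤ) = c - 1 := by
        rw [← hai]
        exact (H.twine_eq_zero hm hw hca h0).imp And.right And.right
      rcases adjacent_of_eq hq hadj with h | h
      · exact not_adjacent_addable hq hN (by omega) hr0 hi hadd (Or.inl rfl) h.symm
      · exact not_adjacent_addable hq hN (by omega) hr0 hi hadd (Or.inr rfl) h.symm
    have hca' := sub_ne_zero.2 hca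
    have hq1 : q + 1 ≠ 0 := by
      have := hN 2 (by omega) (by omega)
      rw [show ((2 : ℕ) : ℤ) = 1 + 1 by norm_num, qInt_add_one hq, qInt_one hq, mul_one] at this
      exact this
    -- Since `u` and the intertwiner of `w` both vanish, `T_m` acts on `v` and `w` as a nontrivial
    -- Jordan block with eigenvalue `t`. This is impossible because the roots `q` and `-1` of its
    -- quadratic equation are distinct.
    have fin : ∀ t : ℂ, t * (c - a) = -(1 + (q - 1) * a) → T m w = t • w → (t - (q - 1)) ≠ 0 →
        2 * t - (q - 1) ≠ 0 → False := by
      intro t ht htw h1 h2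
      have hTv : T m v = t • v + ((t - (q - 1)) / (c - a)) • w := by
        have e : (c - a) • (T m v - (t • v + ((t - (q - 1)) / (c - a)) • w)) = u := by
          rw [hu, htw, smul_sub, smul_add, smul_smul, smul_smul, mul_div_cancel₀ _ hca',
            mul_comm _ t, ht]
          module
        rw [hu0] at e
        exact sub_eq_zero.1 ((smul_eq_zero.1 e).resolve_left hca')
      set κ := (t - (q - 1)) / (c - a)
      have hκ : κ ≠ 0 := div_ne_zero h1 hca'
      have e1 := H.T_T hm v
      have e2 := H.T_T hm w
      rw [htw, map_smul, htw] at e2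
      rw [hTv, map_add, map_smul, map_smul, hTv, htw] at e1
      have e3 : ((t - q) * (t + 1)) • w = 0 := by
        rw [← sub_eq_zero] at e2
        rw [← e2]; module
      have e4 := (smul_eq_zero.1 e3).resolve_right hw
      have e5 : (κ * (2 * t - (q - 1))) • w = 0 := by
        have : ((t - q) * (t + 1)) • v + (κ * (2 * t - (q - 1))) • w = 0 := by
          rw [← sub_eq_zero] at e1
          rw [← e1]; module
        rwa [e4, zero_smul, zero_add] at this
      exact smul_ne_zero (mul_ne_zero hκ h2) hw e5
    rcases H.twine_eq_zero hm hw hca h0 with ⟨h1, h2⟩ | ⟨h1, h2⟩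
    · refine fin q (by linear_combination -h2) h1 (by ring_nf; exact one_ne_zero) ?_
      rwa [show 2 * q - (q - 1) = q + 1 by ring]
    · refine fin (-1) (by linear_combination h2) h1 ?_ ?_
      · rw [show -1 - (q - 1) = -q by ring]; exact neg_ne_zero.2 hq
      · rw [show 2 * -1 - (q - 1) = -(q + 1) by ring]; exact neg_ne_zero.2 hq1

end Spectral


/-! ## Decomposition into common eigenspaces -/

section Decomposition

variable {V : Type*} [AddCommGroup V] [Module ℂ V] {n : ℕ} {q : ℂ} {T : ℕ → Module.End ℂ V}

theorem aeval_of_eigen {f : Module.End ℂ V} {a : ℂ} {v : V} (h : f v = a • v)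
    (p : Polynomial ℂ) : Polynomial.aeval f p v = p.eval a • v := by
  induction p using Polynomial.induction_on' with
  | add p s hp hs => rw [map_add, LinearMap.add_apply, hp, hs, Polynomial.eval_add, add_smul]
  | monomial k c =>
    have : ∀ k : ℕ, (f ^ k) v = a ^ k • v := by
      intro k
      induction k with
      | zero => simp
      | succ k ih => rw [pow_succ, Module.End.mul_apply, h, map_smul, ih, smul_smul, pow_succ']
    rw [Polynomial.aeval_monomial, Module.End.mul_apply, this, Module.algebraMap_end_apply,
      Polynomial.eval_monomial, smul_smul]

/-- An operator without nontrivial Jordan blocks is diagonalizable on every invariant subspace on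
which it is locally algebraic. -/
theorem mem_span_eigenvectors {f : Module.End ℂ V} {U : Submodule ℂ V} (hU : ∀ x ∈ U, f x ∈ U)
    (hD : ∀ x ∈ U, ∀ a : ℂ, f (f x - a • x) = a • (f x - a • x) → f x - a • x = 0)
    {p : Polynomial ℂ} (hp : p ≠ 0) {v : V} (hv : v ∈ U) (h0 : Polynomial.aeval f p v = 0) :
    v ∈ Submodule.span ℂ {x | x ∈ U ∧ ∃ a : ℂ, f x = a • x} := by
  have hs := (IsAlgClosed.splits p).eq_prod_roots
  rw [hs, map_mul, Polynomial.aeval_C, Module.End.mul_apply, Module.algebraMap_end_apply] at h0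
  have h1 := (smul_eq_zero.1 h0).resolve_left (Polynomial.leadingCoeff_ne_zero.2 hp)
  clear h0 hs
  generalize p.roots = s at h1
  clear hp
  induction s using Multiset.induction_on generalizing v with
  | empty =>
    simp only [Multiset.map_zero, Multiset.prod_zero, map_one, Module.End.one_apply] at h1
    rw [h1]; exact Submodule.zero_mem _
  | cons a s ih =>
    rw [Multiset.map_cons, Multiset.prod_cons, mul_comm, map_mul, Module.End.mul_apply] at h1
    simp only [map_sub, Polynomial.aeval_X, Polynomial.aeval_C, LinearMap.sub_apply,
      Module.algebraMap_end_apply] at h1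
    have hu := ih (U.sub_mem (hU v hv) (U.smul_mem a hv)) (by simpa using h1)
    -- Modulo the image of `f - a`, only the `a`-eigenvector in a sum of eigenvectors survives: an
    -- eigenvector with eigenvalue `b ≠ a` is `f - a` applied to its multiple by `(b - a)⁻¹`.
    -- Subtracting `y` from `v` leaves a vector killed by `(f - a)²`, to which `hD` applies.
    have key : ∀ u ∈ Submodule.span ℂ {x | x ∈ U ∧ ∃ a : ℂ, f x = a • x},
        ∃ y ∈ Submodule.span ℂ {x | x ∈ U ∧ ∃ a : ℂ, f x = a • x}, ∃ x, f x = a • x ∧ y ∈ U ∧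
          u = (f y - a • y) + x := by
      intro u hu
      induction hu using Submodule.span_induction with
      | mem x hx =>
        obtain ⟨hxU, b, hb⟩ := hx
        by_cases hab : b = a
        · exact ⟨0, Submodule.zero_mem _, x, by rw [hb, hab], U.zero_mem, by simp⟩
        · have hab := sub_ne_zero.2 hab
          refine ⟨(b - a)⁻¹ • x, Submodule.smul_mem _ _ (Submodule.subset_span ⟨hxU, b, hb⟩), 0,
            by simp, U.smul_mem _ hxU, ?_⟩
          rw [map_smul, hb, smul_comm a, ← smul_sub, ← sub_smul, smul_smul, inv_mul_cancel₀ hab]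
          simp
      | zero => exact ⟨0, Submodule.zero_mem _, 0, by simp, U.zero_mem, by simp⟩
      | add x y _ _ hx hy =>
        obtain ⟨y1, h1, x1, h2, h3, h4⟩ := hx
        obtain ⟨y2, g1, x2, g2, g3, g4⟩ := hy
        refine ⟨y1 + y2, Submodule.add_mem _ h1 g1, x1 + x2, by rw [map_add, h2, g2, smul_add],
          U.add_mem h3 g3, ?_⟩
        rw [h4, g4, map_add]; module
      | smul c x _ hx =>
        obtain ⟨y1, h1, x1, h2, h3, h4⟩ := hx
        refine ⟨c • y1, Submodule.smul_mem _ _ h1, c • x1, by rw [map_smul, h2, smul_comm],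
          U.smul_mem _ h3, ?_⟩
        rw [h4, map_smul]; module
    obtain ⟨y, hy, x, hx, hyU, e⟩ := key _ hu
    have e1 : f (v - y) - a • (v - y) = x := by
      rw [map_sub, ← sub_eq_zero, ← sub_eq_zero.2 e]; module
    have e2 := hD (v - y) (U.sub_mem hv hyU) a (by rw [e1, hx])
    have : v = (v - y) + y := by abel
    rw [this]
    exact Submodule.add_mem _ (Submodule.subset_span ⟨U.sub_mem hv hyU, a, sub_eq_zero.1 e2⟩) hy

/-- A locally finite family satisfying the Hecke relations, at a parameter at which the Hecke
algebra is semisimple. -/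
structure IsSemisimpleFamily (n : ℕ) (q : ℂ) (T : ℕ → Module.End ℂ V) : Prop where
  hecke : IsHeckeFamily n q T
  ne_zero : q ≠ 0
  qNonzero : QNonzero n q
  algebraic : ∀ k < n, ∀ v, ∃ p : Polynomial ℂ, p ≠ 0 ∧ Polynomial.aeval (murphy q T k) p v = 0

theorem IsLattice.update {k : ℕ} {r : ℕ → ℕ} (hr : IsLattice k r) {i : ℕ}
    (hi : Addable (cnt r k) i) : IsLattice (k + 1) (Function.update r k i) := by
  have hag : ∀ x < k, r x = Function.update r k i x := fun x hx => by
    rw [Function.update_of_ne hx.ne]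
  refine isLattice_succ.2 ⟨hr.congr hag, ?_⟩
  rw [← cnt_congr hag, Function.update_self]
  exact hi

theorem IsSemisimpleFamily.exists_extend (S : IsSemisimpleFamily n q T) {k : ℕ} (hk : k < n)
    {r : ℕ → ℕ} (hr : IsLattice k r) {v : V} (hv : v ∈ jmSpace q T r k) (hv0 : v ≠ 0) {a : ℂ}
    (ha : murphy q T k v = a • v) : ∃ i, IsLattice (k + 1) (Function.update r k i) ∧
      a = qInt q (cont (Function.update r k i) k) ∧ v ∈ jmSpace q T (Function.update r k i) (k + 1) := by
  obtain ⟨i, hi, hai⟩ := (S.hecke.spectrum S.ne_zero S.qNonzero hk hr).1 v hv hv0 a ha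
  have hag : ∀ x < k, r x = Function.update r k i x := fun x hx => by
    rw [Function.update_of_ne hx.ne]
  have hc : cont (Function.update r k i) k = (cnt r k i - i : ℤ) := by
    rw [cont, Function.update_self, cnt_congr fun x hx => (hag x hx).symm]
  refine ⟨i, hr.update hi, by rw [hc, hai], mem_jmSpace_succ.2 ⟨?_, by rw [hc, ha, hai]⟩⟩
  rwa [← jmSpace_congr hag]

/-- The decomposition is refined by one Jucys-Murphy element at a time. It preserves the joint
eigenspace, it is diagonalizable there by the second half of `IsHeckeFamily.spectrum`, and by the
first half each eigenvalue names the next cell of a tableau. -/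
theorem IsSemisimpleFamily.mem_span (S : IsSemisimpleFamily n q T) {k : ℕ} (hk : k ≤ n) (v : V) :
    v ∈ Submodule.span ℂ {x | ∃ r, IsLattice k r ∧ x ∈ jmSpace q T r k} := by
  induction k with
  | zero =>
    exact Submodule.subset_span ⟨0, fun k hk i => by simp [Nat.le_zero.1 hk], fun m hm => by omega⟩
  | succ k ih =>
    refine Submodule.span_induction ?_ (Submodule.zero_mem _)
      (fun _ _ _ _ h1 h2 => Submodule.add_mem _ h1 h2) (fun c _ _ h => Submodule.smul_mem _ c h)
      (ih (by omega))
    rintro x ⟨r, hr, hx⟩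
    obtain ⟨p, hp, hpx⟩ := S.algebraic k hk x
    refine Submodule.span_le.2 ?_ (mem_span_eigenvectors (U := jmSpace q T r k)
      (fun y hy => S.hecke.murphy_mem_jmSpace S.ne_zero hk (by omega) hy)
      (S.hecke.spectrum S.ne_zero S.qNonzero hk hr).2 hp hx hpx)
    rintro y ⟨hy, a, ha⟩
    by_cases hy0 : y = 0
    · rw [hy0]; exact Submodule.zero_mem _
    · obtain ⟨i, h1, -, h3⟩ := S.exists_extend hk hr hy hy0 ha
      exact Submodule.subset_span ⟨_, h1, h3⟩

/-! ### Projections onto the common eigenspaces -/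

/-- The Lagrange interpolation polynomial which is one at the value `[c]_q` and zero at the other
possible eigenvalues of the `k`-th Jucys-Murphy element. -/
def lagr (q : ℂ) (k : ℕ) (c : ℤ) : Polynomial ℂ :=
  ∏ x ∈ ((contents (k + 1)).image (qInt q)).erase (qInt q c),
    Polynomial.C (qInt q c - x)⁻¹ * (Polynomial.X - Polynomial.C x)

theorem eval_lagr_self (q : ℂ) (k : ℕ) (c : ℤ) : (lagr q k c).eval (qInt q c) = 1 := by
  rw [lagr, Polynomial.eval_prod]
  refine Finset.prod_eq_one fun x hx => ?_
  have := sub_ne_zero.2 (Finset.ne_of_mem_erase hx).symm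
  simp [inv_mul_cancel₀ this]

theorem eval_lagr_of_ne {q : ℂ} {k : ℕ} {c d : ℤ} (hd : d ∈ contents (k + 1))
    (h : qInt q d ≠ qInt q c) : (lagr q k c).eval (qInt q d) = 0 := by
  rw [lagr, Polynomial.eval_prod]
  refine Finset.prod_eq_zero (Finset.mem_erase.2 ⟨h, Finset.mem_image_of_mem _ hd⟩) ?_
  simp

/-- The projection onto the common eigenspace of the first `k` Jucys-Murphy elements. -/
def proj (q : ℂ) (T : ℕ → Module.End ℂ V) (r : ℕ → ℕ) : ℕ → Module.End ℂ V
  | 0 => 1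
  | k + 1 => Polynomial.aeval (murphy q T k) (lagr q k (cont r k)) * proj q T r k

theorem proj_succ (r : ℕ → ℕ) (k : ℕ) (v : V) : proj q T r (k + 1) v =
    Polynomial.aeval (murphy q T k) (lagr q k (cont r k)) (proj q T r k v) := rfl

theorem proj_congr {r r' : ℕ → ℕ} {k : ℕ} (h : ∀ x < k, r x = r' x) :
    proj q T r k = proj q T r' k := by
  induction k with
  | zero => rfl
  | succ k ih =>
    rw [proj, proj, ih fun x hx => h x (by omega), cont_congr fun x hx => h x (by omega)]

theorem proj_of_mem {r : ℕ → ℕ} {k : ℕ} {v : V} (hv : v ∈ jmSpace q T r k) :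
    proj q T r k v = v := by
  induction k with
  | zero => rfl
  | succ k ih =>
    obtain ⟨h1, h2⟩ := mem_jmSpace_succ.1 hv
    rw [proj_succ, ih h1, aeval_of_eigen h2, eval_lagr_self, one_smul]

/-- Where the two words first differ, the shapes still agree and the two added cells have different
contents. Their q-integers differ as well, so the Lagrange factor at this place vanishes. -/
theorem proj_of_mem_of_ne (hq : q ≠ 0) (hN : QNonzero n q) {r s : ℕ → ℕ} {k : ℕ} (hk : k ≤ n)
    (hr : IsLattice k r) (hs : IsLattice k s) (hrs : ∃ m < k, r m ≠ s m) {v : V}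
    (hv : v ∈ jmSpace q T s k) : proj q T r k v = 0 := by
  induction k with
  | zero => obtain ⟨m, hm, -⟩ := hrs; omega
  | succ k ih =>
    obtain ⟨h1, h2⟩ := mem_jmSpace_succ.1 hv
    rw [proj_succ]
    by_cases hex : ∃ m < k, r m ≠ s m
    · rw [ih (by omega) (hr.mono (by omega)) (hs.mono (by omega)) hex h1, map_zero]
    · push Not at hex
      have hne : r k ≠ s k := by
        obtain ⟨m, hm, hne⟩ := hrs
        rcases (Nat.lt_succ_iff.1 hm).lt_or_eq with h | rfl
        · exact absurd (hex m h) hne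
        · exact hne
      rw [proj_congr hex, proj_of_mem h1, aeval_of_eigen h2,
        eval_lagr_of_ne (hs.cont_mem (Nat.lt_succ_self k)), zero_smul]
      intro heq
      have hkr := hr.addable (Nat.lt_succ_self k)
      have hks := hs.addable (Nat.lt_succ_self k)
      have hr0 := hr.mono (Nat.le_succ k)
      rw [cont, cont, ← cnt_congr hex] at heq
      rw [← cnt_congr hex] at hks
      rcases lt_or_gt_of_ne hne with h | h
      · have h1 := hks.content hr0 h
        have := hN.inj hq (by omega) (by omega) heq; omega
      · have h1 := hkr.content hr0 h
        have := hN.inj hq (by omega) (by omega) heq; omega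

/-- The lattice words of length `k`, continued by zeros. -/
def latticeWords (k : ℕ) : Finset (ℕ → ℕ) := by
  classical
  exact ((Finset.univ : Finset (Fin k → Fin k)).image
    fun f m => if h : m < k then (f ⟨m, h⟩ : ℕ) else 0).filter (IsLattice k)

theorem isLattice_of_mem {k : ℕ} {r : ℕ → ℕ} (h : r ∈ latticeWords k) : IsLattice k r := by
  classical
  rw [latticeWords, Finset.mem_filter] at h
  exact h.2

theorem exists_mem_latticeWords {k : ℕ} {r : ℕ → ℕ} (hr : IsLattice k r) :
    ∃ s ∈ latticeWords k, ∀ x < k, r x = s x := by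
  classical
  have hlt : ∀ m (h : m < k), r m < k := fun m h => (hr.le h).trans_lt h
  refine ⟨fun m => if h : m < k then r m else 0, ?_, fun x hx => by simp [hx]⟩
  rw [latticeWords, Finset.mem_filter, Finset.mem_image]
  exact ⟨⟨fun m => ⟨r m, hlt m m.2⟩, Finset.mem_univ _, rfl⟩,
    hr.congr fun m hm => by simp [hm]⟩

theorem eq_of_mem_latticeWords {k : ℕ} {r s : ℕ → ℕ} (hr : r ∈ latticeWords k)
    (hs : s ∈ latticeWords k) (h : ∀ x < k, r x = s x) : r = s := by
  classical
  have : ∀ r ∈ latticeWords k, ∀ x, k ≤ x → r x = 0 := by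
    intro r hr x hx
    rw [latticeWords, Finset.mem_filter, Finset.mem_image] at hr
    obtain ⟨⟨f, -, rfl⟩, -⟩ := hr
    exact dif_neg (by omega)
  funext x
  rcases lt_or_ge x k with hx | hx
  · exact h x hx
  · rw [this r hr x hx, this s hs x hx]

theorem IsSemisimpleFamily.sum_proj (S : IsSemisimpleFamily n q T) {k : ℕ} (hk : k ≤ n) (v : V) :
    ∑ r ∈ latticeWords k, proj q T r k v = v := by
  refine Submodule.span_induction (p := fun v _ => ∑ r ∈ latticeWords k, proj q T r k v = v)
    ?_ (by simp) (fun x y _ _ h1 h2 => ?_) (fun c x _ h => ?_) (S.mem_span hk v)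
  · rintro x ⟨r, hr, hx⟩
    obtain ⟨s, hs, hrs⟩ := exists_mem_latticeWords hr
    rw [Finset.sum_eq_single s]
    · rw [← proj_congr hrs, proj_of_mem hx]
    · intro t ht hts
      refine proj_of_mem_of_ne S.ne_zero S.qNonzero hk (isLattice_of_mem ht) hr ?_ hx
      by_contra hcon
      push Not at hcon
      exact hts (eq_of_mem_latticeWords ht hs fun x hx => (hcon x hx).trans (hrs x hx))
    · exact fun h => absurd hs h
  · simp only [map_add, Finset.sum_add_distrib]; rw [h1, h2]
  · simp only [map_smul, ← Finset.smul_sum]; rw [h]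

theorem IsSemisimpleFamily.proj_mem (S : IsSemisimpleFamily n q T) {k : ℕ} (hk : k ≤ n)
    {r : ℕ → ℕ} (hr : IsLattice k r) (v : V) : proj q T r k v ∈ jmSpace q T r k := by
  refine Submodule.span_induction (p := fun v _ => proj q T r k v ∈ jmSpace q T r k)
    ?_ (by simp) (fun x y _ _ h1 h2 => ?_) (fun c x _ h => ?_) (S.mem_span hk v)
  · rintro x ⟨s, hs, hx⟩
    by_cases h : ∃ m < k, r m ≠ s m
    · rw [proj_of_mem_of_ne S.ne_zero S.qNonzero hk hr hs h hx]
      exact Submodule.zero_mem _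
    · push Not at h
      rw [proj_congr h, proj_of_mem hx, jmSpace_congr h]
      exact hx
  · rw [map_add]; exact Submodule.add_mem _ h1 h2
  · rw [map_smul]; exact Submodule.smul_mem _ _ h

/-! ### The action of the generators on the eigenspaces -/

/-- The diagonal coefficient of the generator `T_k` on the eigenspace of a tableau. -/
def tau (q : ℂ) (r : ℕ → ℕ) (k : ℕ) : ℂ := -(qInt q (cont r k - cont r (k + 1)))⁻¹

/-- The entries `k` and `k + 1` of the tableau can be exchanged. -/
def Swappable (r : ℕ → ℕ) (k : ℕ) : Prop := r k ≠ r (k + 1) ∧ Addable (cnt r k) (r (k + 1))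

/-- The intertwiner is normalized to have leading term `T_k`. The identity `[a]_q - [b]_q = q^b [a -
b]_q` makes its scalar part depend only on the difference of the contents. -/
theorem twine_eq (hq : q ≠ 0) {r : ℕ → ℕ} {k : ℕ} (v : V)
    (h : qInt q (cont r k - cont r (k + 1)) ≠ 0) :
    twine q T k (qInt q (cont r k)) (qInt q (cont r (k + 1))) v =
      (qInt q (cont r k) - qInt q (cont r (k + 1))) • (T k v - tau q r k • v) := by
  have hz := zpow_ne_zero (cont r (k + 1)) hq
  rw [twine, one_add_qInt hq, qInt_sub hq, smul_sub, smul_smul, tau,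
    show q ^ cont r (k + 1) * qInt q (cont r k - cont r (k + 1)) *
      -(qInt q (cont r k - cont r (k + 1)))⁻¹ = - q ^ cont r (k + 1) by field_simp]
  module

/-- If the cell of the later entry becomes available only through the earlier one, it is its right
or lower neighbour. -/
theorem IsLattice.cont_not_swappable {m : ℕ} {r : ℕ → ℕ} (hr : IsLattice m r) {k : ℕ}
    (hk : k + 1 < m) (h : ¬ Swappable r k) :
    (r k = r (k + 1) ∧ cont r (k + 1) = cont r k + 1) ∨
      (r (k + 1) = r k + 1 ∧ cont r (k + 1) = cont r k - 1) := by
  by_cases e : r k = r (k + 1)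
  · left
    refine ⟨e, ?_⟩
    rw [cont, cont, cnt_succ, if_pos e, ← e]; push_cast; ring
  · right
    have h1 : ¬ Addable (cnt r k) (r (k + 1)) := fun h1 => h ⟨e, h1⟩
    unfold Addable at h1
    push Not at h1
    obtain ⟨j, hj, h1⟩ := h1
    have h2 := hr.addable hk j hj
    rw [cnt_succ, cnt_succ, if_neg e] at h2
    have h3 := hr k (by omega) j
    split_ifs at h2 with h4
    · refine ⟨by omega, ?_⟩
      rw [cont, cont, cnt_succ, if_neg e, ← hj, h4]
      rw [hj] at h3 ⊢
      push_cast
      omega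
    · omega

theorem IsLattice.qInt_cont_ne_zero (hq : q ≠ 0) (hN : QNonzero n q) {m : ℕ} (hmn : m ≤ n)
    {r : ℕ → ℕ} (hr : IsLattice m r) {k : ℕ} (hk : k + 1 < m) :
    qInt q (cont r k - cont r (k + 1)) ≠ 0 := by
  by_cases h : Swappable r k
  · have := hr.cont_dist hk h.2 h.1
    exact hN.ne_zero hq (by omega) (by omega) (by omega)
  · rcases hr.cont_not_swappable hk h with ⟨-, h⟩ | ⟨-, h⟩
    · exact hN.ne_zero hq (by omega) (by omega) (by omega)
    · exact hN.ne_zero hq (by omega) (by omega) (by omega)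

theorem IsSemisimpleFamily.T_sub_mem (S : IsSemisimpleFamily n q T) {m : ℕ} (hmn : m ≤ n)
    {r : ℕ → ℕ} (hr : IsLattice m r) {k : ℕ} (hk : k + 1 < m) (hs : r k ≠ r (k + 1)) {v : V}
    (hv : v ∈ jmSpace q T r m) : T k v - tau q r k • v ∈ jmSpace q T (sw k r) m := by
  have h0 := hr.qInt_cont_ne_zero S.ne_zero S.qNonzero hmn hk
  have h1 := S.hecke.twine_mem S.ne_zero hmn hk hs hv
  rw [twine_eq S.ne_zero v h0] at h1
  have h2 : qInt q (cont r k) - qInt q (cont r (k + 1)) ≠ 0 := by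
    rw [qInt_sub S.ne_zero]; exact mul_ne_zero (zpow_ne_zero _ S.ne_zero) h0
  have h3 := Submodule.smul_mem _ (qInt q (cont r k) - qInt q (cont r (k + 1)))⁻¹ h1
  rwa [smul_smul, inv_mul_cancel₀ h2, one_smul] at h3

theorem IsSemisimpleFamily.T_sub_ne_zero (S : IsSemisimpleFamily n q T) {m : ℕ} (hmn : m ≤ n)
    {r : ℕ → ℕ} (hr : IsLattice m r) {k : ℕ} (hk : k + 1 < m) (hs : Swappable r k) {v : V}
    (hv : v ≠ 0) : T k v - tau q r k • v ≠ 0 := by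
  have h0 := hr.qInt_cont_ne_zero S.ne_zero S.qNonzero hmn hk
  have h1 := S.hecke.twine_ne_zero S.ne_zero S.qNonzero hmn hk hr hs.2 hs.1 hv
  rw [twine_eq S.ne_zero v h0] at h1
  exact fun h => h1 (by rw [h, smul_zero])

/-- Otherwise the intertwiner would be an eigenvector of `J_k` whose content is next to that of a
cell addable to the same shape, contrary to `not_adjacent_addable`. -/
theorem IsSemisimpleFamily.T_eq (S : IsSemisimpleFamily n q T) {m : ℕ} (hmn : m ≤ n)
    {r : ℕ → ℕ} (hr : IsLattice m r) {k : ℕ} (hk : k + 1 < m) (hs : ¬ Swappable r k) {v : V}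
    (hv : v ∈ jmSpace q T r m) : T k v = tau q r k • v := by
  have h0 := hr.qInt_cont_ne_zero S.ne_zero S.qNonzero hmn hk
  have h2 : qInt q (cont r k) - qInt q (cont r (k + 1)) ≠ 0 := by
    rw [qInt_sub S.ne_zero]; exact mul_ne_zero (zpow_ne_zero _ S.ne_zero) h0
  have hrk := hr.mono (show k ≤ m by omega)
  have h3 : twine q T k (qInt q (cont r k)) (qInt q (cont r (k + 1))) v = 0 := by
    by_contra hu
    obtain ⟨i, hi, hai⟩ := (S.hecke.spectrum S.ne_zero S.qNonzero (m := k) (by omega) hrk).1 _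
      (S.hecke.twine_mem_prefix S.ne_zero (by omega) _ _ (jmSpace_mono (by omega) hv)) hu _
      (S.hecke.murphy_twine S.ne_zero (by omega) (hv k (by omega)) (hv (k + 1) hk)).1
    refine not_adjacent_addable S.ne_zero S.qNonzero (by omega) hrk hi
      (hr.addable (show k < m by omega)) ?_ hai
    exact (hr.cont_not_swappable hk hs).imp And.right And.right
  rw [twine_eq S.ne_zero v h0] at h3
  exact sub_eq_zero.1 ((smul_eq_zero.1 h3).resolve_left h2)

theorem tau_eq_of_row (hq : q ≠ 0) {r : ℕ → ℕ} {k : ℕ} (h : cont r (k + 1) = cont r k + 1) :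
    tau q r k = q := by
  have h1 := qInt_add_one hq (-1)
  rw [neg_add_cancel, qInt_zero] at h1
  have h2 : q * qInt q (-1) = -1 := by linear_combination -h1
  rw [tau, h, show cont r k - (cont r k + 1) = -1 by ring]
  rw [show qInt q (-1) = -q⁻¹ by field_simp; rwa [mul_comm], inv_neg, inv_inv, neg_neg]

theorem tau_eq_of_column (hq : q ≠ 0) {r : ℕ → ℕ} {k : ℕ} (h : cont r (k + 1) = cont r k - 1) :
    tau q r k = -1 := by
  rw [tau, h, show cont r k - (cont r k - 1) = 1 by ring, qInt_one hq, inv_one]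

theorem Swappable.sw {r : ℕ → ℕ} {k m : ℕ} (hk : k < m) (hr : IsLattice m r) (h : Swappable r k) :
    Swappable (sw k r) k := by
  refine ⟨by rw [sw_left, sw_right]; exact h.1.symm, ?_⟩
  rw [sw_right, cnt_sw_of_le r le_rfl]
  exact hr.addable hk

/-- It suffices to test one joint eigenspace at a time. `T_k` maps into the eigenspace of `r` only
from the eigenspaces of `r` and `sw k r`. From the latter, the contribution is what remains after
removing its diagonal part. -/
theorem IsSemisimpleFamily.proj_T (S : IsSemisimpleFamily n q T) {m : ℕ} (hmn : m ≤ n)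
    {r : ℕ → ℕ} (hr : IsLattice m r) {k : ℕ} (hk : k + 1 < m) (hs : Swappable r k) (v : V) :
    proj q T r m (T k v) = tau q r k • proj q T r m v +
      (T k (proj q T (sw k r) m v) - tau q (sw k r) k • proj q T (sw k r) m v) := by
  have hsr := hr.sw hs.2
  have hss := hs.sw (by omega) hr
  have hne : ∃ l < m, r l ≠ sw k r l := ⟨k, by omega, by rw [sw_left]; exact hs.1⟩
  have hne' : ∃ l < m, sw k r l ≠ r l := ⟨k, by omega, by rw [sw_left]; exact hs.1.symm⟩
  refine Submodule.span_induction (p := fun v _ => proj q T r m (T k v) =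
      tau q r k • proj q T r m v +
      (T k (proj q T (sw k r) m v) - tau q (sw k r) k • proj q T (sw k r) m v))
    ?_ (by simp) (fun x y _ _ h1 h2 => ?_) (fun c x _ h => ?_) (S.mem_span hmn v)
  · rintro x ⟨s, hs', hx⟩
    have z : ∀ {r s : ℕ → ℕ} {x : V}, IsLattice m r → IsLattice m s → (∃ l < m, r l ≠ s l) →
        x ∈ jmSpace q T s m → proj q T r m x = 0 := fun h1 h2 h3 h4 =>
      proj_of_mem_of_ne S.ne_zero S.qNonzero hmn h1 h2 h3 h4
    by_cases e1 : ∀ l < m, r l = s l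
    · have hx' : x ∈ jmSpace q T r m := by rwa [jmSpace_congr e1]
      rw [z hsr hr hne' hx', map_zero, smul_zero, sub_zero, add_zero, proj_of_mem hx']
      have h1 := S.T_sub_mem hmn hr hk hs.1 hx'
      have h2 := z hr hsr hne h1
      rw [map_sub, map_smul, proj_of_mem hx', sub_eq_zero] at h2
      exact h2
    · by_cases e2 : ∀ l < m, sw k r l = s l
      · have hx' : x ∈ jmSpace q T (sw k r) m := by rwa [jmSpace_congr e2]
        rw [z hr hsr hne hx', smul_zero, zero_add, proj_of_mem hx']
        have h1 := S.T_sub_mem hmn hsr hk hss.1 hx'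
        rw [sw_sw] at h1
        have h2 := proj_of_mem h1
        rwa [map_sub, map_smul, z hr hsr hne hx', smul_zero, sub_zero] at h2
      · push Not at e1 e2
        rw [z hr hs' e1 hx, z hsr hs' e2 hx, map_zero, smul_zero, smul_zero, sub_zero, add_zero]
        by_cases hsw : Swappable s k
        · have h1 := S.T_sub_mem hmn hs' hk hsw.1 hx
          have h2 : proj q T r m (T k x - tau q s k • x) = 0 := by
            refine z hr (hs'.sw hsw.2) ?_ h1
            by_contra hcon
            push Not at hcon
            obtain ⟨l, hl, hne2⟩ := e2
            refine hne2 ?_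
            have e3 : ∀ l < m, sw k r l = sw k (sw k s) l := by
              intro l hl
              have : Equiv.swap k (k + 1) l < m := by
                rw [Equiv.swap_apply_def]; split_ifs <;> omega
              exact hcon _ this
            rw [e3 l hl, sw_sw]
          rwa [map_sub, map_smul, z hr hs' e1 hx, smul_zero, sub_zero] at h2
        · rw [S.T_eq hmn hs' hk hsw hx, map_smul, z hr hs' e1 hx, smul_zero]
  · simp only [map_add, h1, h2]; module
  · simp only [map_smul, h]; module

theorem IsSemisimpleFamily.proj_T_of_not (S : IsSemisimpleFamily n q T) {m : ℕ} (hmn : m ≤ n)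
    {r : ℕ → ℕ} (hr : IsLattice m r) {k : ℕ} (hk : k + 1 < m) (hs : ¬ Swappable r k) (v : V) :
    proj q T r m (T k v) = tau q r k • proj q T r m v := by
  refine Submodule.span_induction (p := fun v _ => proj q T r m (T k v) =
      tau q r k • proj q T r m v)
    ?_ (by simp) (fun x y _ _ h1 h2 => ?_) (fun c x _ h => ?_) (S.mem_span hmn v)
  · rintro x ⟨s, hs', hx⟩
    have z : ∀ {r s : ℕ → ℕ} {x : V}, IsLattice m r → IsLattice m s → (∃ l < m, r l ≠ s l) →
        x ∈ jmSpace q T s m → proj q T r m x = 0 := fun h1 h2 h3 h4 =>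
      proj_of_mem_of_ne S.ne_zero S.qNonzero hmn h1 h2 h3 h4
    by_cases e1 : ∀ l < m, r l = s l
    · have hx' : x ∈ jmSpace q T r m := by rwa [jmSpace_congr e1]
      rw [S.T_eq hmn hr hk hs hx', map_smul, proj_of_mem hx']
    · push Not at e1
      rw [z hr hs' e1 hx, smul_zero]
      by_cases hsw : Swappable s k
      · have h1 := S.T_sub_mem hmn hs' hk hsw.1 hx
        have h2 : proj q T r m (T k x - tau q s k • x) = 0 := by
          refine z hr (hs'.sw hsw.2) ?_ h1
          by_contra hcon
          push Not at hcon
          refine hs ?_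
          have h3 := hsw.sw (by omega) hs'
          rw [Swappable, ← hcon k (by omega), ← hcon (k + 1) hk,
            cnt_congr (r' := r) fun x hx => (hcon x (by omega)).symm] at h3
          exact h3
        rwa [map_sub, map_smul, z hr hs' e1 hx, smul_zero, sub_zero] at h2
      · rw [S.T_eq hmn hs' hk hsw hx, map_smul, z hr hs' e1 hx, smul_zero]
  · simp only [map_add, h1, h2]; module
  · simp only [map_smul, h]; module

end Decomposition


/-! ### Primitivity of the projections -/

section Primitive

variable {V : Type*} [AddCommGroup V] [Module ℂ V] {n : ℕ} {q : ℂ} {T : ℕ → Module.End ℂ V}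

/-- The algebra generated by `T_0, …, T_{m-1}`. -/
def genAlg (T : ℕ → Module.End ℂ V) (m : ℕ) : Subalgebra ℂ (Module.End ℂ V) :=
  Algebra.adjoin ℂ {x | ∃ i < m, x = T i}

theorem T_mem_genAlg {i m : ℕ} (h : i < m) : T i ∈ genAlg T m :=
  Algebra.subset_adjoin ⟨i, h, rfl⟩

theorem genAlg_mono {m m' : ℕ} (h : m ≤ m') : genAlg T m ≤ genAlg T m' :=
  Algebra.adjoin_mono fun _ ⟨i, hi, e⟩ => ⟨i, hi.trans_le h, e⟩

theorem murphy_mem_genAlg (k : ℕ) : murphy q T k ∈ genAlg T k := by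
  induction k with
  | zero => exact Subalgebra.zero_mem _
  | succ k ih =>
    have h1 : T k ∈ genAlg T (k + 1) := T_mem_genAlg (Nat.lt_succ_self k)
    have h2 := genAlg_mono (T := T) (Nat.le_succ k) ih
    exact Subalgebra.smul_mem _ (add_mem (mul_mem (mul_mem h1 h2) h1) h1) _

theorem proj_mem_genAlg (r : ℕ → ℕ) (k : ℕ) : proj q T r (k + 1) ∈ genAlg T k := by
  induction k with
  | zero =>
    rw [proj, proj, mul_one]
    have h := murphy_mem_genAlg (q := q) (T := T) 0
    exact Algebra.adjoin_le (by simpa using h) (Polynomial.aeval_mem_adjoin_singleton ℂ _)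
  | succ k ih =>
    rw [proj]
    refine mul_mem ?_ (genAlg_mono (Nat.le_succ k) ih)
    exact Algebra.adjoin_le (by simpa using murphy_mem_genAlg (q := q) (T := T) (k + 1))
      (Polynomial.aeval_mem_adjoin_singleton ℂ _)

theorem commute_of_mem_genAlg {m : ℕ} {y x : Module.End ℂ V} (h : ∀ i < m, Commute (T i) y)
    (hx : x ∈ genAlg T m) : Commute x y := by
  induction hx using Algebra.adjoin_induction with
  | mem x hx => obtain ⟨i, hi, rfl⟩ := hx; exact h i hi
  | algebraMap c => exact Algebra.commutes c y
  | add x z _ _ h1 h2 => exact h1.add_left h2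
  | mul x z _ _ h1 h2 => exact h1.mul_left h2

/-- The algebra generated by `T_0, …, T_m` is spanned by `A` and `A T_m A`, where `A` is generated
by `T_0, …, T_{m-1}`. -/
theorem IsHeckeFamily.genAlg_succ_le (H : IsHeckeFamily n q T) {m : ℕ} (hm : m + 1 < n)
    {x : Module.End ℂ V} (hx : x ∈ genAlg T (m + 1)) :
    x ∈ Submodule.span ℂ ((genAlg T m : Set (Module.End ℂ V)) ∪
      {y | ∃ a ∈ genAlg T m, ∃ b ∈ genAlg T m, y = a * T m * b}) := by
  induction m generalizing x with
  | zero =>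
    induction hx using Algebra.adjoin_induction with
    | mem x hx =>
      obtain ⟨i, hi, rfl⟩ := hx
      obtain rfl : i = 0 := by omega
      exact Submodule.subset_span (Or.inr ⟨1, one_mem _, 1, one_mem _, by simp⟩)
    | algebraMap c => exact Submodule.subset_span (Or.inl (Subalgebra.algebraMap_mem _ c))
    | add x y _ _ h1 h2 => exact add_mem h1 h2
    | mul x y _ _ h1 h2 =>
      have scal : ∀ a ∈ genAlg T 0, ∃ c : ℂ, a = algebraMap ℂ _ c := by
        intro a ha
        have e : {x : Module.End ℂ V | ∃ i < 0, x = T i} = ∅ := by ext; simp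
        rw [genAlg, e, Algebra.adjoin_empty] at ha
        obtain ⟨c, hc⟩ := Algebra.mem_bot.1 ha
        exact ⟨c, hc.symm⟩
      refine Submodule.span_induction (p := fun x _ => x * y ∈ _) ?_ (by simp)
        (fun a b _ _ h1 h2 => by rw [add_mul]; exact add_mem h1 h2)
        (fun c a _ h => by rw [smul_mul_assoc]; exact Submodule.smul_mem _ c h) h1
      intro a ha
      refine Submodule.span_induction (p := fun y _ => a * y ∈ _) ?_ (by simp)
        (fun a b _ _ h1 h2 => by rw [mul_add]; exact add_mem h1 h2)
        (fun c a _ h => by rw [mul_smul_comm]; exact Submodule.smul_mem _ c h) h2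
      intro b hb
      have nf : ∀ a ∈ (genAlg T 0 : Set (Module.End ℂ V)) ∪
          {y | ∃ a ∈ genAlg T 0, ∃ b ∈ genAlg T 0, y = a * T 0 * b},
          ∃ c d : ℂ, a = c • (1 : Module.End ℂ V) + d • T 0 := by
        rintro a (ha | ⟨a, ha, b, hb, rfl⟩)
        · obtain ⟨c, rfl⟩ := scal a ha
          exact ⟨c, 0, by rw [Algebra.algebraMap_eq_smul_one]; simp⟩
        · obtain ⟨c, rfl⟩ := scal a ha
          obtain ⟨d, rfl⟩ := scal b hb
          refine ⟨0, c * d, ?_⟩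
          rw [Algebra.algebraMap_eq_smul_one, Algebra.algebraMap_eq_smul_one, smul_mul_assoc, one_mul,
            mul_smul_comm, mul_one, smul_smul, zero_smul, zero_add, mul_comm]
      obtain ⟨c, d, rfl⟩ := nf a ha
      obtain ⟨c', d', rfl⟩ := nf b hb
      have e : (c • (1 : Module.End ℂ V) + d • T 0) * (c' • (1 : Module.End ℂ V) + d' • T 0) =
          (c * c' + d * d' * q) • (1 : Module.End ℂ V) +
            (c * d' + d * c' + d * d' * (q - 1)) • T 0 := by
        simp only [add_mul, mul_add, smul_mul_assoc, mul_smul_comm, one_mul, mul_one,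
          H.quad 0 (by omega)]
        module
      rw [e]
      exact add_mem (Submodule.smul_mem _ _ (Submodule.subset_span (Or.inl (one_mem _))))
        (Submodule.smul_mem _ _ (Submodule.subset_span
          (Or.inr ⟨1, one_mem _, 1, one_mem _, by simp⟩)))
  | succ m ih =>
    set W := Submodule.span ℂ ((genAlg T (m + 1) : Set (Module.End ℂ V)) ∪
      {y | ∃ a ∈ genAlg T (m + 1), ∃ b ∈ genAlg T (m + 1), y = a * T (m + 1) * b}) with hW
    have hq2 := H.quad (m + 1) hm
    have hcomm : ∀ b ∈ genAlg T m, Commute b (T (m + 1)) := fun b hb =>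
      commute_of_mem_genAlg (fun i hi => H.commute (by omega) hm (Or.inl (by omega))) hb
    -- `W` is closed under multiplication by the generators
    have step : ∀ a ∈ genAlg T (m + 1), ∀ b ∈ genAlg T (m + 1),
        a * T (m + 1) * b * T (m + 1) ∈ W := by
      intro a ha b hb
      refine Submodule.span_induction (p := fun b _ => a * T (m + 1) * b * T (m + 1) ∈ W) ?_
        (by simp) (fun x y _ _ h1 h2 => by rw [mul_add, add_mul]; exact add_mem h1 h2)
        (fun c x _ h => by rw [mul_smul_comm, smul_mul_assoc]; exact Submodule.smul_mem _ c h)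
        (ih (by omega) hb)
      rintro b (hb | ⟨b1, hb1, b2, hb2, rfl⟩)
      · have e : a * T (m + 1) * b * T (m + 1) =
            (q - 1) • (a * T (m + 1) * b) + q • (a * b) := by
          have h1 := (hcomm b hb).eq
          calc a * T (m + 1) * b * T (m + 1) = a * (T (m + 1) * T (m + 1)) * b := by
                rw [mul_assoc (a * T (m + 1)), h1]; noncomm_ring
            _ = _ := by
                rw [hq2]
                simp only [mul_add, add_mul, mul_smul_comm, smul_mul_assoc, mul_one]
        rw [e]
        have hb' := genAlg_mono (T := T) (Nat.le_succ m) hb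
        exact add_mem (Submodule.smul_mem _ _ (Submodule.subset_span (Or.inr ⟨a, ha, b, hb', rfl⟩)))
          (Submodule.smul_mem _ _ (Submodule.subset_span (Or.inl (mul_mem ha hb'))))
      · have h1 := (hcomm b1 hb1).eq
        have h2 := (hcomm b2 hb2).eq
        -- After the commuting factors are moved outwards, the braid relation leaves a single
        -- `T_{m+1}`.
        have e : a * T (m + 1) * (b1 * T m * b2) * T (m + 1) =
            (a * b1 * T m) * T (m + 1) * (T m * b2) := by
          calc a * T (m + 1) * (b1 * T m * b2) * T (m + 1)
              = a * (T (m + 1) * b1) * T m * (b2 * T (m + 1)) := by noncomm_ring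
            _ = a * b1 * (T (m + 1) * T m * T (m + 1)) * b2 := by rw [← h1, h2]; noncomm_ring
            _ = _ := by rw [← H.braid m (by omega)]; noncomm_ring
        rw [e]
        have hT : T m ∈ genAlg T (m + 1) := T_mem_genAlg (Nat.lt_succ_self m)
        exact Submodule.subset_span (Or.inr ⟨_,
          mul_mem (mul_mem ha (genAlg_mono (Nat.le_succ m) hb1)) hT, _,
          mul_mem hT (genAlg_mono (Nat.le_succ m) hb2), rfl⟩)
    have closed : ∀ y ∈ W, ∀ i < m + 2, y * T i ∈ W := by
      intro y hy i hi
      refine Submodule.span_induction (p := fun y _ => y * T i ∈ W) ?_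
        (by simp) (fun x y _ _ h1 h2 => by rw [add_mul]; exact add_mem h1 h2)
        (fun c x _ h => by rw [smul_mul_assoc]; exact Submodule.smul_mem _ c h) hy
      rcases (Nat.lt_succ_iff.1 hi).lt_or_eq with hi | rfl
      · have hT : T i ∈ genAlg T (m + 1) := T_mem_genAlg hi
        rintro y (hy | ⟨a, ha, b, hb, rfl⟩)
        · exact Submodule.subset_span (Or.inl (mul_mem hy hT))
        · rw [mul_assoc]
          exact Submodule.subset_span (Or.inr ⟨a, ha, _, mul_mem hb hT, rfl⟩)
      · rintro y (hy | ⟨a, ha, b, hb, rfl⟩)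
        · exact Submodule.subset_span (Or.inr ⟨y, hy, 1, one_mem _, by simp⟩)
        · exact step a ha b hb
    have main : ∀ y ∈ W, y * x ∈ W := by
      induction hx using Algebra.adjoin_induction with
      | mem x hx => obtain ⟨i, hi, rfl⟩ := hx; exact fun y hy => closed y hy i hi
      | algebraMap c =>
        intro y hy
        rw [Algebra.algebraMap_eq_smul_one, mul_smul_comm, mul_one]
        exact Submodule.smul_mem _ c hy
      | add x z _ _ h1 h2 => intro y hy; rw [mul_add]; exact add_mem (h1 y hy) (h2 y hy)
      | mul x z _ _ h1 h2 => intro y hy; rw [← mul_assoc]; exact h2 _ (h1 y hy)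
    simpa using main 1 (Submodule.subset_span (Or.inl (one_mem _)))

/-- The projection onto the eigenspace of a standard tableau is primitive in the Hecke algebra. -/
theorem IsSemisimpleFamily.proj_primitive (S : IsSemisimpleFamily n q T) {m : ℕ} (hm : m < n)
    {s : ℕ → ℕ} (hs : IsLattice (m + 1) s) {v : V} (hv : v ∈ jmSpace q T s (m + 1))
    {x : Module.End ℂ V} (hx : x ∈ genAlg T m) :
    ∃ c : ℂ, proj q T s (m + 1) (x v) = c • v := by
  induction m generalizing s v x with
  | zero =>
    have e : {x : Module.End ℂ V | ∃ i < 0, x = T i} = ∅ := by ext; simp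
    rw [genAlg, e, Algebra.adjoin_empty] at hx
    obtain ⟨c, rfl⟩ := Algebra.mem_bot.1 hx
    exact ⟨c, by rw [Module.algebraMap_end_apply, map_smul, proj_of_mem hv]⟩
  | succ m ih =>
    have H := S.hecke
    obtain ⟨hv1, hv2⟩ := mem_jmSpace_succ.1 hv
    have hs1 := hs.mono (Nat.le_succ (m + 1))
    have hJ : ∀ a ∈ genAlg T m, ∀ w, murphy q T (m + 1) (a w) = a (murphy q T (m + 1) w) := by
      intro a ha w
      have := commute_of_mem_genAlg (y := murphy q T (m + 1))
        (fun i hi => H.commute_murphy_of_gt S.ne_zero hm (by omega)) ha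
      exact (LinearMap.congr_fun this.eq w).symm
    refine Submodule.span_induction (p := fun x _ => ∃ c : ℂ, proj q T s (m + 1 + 1) (x v) = c • v)
      ?_ ⟨0, by simp⟩ ?_ ?_ (H.genAlg_succ_le hm hx)
    · rintro x (hx | ⟨a, ha, b, hb, rfl⟩)
      · obtain ⟨c, hc⟩ := ih (by omega) hs1 hv1 hx
        exact ⟨c, by rw [proj_succ, hc, map_smul, aeval_of_eigen hv2, eval_lagr_self, one_smul]⟩
      have hby : murphy q T (m + 1) (b v) = qInt q (cont s (m + 1)) • b v := by
        rw [hJ b hb, hv2, map_smul]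
      -- For `x = a T_m b`, the vector `b v` is split into its components `y`, which keep the
      -- `J_{m+1}`-eigenvalue of `v`. The off-diagonal part of `T_m y` has a different
      -- `J_{m+1}`-eigenvalue and is killed by the final projection. The diagonal part is a multiple
      -- of `y`, and the induction hypothesis applies to `a`, the projection and `b` together.
      have key : ∀ r ∈ latticeWords (m + 1), ∃ c : ℂ,
          proj q T s (m + 1 + 1) (a (T m (proj q T r (m + 1) (b v)))) = c • v := by
        intro r hr
        have hr := isLattice_of_mem hr
        set y := proj q T r (m + 1) (b v) with hy
        have hyJ : murphy q T (m + 1) y = qInt q (cont s (m + 1)) • y := by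
          rw [hy, hJ _ (proj_mem_genAlg r m), hby, map_smul]
        by_cases hy0 : y = 0
        · exact ⟨0, by rw [hy0]; simp⟩
        obtain ⟨i, hri, hci, hyr⟩ := S.exists_extend hm hr (S.proj_mem (by omega) hr _) hy0 hyJ
        obtain ⟨c, hc⟩ := ih (by omega) hs1 hv1
          (mul_mem ha (mul_mem (proj_mem_genAlg (q := q) r m) hb))
        have h1 : proj q T s (m + 1 + 1) (a y) = c • v := by
          simp only [Module.End.mul_apply] at hc
          rw [proj_succ, hy, hc, map_smul, aeval_of_eigen hv2, eval_lagr_self, one_smul]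
        set r' := Function.update r (m + 1) i
        by_cases hsw : Swappable r' m
        · have h2 := S.T_sub_mem (show m + 2 ≤ n by omega) hri (k := m) (by omega) hsw.1 hyr
          set z := T m y - tau q r' m • y with hz
          have hTy : T m y = z + tau q r' m • y := by rw [hz]; abel
          have h3 : murphy q T (m + 1) (a z) = qInt q (cont (sw m r') (m + 1)) • a z := by
            rw [hJ a ha, h2 (m + 1) (Nat.lt_succ_self _), map_smul]
          have h4 : proj q T s (m + 1 + 1) (a z) = 0 := by
            rw [proj_succ, ← Module.End.mul_apply]
            have : Commute (proj q T s (m + 1)) (Polynomial.aeval (murphy q T (m + 1))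
                (lagr q (m + 1) (cont s (m + 1)))) :=
              commute_of_mem_genAlg (fun i hi => (Polynomial.aeval_mem_adjoin_singleton ℂ _ |>
                Algebra.commute_of_mem_adjoin_singleton_of_commute <|
                  (H.commute_murphy_of_gt S.ne_zero hm (by omega)))) (proj_mem_genAlg s m)
            rw [← this.eq, Module.End.mul_apply, aeval_of_eigen h3, eval_lagr_of_ne, zero_smul,
              map_zero]
            · exact (hri.sw hsw.2).cont_mem (Nat.lt_succ_self _)
            · rw [cont_sw_right hsw.1, hci]
              intro heq
              have h5 := hri.cont_dist (k := m) (by omega) hsw.2 hsw.1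
              have := S.qNonzero.inj S.ne_zero (by omega) (by omega) heq
              omega
          exact ⟨tau q r' m * c, by rw [hTy, map_add, map_add, h4, zero_add, map_smul, map_smul, h1,
            smul_smul]⟩
        · exact ⟨tau q r' m * c, by rw [S.T_eq (show m + 2 ≤ n by omega) hri (by omega) hsw hyr,
            map_smul, map_smul, h1, smul_smul]⟩
      choose! c hc using key
      refine ⟨∑ r ∈ latticeWords (m + 1), c r, ?_⟩
      rw [Module.End.mul_apply, Module.End.mul_apply]
      conv_lhs => rw [← S.sum_proj (show m + 1 ≤ n by omega) (b v)]
      rw [map_sum, map_sum, map_sum, Finset.sum_smul]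
      exact Finset.sum_congr rfl hc
    · rintro x y - - ⟨c, hc⟩ ⟨d, hd⟩
      exact ⟨c + d, by rw [LinearMap.add_apply, map_add, hc, hd, add_smul]⟩
    · rintro a x - ⟨c, hc⟩
      exact ⟨a * c, by rw [LinearMap.smul_apply, map_smul, hc, smul_smul]⟩

/-- Central elements act by scalars on the eigenspace of a standard tableau. -/
theorem IsSemisimpleFamily.central_scalar (S : IsSemisimpleFamily n q T) {m : ℕ} (hm : m < n)
    {s : ℕ → ℕ} (hs : IsLattice (m + 1) s) {e : Module.End ℂ V} (he : e ∈ genAlg T m)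
    (hcent : ∀ i < m, Commute (T i) e) :
    ∃ c : ℂ, ∀ v ∈ jmSpace q T s (m + 1), e v = c • v := by
  have h1 : ∀ v ∈ jmSpace q T s (m + 1), ∃ c : ℂ, e v = c • v := by
    intro v hv
    obtain ⟨c, hc⟩ := S.proj_primitive hm hs hv he
    refine ⟨c, ?_⟩
    rw [← hc, proj_of_mem]
    intro k hk
    have := commute_of_mem_genAlg hcent
      (genAlg_mono (show k ≤ m by omega) (murphy_mem_genAlg (q := q) (T := T) k))
    rw [show murphy q T k (e v) = e (murphy q T k v) from LinearMap.congr_fun this.eq v, hv k hk,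
      map_smul]
  -- So far the scalar may depend on the vector. Comparing the scalars at `v0`, `v` and `v0 + v`
  -- shows that it does not.
  by_cases hall : ∀ v ∈ jmSpace q T s (m + 1), v = 0
  · exact ⟨0, fun v hv => by rw [hall v hv]; simp⟩
  push Not at hall
  obtain ⟨v0, hv0, hne⟩ := hall
  obtain ⟨c0, hc0⟩ := h1 v0 hv0
  refine ⟨c0, fun v hv => ?_⟩
  obtain ⟨c, hc⟩ := h1 v hv
  obtain ⟨d, hd⟩ := h1 _ (add_mem hv0 hv)
  have h2 : (d - c0) • v0 = (c - d) • v := by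
    rw [map_add, hc0, hc, ← sub_eq_zero] at hd
    rw [← sub_eq_zero, ← neg_eq_zero, ← hd]; module
  by_cases hcd : c - d = 0
  · rw [hcd, zero_smul] at h2
    have h3 := (smul_eq_zero.1 h2).resolve_right hne
    rw [hc, show c = c0 by linear_combination hcd + h3]
  · have h3 : v = ((c - d)⁻¹ * (d - c0)) • v0 := by
      rw [mul_smul, h2, smul_smul, inv_mul_cancel₀ hcd, one_smul]
    rw [h3, map_smul, hc0, smul_comm]

end Primitive


/-! ## The action on words -/

section WordAction

variable {n : ℕ} {q : ℂ}

theorem rightMul_add (x y : Hecke n q) : rightMul (x + y) = rightMul x + rightMul y := by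
  simp [rightMul]

theorem rightMul_smul (c : ℂ) (x : Hecke n q) : rightMul (c • x) = c • rightMul x := by
  simp [rightMul]

theorem rightMul_one : rightMul (1 : Hecke n q) = 1 := by
  simp [rightMul]

theorem rightMul_zero : rightMul (0 : Hecke n q) = 0 := by
  simp [rightMul]

theorem rightMul_mul' (x y : Hecke n q) : rightMul (x * y) = rightMul y * rightMul x :=
  LinearMap.ext fun v => rightMul_mul x y v

/-- The operators by which the generators act on words. -/
def opT (n : ℕ) (q : ℂ) (i : ℕ) : Module.End ℂ (Words n) := rightMul (heckeT n q i)

theorem isHeckeFamily_opT (n : ℕ) (q : ℂ) : IsHeckeFamily n q (opT n q) where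
  quad i hi := by
    rw [opT, ← rightMul_mul', (isHeckeFamily_heckeT n q).quad i hi, rightMul_add, rightMul_smul,
      rightMul_smul, rightMul_one]
  comm i j h hj := by
    rw [opT, opT, ← rightMul_mul', ← rightMul_mul', (isHeckeFamily_heckeT n q).comm i j h hj]
  braid i hi := by
    simp only [opT, ← rightMul_mul']
    rw [← mul_assoc, ← mul_assoc, (isHeckeFamily_heckeT n q).braid i hi]

theorem rightMul_murphy (k : ℕ) : rightMul (murphy q (heckeT n q) k) = murphy q (opT n q) k := by
  induction k with
  | zero => exact rightMul_zero
  | succ k ih =>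
    rw [murphy, murphy, rightMul_smul, rightMul_add, rightMul_mul', rightMul_mul', ih, opT,
      mul_assoc]

theorem rightMul_aeval (x : Hecke n q) (p : Polynomial ℂ) :
    rightMul (Polynomial.aeval x p) = Polynomial.aeval (rightMul x) p := by
  induction p using Polynomial.induction_on' with
  | add p s hp hs => rw [map_add, map_add, rightMul_add, hp, hs]
  | monomial k c =>
    have : ∀ k : ℕ, rightMul (x ^ k) = rightMul x ^ k := by
      intro k
      induction k with
      | zero => simp [rightMul_one]
      | succ k ih => rw [pow_succ, rightMul_mul', ih, pow_succ']
    rw [Polynomial.aeval_monomial, Polynomial.aeval_monomial, Algebra.algebraMap_eq_smul_one,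
      Algebra.algebraMap_eq_smul_one, smul_mul_assoc, one_mul, smul_mul_assoc, one_mul,
      rightMul_smul, this]

/-- Subspaces invariant under the generators are invariant under the Hecke algebra. -/
theorem rightMul_mem {p : Submodule ℂ (Words n)} (hp : ∀ i, i + 1 < n → ∀ v ∈ p, opT n q i v ∈ p)
    (x : Hecke n q) : ∀ v ∈ p, rightMul x v ∈ p := by
  induction x using hecke_induction with
  | h1 => intro v hv; rw [rightMul_one]; exact hv
  | hadd x y hx hy => intro v hv; rw [rightMul_add]; exact p.add_mem (hx v hv) (hy v hv)
  | hsmul c x hx => intro v hv; rw [rightMul_smul]; exact p.smul_mem c (hx v hv)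
  | hmul x i hi hx => intro v hv; rw [rightMul_mul]; exact hp i hi _ (hx v hv)

/-- Extension of a word of length `n` by zeros. -/
def ext (w : Fin n → ℕ) : ℕ → ℕ := fun m => if h : m < n then w ⟨m, h⟩ else 0

/-- The word formed by the first `n` letters. -/
def wd (n : ℕ) (r : ℕ → ℕ) : Fin n → ℕ := fun k => r k

theorem ext_of_lt (w : Fin n → ℕ) {m : ℕ} (h : m < n) : ext w m = w ⟨m, h⟩ := dif_pos h

theorem wd_ext (w : Fin n → ℕ) : wd n (ext w) = w := by
  funext k; exact ext_of_lt w k.2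

theorem ext_wd (r : ℕ → ℕ) {m : ℕ} (h : m < n) : ext (wd n r) m = r m := ext_of_lt _ h

theorem ext_swapWord {i : ℕ} (hi : i + 1 < n) (w : Fin n → ℕ) :
    ext (swapWord ⟨i, hi⟩ w) = sw i (ext w) := by
  funext m
  by_cases hm : m < n
  · rw [ext_of_lt _ hm, swapWord_apply]
    split_ifs with h1 h2
    · subst h1; rw [sw_left, ext_of_lt _ hi]
    · subst h2; rw [sw_right, ext_of_lt _ (show i < n by omega)]
    · rw [sw_of_ne _ h1 h2, ext_of_lt _ hm]
  · rw [ext, dif_neg hm, sw_of_ne _ (by omega) (by omega), ext, dif_neg hm]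

theorem opT_single {i : ℕ} (hi : i + 1 < n) (w : Fin n → ℕ) :
    opT n q i (Finsupp.single w 1) =
      cA q (ext w i) (ext w (i + 1)) • Finsupp.single w 1 +
      cB q (ext w i) (ext w (i + 1)) • Finsupp.single (swapWord ⟨i, hi⟩ w) 1 := by
  rw [opT, heckeT_of_lt hi, rightMul_gen, wordOp_single, one_mul, one_mul, ext_of_lt w hi,
    ext_of_lt w (show i < n by omega)]

/-- Coefficients of the image of a vector under a generator. -/
theorem opT_apply {i : ℕ} (hi : i + 1 < n) (v : Words n) (w : Fin n → ℕ) :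
    opT n q i v w = cA q (ext w i) (ext w (i + 1)) * v w +
      cB q (ext w (i + 1)) (ext w i) * v (swapWord ⟨i, hi⟩ w) := by
  induction v using Finsupp.induction_linear with
  | zero => simp
  | add f g hf hg => rw [map_add, Finsupp.add_apply, hf, hg, Finsupp.add_apply, Finsupp.add_apply]; ring
  | single x c =>
    have e : Finsupp.single x c = c • Finsupp.single x (1 : ℂ) := by simp
    have hs : swapWord ⟨i, hi⟩ w = x ↔ w = swapWord ⟨i, hi⟩ x :=
      ⟨fun h => by rw [← h, swapWord_swapWord], fun h => by rw [h, swapWord_swapWord]⟩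
    rw [e, map_smul, opT_single hi]
    simp only [Finsupp.smul_apply, Finsupp.add_apply, smul_eq_mul, Finsupp.single_apply]
    have h1 : (if x = w then (1 : ℂ) else 0) * cA q (ext x i) (ext x (i + 1)) =
        cA q (ext w i) (ext w (i + 1)) * if x = w then 1 else 0 := by
      split_ifs with h
      · rw [h]; ring
      · ring
    have h2 : (if swapWord ⟨i, hi⟩ x = w then (1 : ℂ) else 0) * cB q (ext x i) (ext x (i + 1)) =
        cB q (ext w (i + 1)) (ext w i) * if x = swapWord ⟨i, hi⟩ w then 1 else 0 := by
      by_cases h : w = swapWord ⟨i, hi⟩ x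
      · rw [if_pos h.symm, if_pos (hs.2 h).symm, h, ext_swapWord, sw_left, sw_right]; ring
      · rw [if_neg fun h' => h h'.symm, if_neg fun h' => h (hs.1 h'.symm)]; ring
    linear_combination c * h1 + c * h2

theorem opT_of_lt {i : ℕ} (hi : i + 1 < n) (w : Fin n → ℕ) (h : ext w i < ext w (i + 1)) :
    opT n q i (Finsupp.single w 1) = Finsupp.single (swapWord ⟨i, hi⟩ w) 1 := by
  rw [opT_single hi, cA, cB, if_neg h.ne, if_pos h, if_neg h.ne, if_pos h]; simp

theorem opT_mem_supported {i : ℕ} (hi : i + 1 < n) {s : Set (Fin n → ℕ)}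
    (hs : ∀ w ∈ s, swapWord ⟨i, hi⟩ w ∈ s) {v : Words n} (hv : v ∈ Finsupp.supported ℂ ℂ s) :
    opT n q i v ∈ Finsupp.supported ℂ ℂ s := by
  rw [Finsupp.mem_supported'] at hv ⊢
  intro w hw
  rw [opT_apply hi, hv w hw, hv _ fun h => hw ?_]
  · ring
  · have := hs _ h
    rwa [swapWord_swapWord] at this

theorem algebraic_of_invariant {V : Type*} [AddCommGroup V] [Module ℂ V] (f : Module.End ℂ V)
    (U : Submodule ℂ V) [FiniteDimensional ℂ U] (hU : ∀ x ∈ U, f x ∈ U) {v : V} (hv : v ∈ U) :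
    ∃ p : Polynomial ℂ, p ≠ 0 ∧ Polynomial.aeval f p v = 0 := by
  have key : ∀ p : Polynomial ℂ, ∀ x : U,
      (Polynomial.aeval (f.restrict hU) p x : V) = Polynomial.aeval f p x := by
    intro p
    induction p using Polynomial.induction_on with
    | C a => intro x; simp
    | add p s hp hs => intro x; simp [hp, hs]
    | monomial k a h =>
      intro x
      have := h (f.restrict hU x)
      simp only [map_mul, Polynomial.aeval_C, map_pow, Polynomial.aeval_X, Module.End.mul_apply,
        pow_succ, LinearMap.coe_restrict_apply] at this ⊢
      exact this
  refine ⟨minpoly ℂ (f.restrict hU), minpoly.ne_zero (Algebra.IsIntegral.isIntegral _), ?_⟩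
  have := key (minpoly ℂ (f.restrict hU)) ⟨v, hv⟩
  rw [minpoly.aeval] at this
  exact this.symm

theorem finite_bounded_words (n N : ℕ) : {w : Fin n → ℕ | ∀ k, w k < N}.Finite := by
  have : {w : Fin n → ℕ | ∀ k, w k < N} = Set.pi Set.univ fun _ => Set.Iio N := by
    ext w; simp
  rw [this]
  exact Set.Finite.pi fun _ => Set.finite_Iio N

/-- Finite dimensional subspaces of words invariant under the Hecke algebra. -/
theorem exists_invariant (n : ℕ) (q : ℂ) (v : Words n) : ∃ U : Submodule ℂ (Words n),
    FiniteDimensional ℂ U ∧ v ∈ U ∧ ∀ i, i + 1 < n → ∀ x ∈ U, opT n q i x ∈ U := by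
  obtain ⟨N, hN⟩ : ∃ N, ∀ w ∈ v.support, ∀ k, w k < N := by
    refine ⟨v.support.sup (fun w => Finset.univ.sup w) + 1, fun w hw k => Nat.lt_succ_of_le ?_⟩
    exact (Finset.le_sup (f := w) (Finset.mem_univ k)).trans
      (Finset.le_sup (f := fun w : Fin n → ℕ => Finset.univ.sup w) hw)
  have := (finite_bounded_words n N).to_subtype
  refine ⟨Finsupp.supported ℂ ℂ {w | ∀ k, w k < N}, ?_, fun w hw => hN w hw, ?_⟩
  · exact Module.Finite.equiv (Finsupp.supportedEquivFinsupp (M := ℂ) (R := ℂ) _).symm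
  · exact fun i hi x hx => opT_mem_supported hi (fun w (hw : ∀ k, w k < N) k => hw _) hx

/-- The alphabet is infinite, but words with bounded letters span finite dimensional invariant
subspaces, so every Jucys-Murphy element is locally algebraic. -/
theorem isSemisimpleFamily_opT (hq : q ≠ 0) (hN : QNonzero n q) :
    IsSemisimpleFamily n q (opT n q) where
  hecke := isHeckeFamily_opT n q
  ne_zero := hq
  qNonzero := hN
  algebraic k hk v := by
    obtain ⟨U, hU, hv, hT⟩ := exists_invariant n q v
    refine algebraic_of_invariant _ U (fun x hx => ?_) hv
    rw [← rightMul_murphy]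
    exact rightMul_mem hT _ x hx

end WordAction

/-! ### Antisymmetric vectors and the dominance order -/

section Dominance

variable {n : ℕ} {q : ℂ}

theorem QNonzero.add_one_ne_zero (hq : q ≠ 0) (hN : QNonzero n q) (hn : 2 ≤ n) : q + 1 ≠ 0 := by
  have := hN 2 (by omega) hn
  rw [show ((2 : ℕ) : ℤ) = 1 + 1 by norm_num, qInt_add_one hq, qInt_one hq, mul_one] at this
  exact this

/-- At a word with two equal letters the generator multiplies the coefficient by `q ≠ -1`. At other
words the coefficients before and after the exchange are proportional with a nonzero factor. -/
theorem apply_eq_zero_of_antisymm (hq : q ≠ 0) (hq1 : q + 1 ≠ 0) {i : ℕ} (hi : i + 1 < n)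
    {v : Words n} (hv : opT n q i v = (-1 : ℂ) • v) {w : Fin n → ℕ} :
    (ext w i = ext w (i + 1) → v w = 0) ∧ (v (swapWord ⟨i, hi⟩ w) = 0 → v w = 0) := by
  have h := opT_apply (q := q) hi v w
  rw [hv, Finsupp.smul_apply, smul_eq_mul, cA, cB] at h
  constructor
  · intro he
    rw [if_pos he, if_pos he.symm] at h
    have : (q + 1) * v w = 0 := by linear_combination -h
    exact (mul_eq_zero.1 this).resolve_left hq1
  · intro h0
    rw [h0, mul_zero, add_zero] at h
    split_ifs at h with h1 h2
    · have : (q + 1) * v w = 0 := by linear_combination -h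
      exact (mul_eq_zero.1 this).resolve_left hq1
    · linear_combination -h
    · have : q * v w = 0 := by linear_combination -h
      exact (mul_eq_zero.1 this).resolve_left hq

/-- Inside the antisymmetric block, the letter in position `p'` can be moved next to position `p`
without making the coefficient zero, which reduces to adjacent positions. -/
theorem ne_of_antisymm (hq : q ≠ 0) (hq1 : q + 1 ≠ 0) {v : Words n} {p p' : ℕ} (hpp : p < p')
    (hp : p' < n) (hv : ∀ j, p ≤ j → j < p' → opT n q j v = (-1 : ℂ) • v) {w : Fin n → ℕ}
    (hw : v w ≠ 0) : ext w p ≠ ext w p' := by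
  induction p', hpp using Nat.le_induction generalizing w with
  | base => exact fun h => hw ((apply_eq_zero_of_antisymm hq hq1 hp (hv p le_rfl (by omega))).1 h)
  | succ p' hpp ih =>
    intro h
    refine hw ((apply_eq_zero_of_antisymm hq hq1 hp (hv p' (by omega) (by omega))).2 ?_)
    by_contra h0
    refine ih (by omega) (fun j h1 h2 => hv j h1 (by omega)) h0 ?_
    rw [ext_swapWord, sw_left, sw_of_ne _ (by omega) (by omega), h]

theorem supported_prefix_invariant {k : ℕ} (hk : k ≤ n) (α : ℕ → ℕ) {i : ℕ} (hi : i + 1 < k)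
    {v : Words n} (hv : v ∈ Finsupp.supported ℂ ℂ {w | cnt (ext w) k = α}) :
    opT n q i v ∈ Finsupp.supported ℂ ℂ {w | cnt (ext w) k = α} := by
  refine opT_mem_supported (by omega) (fun w hw => ?_) hv
  rw [Set.mem_ofPred_eq, ext_swapWord, cnt_sw_of_ge _ (by omega)]
  exact hw

/-- If the eigenspace of a tableau of shape `cnt r k` contains a vector of content `α`, then
`cnt r k` dominates `α`. -/
theorem dominance (hq : q ≠ 0) (hN : QNonzero n q) {k : ℕ} (hk : k ≤ n) {r α : ℕ → ℕ}
    (hr : IsLattice k r) {v : Words n} (hv0 : v ≠ 0) (hv : v ∈ jmSpace q (opT n q) r k)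
    (hα : v ∈ Finsupp.supported ℂ ℂ {w | cnt (ext w) k = α}) (b : ℕ) :
    ∑ i ∈ Finset.range b, α i ≤ ∑ i ∈ Finset.range b, cnt r k i := by
  have S := isSemisimpleFamily_opT hq hN
  obtain ⟨c', hc', hcnt, hblock, -⟩ := exists_column_lattice k r hr
  set c : ℕ → ℕ := fun x => if x < k then c' x else r x with hcdef
  have hcc : ∀ x < k, c' x = c x := fun x hx => by simp [hcdef, hx]
  have hc : IsLattice k c := hc'.congr hcc
  rw [cnt_congr hcc] at hcnt
  have hblock' : ∀ p, p + 1 < k →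
      (c (p + 1) = c p + 1 ∧ cnt c p (c p + 1) = cnt c p (c p)) ∨ c (p + 1) = 0 := by
    intro p hp
    rw [← hcc _ hp, ← hcc p (by omega), ← cnt_congr fun x (hx : x < p) => hcc x (by omega)]
    exact hblock p hp
  -- The vector is transported to the column reading tableau of the same shape, and its content `α`
  -- is kept. There the generators inside a column act by `-1`, so the words in the support have
  -- distinct letters in every column.
  obtain ⟨v', hv', hvp, hvc⟩ := S.hecke.exists_transport hq hN hk (r := r) (r' := c)
    (fun R h1 h2 h3 => lattice_connected R h1 h2 (j := 0) (fun r k _ => h3 r k) hr hc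
      (fun x hx => by
        have : ¬ x < k := by omega
        simp [hcdef, this]) hcnt.symm)
    _ (fun i hi x hx => supported_prefix_invariant hk α hi hx) hv0 hα hv
  obtain ⟨w, hw⟩ : ∃ w, v' w ≠ 0 := by
    by_contra h
    push Not at h
    exact hv' (Finsupp.ext h)
  have hwα : cnt (ext w) k = α := by
    by_contra h
    exact hw ((Finsupp.mem_supported' ℂ v').1 hvp w h)
  have hanti : ∀ p, p + 1 < k → c (p + 1) = c p + 1 → opT n q p v' = (-1 : ℂ) • v' := by
    intro p hp h
    have h1 := (hblock' p hp).resolve_right (by omega)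
    have hns : ¬ Swappable c p := fun hs => by
      have := hs.2 (c p) h.symm
      rw [h] at this
      omega
    rw [S.T_eq hk hc hp hns hvc, tau_eq_of_column hq]
    rw [cont, cont, cnt_succ, if_neg (by omega), h]
    push_cast
    omega
  have hle : ∀ p < k, c p ≤ p := fun p hp => hc.le hp
  have hb2 : ∀ p, p + 1 < k → c (p + 1) = c p + 1 ∨ c (p + 1) = 0 :=
    fun p hp => (hblock' p hp).imp_left And.left
  rw [← hwα, ← hcnt, sum_cnt, sum_cnt]
  refine card_lt_le_of_columns hle hb2 (fun p p' hpp hp h => ?_) b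
  exact ne_of_antisymm hq (hN.add_one_ne_zero hq (by omega)) hpp (by omega)
    (fun j h1 h2 => hanti j (by omega) (column_steps hle hb2 hp h j h1 h2)) hw

theorem invariant_of_mem_genAlg {V : Type*} [AddCommGroup V] [Module ℂ V]
    {T : ℕ → Module.End ℂ V} {m : ℕ} {x : Module.End ℂ V}
    (hx : x ∈ genAlg T m) {p : Submodule ℂ V} (hp : ∀ i < m, ∀ v ∈ p, T i v ∈ p) :
    ∀ v ∈ p, x v ∈ p := by
  induction hx using Algebra.adjoin_induction with
  | mem x hx => obtain ⟨i, hi, rfl⟩ := hx; exact hp i hi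
  | algebraMap c => intro v hv; rw [Module.algebraMap_end_apply]; exact p.smul_mem c hv
  | add x y _ _ h1 h2 => exact fun v hv => p.add_mem (h1 v hv) (h2 v hv)
  | mul x y _ _ h1 h2 => exact fun v hv => h1 _ (h2 v hv)

theorem proj_mem_supported {k : ℕ} (hk : k ≤ n) (r : ℕ → ℕ) {α : ℕ → ℕ} {v : Words n}
    (hv : v ∈ Finsupp.supported ℂ ℂ {w | cnt (ext w) k = α}) :
    proj q (opT n q) r k v ∈ Finsupp.supported ℂ ℂ {w | cnt (ext w) k = α} := by
  rcases k with _ | k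
  · exact hv
  · exact invariant_of_mem_genAlg (proj_mem_genAlg r k)
      (fun i hi v hv => supported_prefix_invariant hk α (by omega) hv) v hv

theorem proj_eq_zero_mono {V : Type*} [AddCommGroup V] [Module ℂ V] {T : ℕ → Module.End ℂ V}
    {r : ℕ → ℕ} {k l : ℕ} (h : k ≤ l) {v : V} (hv : proj q T r k v = 0) : proj q T r l v = 0 := by
  induction l, h using Nat.le_induction with
  | base => exact hv
  | succ l _ ih => rw [proj_succ, ih, map_zero]

/-- The word of a tableau has only components at tableaux which dominate it. -/
theorem dominance_of_proj_ne_zero (hq : q ≠ 0) (hN : QNonzero n q) {r : ℕ → ℕ}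
    (hr : IsLattice n r) {w : Fin n → ℕ}
    (h : proj q (opT n q) r n (Finsupp.single w 1) ≠ 0) {k : ℕ} (hk : k ≤ n) (b : ℕ) :
    ∑ i ∈ Finset.range b, cnt (ext w) k i ≤ ∑ i ∈ Finset.range b, cnt r k i := by
  have S := isSemisimpleFamily_opT hq hN
  refine dominance hq hN hk (hr.mono hk)
    (v := proj q (opT n q) r k (Finsupp.single w 1)) (fun h0 => h (proj_eq_zero_mono hk h0))
    (S.proj_mem hk (hr.mono hk) _) (proj_mem_supported hk r ?_) b
  exact Finsupp.single_mem_supported ℂ _ rfl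

end Dominance


/-! ### Products over pairs of positions -/

section PairProd

variable {n : ℕ}

/-- The product of `g (w p) (w p')` over the positions `p < p'` of the same block. -/
def pairProd (b : ℕ → ℕ) (g : ℕ → ℕ → ℂ) (w : Fin n → ℕ) : ℂ :=
  ∏ x : Fin n × Fin n with x.1 < x.2 ∧ b x.1 = b x.2, g (w x.1) (w x.2)

/-- Exchanging adjacent positions permutes the other pairs while preserving their order, so only one
factor changes. The blocks are the columns for antisymmetric vectors, and there is a single block
for the inversion weight. -/
theorem pairProd_swapWord (b : ℕ → ℕ) (g : ℕ → ℕ → ℂ) {i : ℕ} (hi : i + 1 < n)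
    (hb : b i = b (i + 1)) (w : Fin n → ℕ) : ∃ F : ℂ,
    pairProd b g w = g (ext w i) (ext w (i + 1)) * F ∧
    pairProd b g (swapWord ⟨i, hi⟩ w) = g (ext w (i + 1)) (ext w i) * F := by
  set a : Fin n := ⟨i, by omega⟩ with ha
  set a' : Fin n := ⟨i + 1, hi⟩ with ha'
  set P : Finset (Fin n × Fin n) :=
    ({x : Fin n × Fin n | x.1 < x.2 ∧ b x.1 = b x.2} : Finset (Fin n × Fin n)) with hP
  have haP : (a, a') ∈ P := by
    rw [hP, Finset.mem_filter]
    exact ⟨Finset.mem_univ _, by simp [ha, ha'], hb⟩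
  have key : ∀ w : Fin n → ℕ, pairProd b g w = g (w a) (w a') *
      ∏ x ∈ P.erase (a, a'), g (w x.1) (w x.2) := fun w =>
    (Finset.mul_prod_erase P (fun x => g (w x.1) (w x.2)) haP).symm
  have hs : ∀ x : Fin n, ((Equiv.swap a a' x : Fin n) : ℕ) =
      if (x : ℕ) = i then i + 1 else if (x : ℕ) = i + 1 then i else x := by
    intro x
    rw [Equiv.swap_apply_def]
    simp only [Fin.ext_iff, ha, ha']
    split_ifs <;> rfl
  have hbs : ∀ x : Fin n, b (Equiv.swap a a' x : Fin n) = b x := by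
    intro x
    rw [hs]
    split_ifs with h1 h2
    · rw [h1, hb]
    · rw [h2, hb]
    · rfl
  have hmem : ∀ x ∈ P.erase (a, a'),
      (Equiv.swap a a' x.1, Equiv.swap a a' x.2) ∈ P.erase (a, a') := by
    rintro ⟨x, y⟩ h
    simp only [hP, Finset.mem_erase, Finset.mem_filter, Finset.mem_univ, true_and, ne_eq,
      Prod.mk.injEq, hbs] at h ⊢
    simp only [Fin.ext_iff, Fin.lt_def, hs] at h ⊢
    refine ⟨?_, ?_, h.2.2⟩
    all_goals
      simp only [ha, ha'] at *
      split_ifs <;> omega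
  refine ⟨∏ x ∈ P.erase (a, a'), g (w x.1) (w x.2), ?_, ?_⟩
  · rw [key, ext_of_lt w hi, ext_of_lt w (show i < n by omega)]
  · rw [key, ext_of_lt w hi, ext_of_lt w (show i < n by omega)]
    have e1 : swapWord ⟨i, hi⟩ w a = w a' := by
      simp only [swapWord, Function.comp, ha, ha', Equiv.swap_apply_left]
    have e2 : swapWord ⟨i, hi⟩ w a' = w a := by
      simp only [swapWord, Function.comp, ha, ha', Equiv.swap_apply_right]
    rw [e1, e2]
    congr 1
    refine Finset.prod_nbij' (fun x => (Equiv.swap a a' x.1, Equiv.swap a a' x.2))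
      (fun x => (Equiv.swap a a' x.1, Equiv.swap a a' x.2)) hmem hmem ?_ ?_ ?_
    · intro x _; simp
    · intro x _; simp
    · intro x _; rfl

end PairProd

/-! ### Seminormal units -/

section Seminormal

variable {n : ℕ} {q : ℂ}

/-- The seminormal unit of the tableau given by a lattice word. -/
def unit (n : ℕ) (q : ℂ) (r : ℕ → ℕ) : Words n := proj q (opT n q) r n (Finsupp.single (wd n r) 1)

theorem unit_congr {r r' : ℕ → ℕ} (h : ∀ x < n, r x = r' x) : unit n q r = unit n q r' := by
  rw [unit, unit, proj_congr h, show wd n r = wd n r' from funext fun k => h k k.2]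

theorem unit_mem (hq : q ≠ 0) (hN : QNonzero n q) {r : ℕ → ℕ} (hr : IsLattice n r) :
    unit n q r ∈ jmSpace q (opT n q) r n := (isSemisimpleFamily_opT hq hN).proj_mem le_rfl hr _

theorem sum_cnt_lt_of_swap {r : ℕ → ℕ} {k : ℕ} (h : r k < r (k + 1)) :
    ∑ i ∈ Finset.range (r (k + 1)), cnt (sw k r) (k + 1) i <
      ∑ i ∈ Finset.range (r (k + 1)), cnt r (k + 1) i := by
  rw [Finset.sum_congr rfl fun i _ => cnt_succ (sw k r) k i,
    Finset.sum_congr rfl fun i _ => cnt_succ r k i, Finset.sum_add_distrib, Finset.sum_add_distrib,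
    cnt_sw_of_le r le_rfl, sw_left, Finset.sum_ite_eq, Finset.sum_ite_eq, if_neg (by simp),
    if_pos (by simpa using h)]
  omega

/-- The action of a generator on the seminormal units. -/
theorem unit_sw (hq : q ≠ 0) (hN : QNonzero n q) {r : ℕ → ℕ} (hr : IsLattice n r) {k : ℕ}
    (hk : k + 1 < n) (hs : Swappable r k) (h : r k < r (k + 1)) :
    unit n q (sw k r) = opT n q k (unit n q r) - tau q r k • unit n q r := by
  have S := isSemisimpleFamily_opT hq hN
  have hsr := hr.sw hs.2
  have e : Finsupp.single (wd n (sw k r)) 1 = opT n q k (Finsupp.single (wd n r) 1) := by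
    rw [opT_of_lt hk]
    · congr 1
      rw [← wd_ext (swapWord ⟨k, hk⟩ (wd n r)), ext_swapWord]
      funext x
      simp only [wd, sw, Function.comp]
      refine (ext_wd r ?_).symm
      have := x.2
      rw [Equiv.swap_apply_def]
      split_ifs <;> omega
    · rwa [ext_wd r hk, ext_wd r (by omega)]
  -- The word of `r` has components only at tableaux that dominate it. `sw k r` does not, since the
  -- smaller row has left the first `k + 1` entries.
  have h0 : proj q (opT n q) (sw k r) n (Finsupp.single (wd n r) 1) = 0 := by
    by_contra h0
    have := dominance_of_proj_ne_zero hq hN hsr h0 (k := k + 1) (by omega) (r (k + 1))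
    rw [cnt_congr (r := ext (wd n r)) (r' := r) fun m hm => ext_wd r (by omega)] at this
    have := sum_cnt_lt_of_swap h
    omega
  rw [unit, e, S.proj_T le_rfl hsr hk (hs.sw (by omega) hr), h0, smul_zero, zero_add, sw_sw]
  rfl

theorem unit_sw_ne_zero_iff (hq : q ≠ 0) (hN : QNonzero n q) {r : ℕ → ℕ} (hr : IsLattice n r)
    {k : ℕ} (hk : k + 1 < n) (hs : Swappable r k) (h : r k < r (k + 1)) :
    unit n q (sw k r) ≠ 0 ↔ unit n q r ≠ 0 := by
  rw [unit_sw hq hN hr hk hs h]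
  refine ⟨fun h0 h1 => h0 ?_, fun h0 => ?_⟩
  · rw [h1]; simp
  · exact (isSemisimpleFamily_opT hq hN).T_sub_ne_zero le_rfl hr hk hs h0

/-- A block-antisymmetric vector. -/
theorem exists_antisymm (hq : q ≠ 0) {c : ℕ → ℕ} (hc : ∀ p < n, c p ≤ p) :
    ∃ v : Words n, v ≠ 0 ∧ (v ∈ Finsupp.supported ℂ ℂ {w | cnt (ext w) n = cnt c n}) ∧
      ∀ p, p + 1 < n → c (p + 1) = c p + 1 → opT n q p v = (-1 : ℂ) • v := by
  classical
  -- The blocks are the columns, labelled by their first positions. The vector is the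
  -- q-antisymmetrization of the word of `c` along the columns: each inversion within a column
  -- contributes the factor `-q⁻¹`.
  set b : ℕ → ℕ := fun p => p - c p with hb
  set g : ℕ → ℕ → ℂ := fun x y => if x < y then 1 else if x = y then 0 else -q⁻¹ with hg
  set S : Set (Fin n → ℕ) :=
    {w | ∃ σ : Equiv.Perm (Fin n), (∀ p, b (σ p) = b p) ∧ w = wd n c ∘ σ} with hS
  have hfin : S.Finite := by
    refine (Set.finite_range fun σ : Equiv.Perm (Fin n) => wd n c ∘ σ).subset ?_
    rintro w ⟨σ, -, rfl⟩
    exact ⟨σ, rfl⟩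
  set f : (Fin n → ℕ) → ℂ := fun w => if w ∈ S then pairProd b g w else 0 with hf
  set v : Words n := Finsupp.onFinset hfin.toFinset f (fun w hw => by
    rw [Set.Finite.mem_toFinset]
    by_contra h
    exact hw (if_neg h)) with hv
  have hva : ∀ w, v w = f w := fun w => rfl
  have hswap : ∀ p (hp : p + 1 < n), c (p + 1) = c p + 1 → ∀ w ∈ S, swapWord ⟨p, hp⟩ w ∈ S := by
    rintro p hp hcp w ⟨σ, hσ, rfl⟩
    refine ⟨σ * Equiv.swap ⟨p, by omega⟩ ⟨p + 1, hp⟩, fun x => ?_, rfl⟩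
    rw [Equiv.Perm.mul_apply, hσ, Equiv.swap_apply_def]
    split_ifs with h1 h2
    · rw [h1]; simp only [hb, hcp]; have := hc p (by omega); omega
    · rw [h2]; simp only [hb, hcp]; have := hc p (by omega); omega
    · rfl
  refine ⟨v, ?_, ?_, ?_⟩
  · have h1 : wd n c ∈ S := ⟨1, fun p => rfl, rfl⟩
    intro h0
    have h2 : v (wd n c) = 0 := by rw [h0]; rfl
    rw [hva, hf] at h2
    simp only [if_pos h1, pairProd] at h2
    refine Finset.prod_ne_zero_iff.2 ?_ h2
    rintro ⟨x, y⟩ hxy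
    simp only [Finset.mem_filter, Finset.mem_univ, true_and, Fin.lt_def, hb] at hxy
    have := hc x x.2
    have := hc y y.2
    simp only [hg, wd]
    rw [if_pos (by omega)]
    exact one_ne_zero
  · rw [Finsupp.mem_supported']
    intro w hw
    rw [hva]
    refine if_neg ?_
    rintro ⟨σ, -, rfl⟩
    refine hw ?_
    funext i
    have hcard : ∀ r : ℕ → ℕ, cnt r n i = Finset.card {p : Fin n | r p = i} := by
      intro r
      rw [cnt]
      refine (Finset.card_bij (fun (p : Fin n) _ => (p : ℕ)) ?_ ?_ ?_).symm
      · intro p hp; simpa using hp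
      · intro p _ p' _ h; exact Fin.ext h
      · intro p hp
        rw [Finset.mem_filter, Finset.mem_range] at hp
        exact ⟨⟨p, hp.1⟩, by simpa using hp.2, rfl⟩
    rw [hcard, hcard]
    refine Finset.card_bij (fun p _ => σ p) ?_ (fun p _ p' _ h => σ.injective h) ?_
    · intro p hp
      rw [Finset.mem_filter] at hp ⊢
      rw [ext_of_lt _ p.2] at hp
      exact ⟨Finset.mem_univ _, hp.2⟩
    · intro p hp
      refine ⟨σ.symm p, ?_, σ.apply_symm_apply p⟩
      rw [Finset.mem_filter] at hp ⊢
      refine ⟨Finset.mem_univ _, ?_⟩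
      rw [ext_of_lt _ (σ.symm p).2]
      simp [wd, hp.2]
  · intro p hp hcp
    refine Finsupp.ext fun w => ?_
    rw [opT_apply hp, Finsupp.smul_apply, smul_eq_mul, hva, hva, hf]
    simp only
    by_cases hw : w ∈ S
    · rw [if_pos hw, if_pos (hswap p hp hcp w hw)]
      obtain ⟨F, h1, h2⟩ := pairProd_swapWord b g hp
        (by simp only [hb, hcp]; have := hc p (by omega); omega) w
      rw [h1, h2]
      simp only [hg, cA, cB]
      generalize ext w p = x
      generalize ext w (p + 1) = y
      rcases lt_trichotomy x y with h | h | h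
      · simp only [if_neg h.ne, if_neg h.ne', if_pos h, if_neg h.not_gt]
        field_simp
        ring
      · simp [h]
      · simp only [if_neg h.ne, if_neg h.ne', if_pos h, if_neg h.not_gt]
        field_simp
        ring
    · rw [if_neg hw, if_neg fun h => hw ?_]
      · ring
      · have := hswap p hp hcp _ h
        rwa [swapWord_swapWord] at this

/-- Weighted sum of letters; it decreases when a descent is removed. -/
def weight (n : ℕ) (r : ℕ → ℕ) : ℕ := ∑ p ∈ Finset.range n, (n - p) * r p

theorem weight_sw_lt {r : ℕ → ℕ} {k : ℕ} (hk : k + 1 < n) (h : r (k + 1) < r k) :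
    weight n (sw k r) < weight n r := by
  have key : ∀ r : ℕ → ℕ, weight n r = (n - k) * r k + ((n - (k + 1)) * r (k + 1) +
      ∑ p ∈ ((Finset.range n).erase k).erase (k + 1), (n - p) * r p) := by
    intro r
    rw [weight, ← Finset.add_sum_erase _ _ (Finset.mem_range.2 (show k < n by omega)),
      ← Finset.add_sum_erase ((Finset.range n).erase k) _ (a := k + 1)]
    rw [Finset.mem_erase, Finset.mem_range]
    omega
  rw [key, key r, sw_left, sw_right]
  have : ∑ p ∈ ((Finset.range n).erase k).erase (k + 1), (n - p) * sw k r p =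
      ∑ p ∈ ((Finset.range n).erase k).erase (k + 1), (n - p) * r p := by
    refine Finset.sum_congr rfl fun p hp => ?_
    simp only [Finset.mem_erase] at hp
    rw [sw_of_ne r hp.2.1 hp.1]
  rw [this]
  obtain ⟨m, hm⟩ : ∃ m, n - k = m + 1 := ⟨n - k - 1, by omega⟩
  rw [hm, show n - (k + 1) = m by omega]
  nlinarith

/-- If `1 + τ` vanished, the difference `d` of the contents would satisfy `[d]_q = [1]_q`, although
it is at least two in absolute value. -/
theorem one_add_tau_ne_zero (hq : q ≠ 0) (hN : QNonzero n q) {r : ℕ → ℕ} (hr : IsLattice n r)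
    {k : ℕ} (hk : k + 1 < n) (hs : Swappable r k) : 1 + tau q r k ≠ 0 := by
  have h0 := hr.qInt_cont_ne_zero hq hN le_rfl hk
  obtain ⟨h1, h2, h3⟩ := hr.cont_dist hk hs.2 hs.1
  set d := cont r k - cont r (k + 1) with hd
  intro h
  have h4 : qInt q d = qInt q 1 := by
    rw [qInt_one hq]
    have : (1 + tau q r k) * qInt q d = qInt q d - 1 := by
      rw [tau, ← hd]; field_simp; ring
    rw [h, zero_mul] at this
    linear_combination -this
  have := hN.inj hq (a := d) (b := 1) (by omega) (by omega) h4
  omega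

/-- Here vanishing would mean `[d + 1]_q = 0`. This is the factor in straightening, and its
invertibility allows exchanges in both directions. -/
theorem q_sub_tau_ne_zero (hq : q ≠ 0) (hN : QNonzero n q) {r : ℕ → ℕ} (hr : IsLattice n r)
    {k : ℕ} (hk : k + 1 < n) (hs : Swappable r k) : q - tau q r k ≠ 0 := by
  have h0 := hr.qInt_cont_ne_zero hq hN le_rfl hk
  obtain ⟨h1, h2, h3⟩ := hr.cont_dist hk hs.2 hs.1
  set d := cont r k - cont r (k + 1) with hd
  intro h
  have h4 : qInt q (d + 1) = 0 := by
    rw [qInt_add_one hq]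
    have : (q - tau q r k) * qInt q d = q * qInt q d + 1 := by
      rw [tau, ← hd]; field_simp; ring
    rw [h, zero_mul] at this
    exact this.symm
  exact hN.ne_zero hq (d := d + 1) (by omega) (by omega) (by omega) h4

/-- If `r` has a descent at a place where `v` is antisymmetric and `v` has no component at `sw p r`,
then its component at `r` is killed by `1 + τ`, so it vanishes. Hence such descents can be removed
while the component stays nonzero. Equal letters are impossible there, because the generator would
act by `q` as well as by `-1`. -/
theorem exists_increasing (hq : q ≠ 0) (hN : QNonzero n q) {c : ℕ → ℕ} {v : Words n}
    (hv : ∀ p, p + 1 < n → c (p + 1) = c p + 1 → opT n q p v = (-1 : ℂ) • v) (N : ℕ) :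
    ∀ r, weight n r = N → IsLattice n r → proj q (opT n q) r n v ≠ 0 →
    ∃ r', IsLattice n r' ∧ proj q (opT n q) r' n v ≠ 0 ∧
      ∀ p, p + 1 < n → c (p + 1) = c p + 1 → r' p < r' (p + 1) := by
  have S := isSemisimpleFamily_opT hq hN
  induction N using Nat.strong_induction_on with
  | _ N ih =>
    rintro r rfl hr h0
    by_cases hdesc : ∃ p, p + 1 < n ∧ c (p + 1) = c p + 1 ∧ r (p + 1) < r p
    · obtain ⟨p, hp, hcp, hd⟩ := hdesc
      have hs : Swappable r p := ⟨hd.ne', hr.addable_of_gt hp hd⟩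
      refine ih _ (weight_sw_lt hp hd) _ rfl (hr.sw hs.2) fun h1 => ?_
      have := S.proj_T le_rfl hr hp hs v
      rw [hv p hp hcp, map_smul, h1, map_zero, smul_zero, sub_zero, add_zero] at this
      have h2 : (1 + tau q r p) • proj q (opT n q) r n v = 0 := by
        rw [add_smul, ← this]; module
      exact (smul_eq_zero.1 h2).elim (one_add_tau_ne_zero hq hN hr hp hs) h0
    · push Not at hdesc
      refine ⟨r, hr, h0, fun p hp hcp => (hdesc p hp hcp).lt_of_ne fun he => ?_⟩
      have hs : ¬ Swappable r p := fun h => h.1 he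
      have := S.proj_T_of_not le_rfl hr hp hs v
      rw [hv p hp hcp, map_smul] at this
      rcases hr.cont_not_swappable hp hs with ⟨-, h⟩ | ⟨h, -⟩
      · rw [tau_eq_of_row hq h] at this
        have h2 : (q + 1) • proj q (opT n q) r n v = 0 := by
          rw [add_smul, ← this]; module
        exact (smul_eq_zero.1 h2).elim (hN.add_one_ne_zero hq (by omega)) h0
      · omega

/-- Among the words of a fixed content, one without descents has a component at some tableau. -/
theorem exists_sorted (hq : q ≠ 0) (hN : QNonzero n q) {α : ℕ → ℕ} (N : ℕ) :
    ∀ r w, weight n (ext w) = N → cnt (ext w) n = α → IsLattice n r → cnt r n = α →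
      proj q (opT n q) r n (Finsupp.single w 1) ≠ 0 →
    ∃ r' w', IsLattice n r' ∧ cnt r' n = α ∧ cnt (ext w') n = α ∧
      proj q (opT n q) r' n (Finsupp.single w' 1) ≠ 0 ∧
      ∀ p, p + 1 < n → ext w' p ≤ ext w' (p + 1) := by
  have S := isSemisimpleFamily_opT hq hN
  induction N using Nat.strong_induction_on with
  | _ N ih =>
    rintro r w rfl hw hr hrα h0
    by_cases hdesc : ∃ p, p + 1 < n ∧ ext w (p + 1) < ext w p
    · obtain ⟨p, hp, hd⟩ := hdesc
      -- The word `w` arises from its neighbour without this descent by applying `T_p`. A component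
      -- of `w` at `r` therefore comes from a component of that neighbour at `r` or at `sw p r`.
      have e : Finsupp.single w 1 =
          opT n q p (Finsupp.single (swapWord ⟨p, hp⟩ w) 1) := by
        rw [opT_of_lt hp, swapWord_swapWord]
        rwa [ext_swapWord, sw_left, sw_right]
      have hlt : weight n (ext (swapWord ⟨p, hp⟩ w)) < weight n (ext w) := by
        rw [ext_swapWord]; exact weight_sw_lt hp hd
      have hα : cnt (ext (swapWord ⟨p, hp⟩ w)) n = α := by
        rw [ext_swapWord, cnt_sw_of_ge _ (by omega), hw]
      rw [e] at h0
      by_cases h1 : proj q (opT n q) r n (Finsupp.single (swapWord ⟨p, hp⟩ w) 1) = 0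
      · by_cases hs : Swappable r p
        · rw [S.proj_T le_rfl hr hp hs, h1, smul_zero, zero_add] at h0
          refine ih _ hlt _ _ rfl hα (hr.sw hs.2) ?_ fun h2 => h0 ?_
          · rw [cnt_sw_of_ge _ (by omega), hrα]
          · rw [h2]; simp
        · rw [S.proj_T_of_not le_rfl hr hp hs, h1, smul_zero] at h0
          exact absurd rfl h0
      · exact ih _ hlt _ _ rfl hα hr hrα h1
    · push Not at hdesc
      exact ⟨r, w, hr, hrα, hw, h0, hdesc⟩

theorem card_lt_eq_of_sorted {x : ℕ → ℕ} (hx : ∀ p, p + 1 < n → x p ≤ x (p + 1)) {k : ℕ}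
    (hk : k ≤ n) (b : ℕ) : Finset.card {m ∈ Finset.range k | x m < b} =
      min k (Finset.card {m ∈ Finset.range n | x m < b}) := by
  have hmono : ∀ p' < n, ∀ p ≤ p', x p ≤ x p' := by
    intro p' hp' p hpp
    induction p', hpp using Nat.le_induction with
    | base => exact le_rfl
    | succ p' _ ih => exact (ih (by omega)).trans (hx p' hp')
  by_cases h : ∀ m < k, x m < b
  · rw [Finset.filter_true_of_mem (by simpa using h), Finset.card_range, min_eq_left]
    calc k = (Finset.range k).card := (Finset.card_range k).symm
      _ ≤ _ := Finset.card_le_card fun m hm => by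
        rw [Finset.mem_range] at hm
        exact Finset.mem_filter.2 ⟨Finset.mem_range.2 (by omega), h m hm⟩
  · push Not at h
    obtain ⟨m, hm, hbm⟩ := h
    have : ({m ∈ Finset.range n | x m < b} : Finset ℕ) = {m ∈ Finset.range k | x m < b} := by
      ext l
      simp only [Finset.mem_filter, Finset.mem_range]
      refine ⟨fun hl => ⟨?_, hl.2⟩, fun hl => ⟨by omega, hl.2⟩⟩
      by_contra hlk
      have := hmono l hl.1 m (by omega)
      omega
    rw [this, min_eq_right]
    exact (Finset.card_filter_le _ _).trans_eq (Finset.card_range k)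

/-- Seminormal units do not vanish. -/
theorem unit_ne_zero (hq : q ≠ 0) (hN : QNonzero n q) {r : ℕ → ℕ} (hr : IsLattice n r) :
    unit n q r ≠ 0 := by
  have S := isSemisimpleFamily_opT hq hN
  obtain ⟨c, hc, hcnt, hblock, -⟩ := exists_column_lattice n r hr
  obtain ⟨v, hv0, hvs, hvT⟩ := exists_antisymm (n := n) hq fun p hp => hc.le hp
  have hb2 : ∀ p, p + 1 < n → c (p + 1) = c p + 1 ∨ c (p + 1) = 0 :=
    fun p hp => (hblock p hp).imp_left And.left
  -- a tableau of the same shape at which the antisymmetric vector has a component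
  obtain ⟨s, hs, hsv, hinc⟩ : ∃ s, IsLattice n s ∧ proj q (opT n q) s n v ≠ 0 ∧
      ∀ p, p + 1 < n → c (p + 1) = c p + 1 → s p < s (p + 1) := by
    obtain ⟨s, hs, hsv⟩ : ∃ s ∈ latticeWords n, proj q (opT n q) s n v ≠ 0 := by
      by_contra h
      push Not at h
      exact hv0 (by rw [← S.sum_proj le_rfl v, Finset.sum_eq_zero h])
    exact exists_increasing hq hN hvT _ s rfl (isLattice_of_mem hs) hsv
  -- The shape of `s` dominates that of `c` because of the content of `v`. Conversely, the letters
  -- of `s` increase down every column of `c`, so the shape of `c` dominates that of `s`.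
  have hscnt : cnt s n = cnt c n := by
    have h1 := dominance hq hN le_rfl hs hsv (S.proj_mem le_rfl hs v)
      (proj_mem_supported le_rfl s hvs)
    have h2 : ∀ b, ∑ i ∈ Finset.range b, cnt s n i ≤ ∑ i ∈ Finset.range b, cnt c n i := by
      intro b
      rw [sum_cnt, sum_cnt]
      refine card_lt_le_of_columns (fun p hp => hc.le hp) hb2 (fun p p' hpp hp h => ?_) b
      have hst := column_steps (fun p hp => hc.le hp) hb2 hp h
      refine ne_of_lt ?_
      have : ∀ l, p + 1 ≤ l → l ≤ p' → s p < s l := by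
        intro l hl
        induction l, hl using Nat.le_induction with
        | base => intro h'; exact hinc p (by omega) (hst p le_rfl (by omega))
        | succ l hl ih =>
          intro h'
          exact (ih (by omega)).trans (hinc l (by omega) (hst l (by omega) (by omega)))
      exact this p' hpp le_rfl
    funext i
    have e := fun b => le_antisymm (h2 b) (h1 b)
    have := e (i + 1)
    rw [Finset.sum_range_succ, Finset.sum_range_succ, e i] at this
    omega
  obtain ⟨w, hw, hwp⟩ : ∃ w, cnt (ext w) n = cnt c n ∧
      proj q (opT n q) s n (Finsupp.single w 1) ≠ 0 := by
    by_contra h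
    push Not at h
    refine hsv ?_
    have : v = v.sum fun w a => a • Finsupp.single w (1 : ℂ) := by
      conv_lhs => rw [← Finsupp.sum_single v]
      simp
    rw [this, Finsupp.sum, map_sum]
    refine Finset.sum_eq_zero fun w hw => ?_
    rw [map_smul, h w (hvs hw), smul_zero]
  obtain ⟨s', w', hs', hcs', hcw', hp, hsort⟩ := exists_sorted hq hN _ s w rfl hw hs hscnt hwp
  -- A weakly increasing word has the most dominant prefixes among all words of its content, so it
  -- dominates `s'`. The nonzero component gives the reverse comparison, and the two words coincide.
  have hws : ∀ m < n, ext w' m = s' m := by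
    have hlt : ∀ k ≤ n, ∀ b, ∑ i ∈ Finset.range b, cnt (ext w') k i =
        ∑ i ∈ Finset.range b, cnt s' k i := by
      intro k hk b
      refine le_antisymm (dominance_of_proj_ne_zero hq hN hs' hp hk b) ?_
      have h1 : ∑ i ∈ Finset.range b, cnt s' k i ≤ ∑ i ∈ Finset.range b, cnt s' n i :=
        Finset.sum_le_sum fun i _ => cnt_mono _ hk i
      rw [hcs', ← hcw', sum_cnt (ext w')] at h1
      rw [sum_cnt (ext w'), card_lt_eq_of_sorted hsort hk b]
      exact le_min (sum_cnt_le _ _ _) h1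
    have hcntk : ∀ k ≤ n, cnt (ext w') k = cnt s' k := by
      intro k hk
      funext i
      have := hlt k hk (i + 1)
      rw [Finset.sum_range_succ, Finset.sum_range_succ, hlt k hk i] at this
      omega
    intro m hm
    have h1 := congrFun (hcntk (m + 1) hm) (s' m)
    rw [cnt_succ, cnt_succ, hcntk m hm.le, if_pos rfl] at h1
    by_contra h
    rw [if_neg h] at h1
    omega
  have hunit : unit n q s' ≠ 0 := by
    rw [unit, show wd n s' = w' from ?_]
    · exact hp
    · funext k
      rw [wd, ← hws k k.2, ext_of_lt w' k.2]
  -- connect the tableaux of this shape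
  set r' : ℕ → ℕ := fun x => if x < n then r x else s' x with hr'
  have hag : ∀ x < n, r x = r' x := fun x hx => by simp [hr', hx]
  rw [unit_congr hag]
  refine lattice_connected (fun s t => unit n q s ≠ 0 → unit n q t ≠ 0) (fun _ h => h)
    (fun _ _ _ h1 h2 h => h2 (h1 h)) (j := 0) ?_ hs' (hr.congr hag) ?_ ?_ hunit
  · intro r k _ hk hr hsr hne h
    have hs : Swappable r k := ⟨hne, IsLattice.addable_of_sw hk hsr⟩
    rcases lt_or_gt_of_ne hne with hlt | hlt
    · exact (unit_sw_ne_zero_iff hq hN hr hk hs hlt).2 h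
    · have := unit_sw_ne_zero_iff hq hN hsr hk (hs.sw (by omega) hr)
        (by rw [sw_left, sw_right]; exact hlt)
      rw [sw_sw] at this
      exact this.1 h
  · intro x hx
    have : ¬ x < n := by omega
    simp [hr', this]
  · rw [hcs', hcnt, cnt_congr hag]

end Seminormal


/-! ### Semisimplicity and the vanishing of `q`-integers -/

section Semisimple

variable {n : ℕ} {q : ℂ}

/-- The right action makes the words a left module over the opposite algebra, over which every
submodule has a complement. -/
theorem exists_invariant_compl [IsSemisimpleRing (Hecke n q)] (Q : Submodule ℂ (Words n))
    (hQ : ∀ i, i + 1 < n → ∀ v ∈ Q, opT n q i v ∈ Q) : ∃ C : Submodule ℂ (Words n),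
    IsCompl Q C ∧ ∀ i, i + 1 < n → ∀ v ∈ C, opT n q i v ∈ C := by
  let f : (Hecke n q)ᵐᵒᵖ →+* Module.End ℂ (Words n) :=
    (RingEquiv.opOp (Module.End ℂ (Words n))).symm.toRingHom.comp
      (RingHom.op (wordRep n q).toRingHom)
  let _ : Module (Hecke n q)ᵐᵒᵖ (Words n) := Module.compHom _ f
  have hf : ∀ (x : Hecke n q) (v : Words n), MulOpposite.op x • v = rightMul x v := fun x v => rfl
  let Q' : Submodule (Hecke n q)ᵐᵒᵖ (Words n) :=
    { carrier := Q
      add_mem' := Q.add_mem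
      zero_mem' := Q.zero_mem
      smul_mem' := fun x v hv => by
        rw [← MulOpposite.op_unop x, hf]; exact rightMul_mem hQ _ v hv }
  obtain ⟨C', hC⟩ := exists_isCompl Q'
  let C : Submodule ℂ (Words n) :=
    { carrier := C'
      add_mem' := C'.add_mem
      zero_mem' := C'.zero_mem
      smul_mem' := fun c v hv => by
        have := C'.smul_mem (MulOpposite.op (c • (1 : Hecke n q))) hv
        rw [hf, rightMul_smul, rightMul_one] at this
        exact this }
  refine ⟨C, ⟨?_, ?_⟩, fun i hi v hv => C'.smul_mem (MulOpposite.op (heckeT n q i)) hv⟩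
  · rw [Submodule.disjoint_def]
    intro x hx hxC
    exact Submodule.disjoint_def.1 hC.disjoint x hx hxC
  · rw [codisjoint_iff, eq_top_iff]
    intro x _
    have : x ∈ Q' ⊔ C' := by rw [codisjoint_iff.1 hC.codisjoint]; trivial
    obtain ⟨a, ha, b, hb, rfl⟩ := Submodule.mem_sup.1 this
    exact Submodule.mem_sup.2 ⟨a, ha, b, hb, rfl⟩

/-- The letter `1` replaced by `0`. -/
def merge (r : ℕ → ℕ) : ℕ → ℕ := fun m => if r m = 1 then 0 else r m

theorem merge_sw (r : ℕ → ℕ) (i : ℕ) : merge (sw i r) = sw i (merge r) := rfl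

/-- The vectors whose coefficients at words with one letter `1` do not depend on the position of
that letter among the letters `0` and `1`. -/
def mergeInvariant (n : ℕ) : Submodule ℂ (Words n) where
  carrier := {v | ∀ w w', cnt (ext w) n 1 = 1 → cnt (ext w') n 1 = 1 →
    merge (ext w) = merge (ext w') → v w = v w'}
  add_mem' h1 h2 w w' a b c := by
    rw [Finsupp.add_apply, Finsupp.add_apply, h1 w w' a b c, h2 w w' a b c]
  zero_mem' _ _ _ _ _ := rfl
  smul_mem' c v h w w' a b e := by
    rw [Finsupp.smul_apply, Finsupp.smul_apply, h w w' a b e]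

/-- On this subspace the letter `1` may be treated as `0`: among letters `0` and `1`, the
coefficients before and after the exchange agree, and the two matrix entries add up to `q` in either
order. -/
theorem opT_apply_of_mem_mergeInvariant {i : ℕ} (hi : i + 1 < n) {v : Words n}
    (hv : v ∈ mergeInvariant n) {w : Fin n → ℕ} (hw : cnt (ext w) n 1 = 1) :
    opT n q i v w = cA q (merge (ext w) i) (merge (ext w) (i + 1)) * v w +
      cB q (merge (ext w) (i + 1)) (merge (ext w) i) * v (swapWord ⟨i, hi⟩ w) := by
  have h1 : ¬ (ext w i = 1 ∧ ext w (i + 1) = 1) := by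
    rintro ⟨h1, h2⟩
    have := cnt_mono (ext w) (show i + 2 ≤ n by omega) 1
    rw [cnt_succ, cnt_succ, if_pos h1, if_pos h2] at this
    omega
  have h2 : ext w i ≤ 1 → ext w (i + 1) ≤ 1 → v w = v (swapWord ⟨i, hi⟩ w) := by
    intro h3 h4
    refine hv w _ hw ?_ ?_
    · rw [ext_swapWord, cnt_sw_of_ge _ (by omega), hw]
    · rw [ext_swapWord]
      funext m
      rw [merge, merge]
      by_cases e1 : m = i
      · subst e1; rw [sw_left]; split_ifs <;> omega
      · by_cases e2 : m = i + 1
        · subst e2; rw [sw_right]; split_ifs <;> omega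
        · rw [sw_of_ne _ e1 e2]
  rw [opT_apply hi]
  simp only [merge]
  by_cases h3 : ext w i ≤ 1 ∧ ext w (i + 1) ≤ 1
  · rw [h2 h3.1 h3.2, ← add_mul, ← add_mul]
    congr 1
    simp only [cA, cB]
    split_ifs <;> first | omega | ring
  · have h4 : ∀ a b c d : ℕ, (a = b ↔ c = d) → (a < b ↔ c < d) → (b < a ↔ d < c) →
        cA q a b = cA q c d ∧ cB q b a = cB q d c := by
      intro a b c d e1 e2 e3
      have e1' : b = a ↔ d = c := by rw [eq_comm, e1, eq_comm]
      simp only [cA, cB, e1, e1', e2, e3, and_self]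
    obtain ⟨e1, e2⟩ := h4 (ext w i) (ext w (i + 1)) (if ext w i = 1 then 0 else ext w i)
      (if ext w (i + 1) = 1 then 0 else ext w (i + 1)) (by split_ifs <;> omega)
      (by split_ifs <;> omega) (by split_ifs <;> omega)
    rw [e1, e2]

theorem opT_mem_mergeInvariant {i : ℕ} (hi : i + 1 < n) {v : Words n}
    (hv : v ∈ mergeInvariant n) : opT n q i v ∈ mergeInvariant n := by
  intro w w' hw hw' h
  rw [opT_apply_of_mem_mergeInvariant hi hv hw, opT_apply_of_mem_mergeInvariant hi hv hw', h,
    hv w w' hw hw' h, hv (swapWord ⟨i, hi⟩ w) (swapWord ⟨i, hi⟩ w')]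
  · rw [ext_swapWord, cnt_sw_of_ge _ (by omega), hw]
  · rw [ext_swapWord, cnt_sw_of_ge _ (by omega), hw']
  · rw [ext_swapWord, ext_swapWord, merge_sw, merge_sw, h]

/-- The word with the letter `1` in position `p`, the letter `0` in the other positions below `k`
and the letter `2` elsewhere. -/
def markedWord (k p : ℕ) : ℕ → ℕ := fun m => if m = p then 1 else if m < k then 0 else 2

theorem cnt_markedWord {k p : ℕ} (hp : p < n) : cnt (ext (wd n (markedWord k p))) n 1 = 1 := by
  rw [cnt, Finset.card_eq_one]
  refine ⟨p, ?_⟩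
  ext m
  rw [Finset.mem_filter, Finset.mem_range, Finset.mem_singleton]
  constructor
  · rintro ⟨hm, h⟩
    rw [ext_wd _ hm, markedWord] at h
    split_ifs at h with h1
    · exact h1
    · omega
  · rintro rfl
    exact ⟨hp, by rw [ext_wd _ hp, markedWord, if_pos rfl]⟩

theorem sum_markedWord_apply {k : ℕ} (hk : k ≤ n) {w : Fin n → ℕ} (hw : cnt (ext w) n 1 = 1) :
    (∑ p ∈ Finset.range k, Finsupp.single (wd n (markedWord k p)) (1 : ℂ)) w =
      if (∀ m < n, merge (ext w) m = if m < k then 0 else 2) then 1 else 0 := by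
  rw [cnt, Finset.card_eq_one] at hw
  obtain ⟨p, hp⟩ := hw
  have hiff : ∀ m, m < n → (ext w m = 1 ↔ m = p) := by
    intro m hm
    have := Finset.ext_iff.1 hp m
    rw [Finset.mem_filter, Finset.mem_range, Finset.mem_singleton] at this
    rw [← this]
    tauto
  have hpn : p < n := by
    have := Finset.ext_iff.1 hp p
    rw [Finset.mem_filter, Finset.mem_range, Finset.mem_singleton] at this
    exact (this.2 rfl).1
  rw [Finsupp.finsetSum_apply]
  simp only [Finsupp.single_apply]
  have hinj : ∀ p' < k, wd n (markedWord k p') = w → p' = p := by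
    rintro p' hp' rfl
    rw [← hiff p' (by omega), ext_wd _ (by omega), markedWord, if_pos rfl]
  split_ifs with h
  · have hpk : p < k := by
      have := h p hpn
      rw [merge, if_pos ((hiff p hpn).2 rfl)] at this
      by_contra hc
      rw [if_neg hc] at this
      omega
    rw [Finset.sum_eq_single_of_mem p (Finset.mem_range.2 hpk), if_pos]
    · funext m
      have h1 := h m m.2
      have h2 := hiff m m.2
      rw [merge, ext_of_lt w m.2, Fin.eta] at h1
      rw [ext_of_lt w m.2, Fin.eta] at h2
      rw [wd, markedWord]
      split_ifs at h1 ⊢ <;> omega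
    · intro p' hp' hne
      exact if_neg fun e => hne (hinj p' (Finset.mem_range.1 hp') e)
  · refine Finset.sum_eq_zero fun p' hp' => if_neg ?_
    rintro rfl
    refine h fun m hm => ?_
    rw [merge, ext_wd _ hm, markedWord]
    have := Finset.mem_range.1 hp'
    split_ifs <;> omega

/-- The products `T_{k-2} T_{k-3} ⋯`, acting from the right. -/
def descOp (n : ℕ) (q : ℂ) (k : ℕ) : ℕ → Module.End ℂ (Words n)
  | 0 => 1
  | j + 1 => opT n q (k - 2 - j) * descOp n q k j

theorem descOp_mem {p : Submodule ℂ (Words n)} (hp : ∀ i, i + 1 < n → ∀ v ∈ p, opT n q i v ∈ p)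
    {k j : ℕ} (hk : k ≤ n) (hj : j < k) {v : Words n} (hv : v ∈ p) : descOp n q k j v ∈ p := by
  induction j with
  | zero => exact hv
  | succ j ih => exact hp _ (by omega) _ (ih (by omega))

theorem descOp_single {k j : ℕ} (hk : k ≤ n) (hj : j < k) :
    descOp n q k j (Finsupp.single (wd n (markedWord k (k - 1))) 1) =
      Finsupp.single (wd n (markedWord k (k - 1 - j))) 1 := by
  induction j with
  | zero => rfl
  | succ j ih =>
    have h1 : k - 2 - j + 1 < n := by omega
    rw [descOp, Module.End.mul_apply, ih (by omega), opT_of_lt h1]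
    · congr 1
      rw [← wd_ext (swapWord _ _), ext_swapWord]
      funext x
      have hx := x.2
      simp only [wd]
      by_cases e1 : (x : ℕ) = k - 2 - j
      · rw [e1, sw_left, ext_wd _ h1]
        simp only [markedWord]
        split_ifs <;> omega
      · by_cases e2 : (x : ℕ) = k - 2 - j + 1
        · rw [e2, sw_right, ext_wd _ (by omega)]
          simp only [markedWord]
          split_ifs <;> omega
        · rw [sw_of_ne _ e1 e2, ext_wd _ hx]
          simp only [markedWord]
          split_ifs <;> omega
    · rw [ext_wd _ h1, ext_wd _ (by omega)]
      simp only [markedWord]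
      split_ifs <;> omega

theorem descOp_apply_of_mem_mergeInvariant {k j : ℕ} (hk : k ≤ n) (hj : j < k) {v : Words n}
    (hv : v ∈ mergeInvariant n) : descOp n q k j v (wd n (markedWord k (k - 1))) =
      q ^ j * v (wd n (markedWord k (k - 1))) := by
  have hc : cnt (ext (wd n (markedWord k (k - 1)))) n 1 = 1 := cnt_markedWord (by omega)
  induction j with
  | zero => rw [pow_zero, one_mul]; rfl
  | succ j ih =>
    have h1 : k - 2 - j + 1 < n := by omega
    have hm : ∀ m < k, merge (ext (wd n (markedWord k (k - 1)))) m = 0 := by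
      intro m hm
      rw [merge, ext_wd _ (by omega)]
      simp only [markedWord]
      split_ifs <;> omega
    rw [descOp, Module.End.mul_apply, opT_apply_of_mem_mergeInvariant h1
      (descOp_mem (fun i hi v hv => opT_mem_mergeInvariant hi hv) hk (by omega) hv) hc,
      hm _ (by omega), hm _ (by omega), ih (by omega)]
    simp only [cA, cB, if_true]
    ring

/-- If the Hecke algebra is semisimple, then the `q`-integers up to `n` do not vanish. -/
theorem qNonzero_of_isSemisimpleRing [IsSemisimpleRing (Hecke n q)] : QNonzero n q := by
  intro k hk1 hk h0
  obtain ⟨C, hC, hCT⟩ := exists_invariant_compl (q := q) (mergeInvariant n)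
    fun i hi v hv => opT_mem_mergeInvariant hi hv
  set w := wd n (markedWord k (k - 1)) with hw
  have hwc : cnt (ext w) n 1 = 1 := cnt_markedWord (by omega)
  -- The products `T_{k-2} T_{k-3} ⋯` move the letter `1` to every position below `k`, and the sum
  -- `u` of the resulting words lies in the invariant subspace. Hence the contribution of `b`
  -- vanishes. On `a`, the `j`-th product multiplies the coefficient at `w` by `q^j`. Comparing
  -- coefficients gives `1 = [k]_q a(w)`.
  obtain ⟨a, ha, b, hb, hab⟩ := Submodule.mem_sup.1
    (show Finsupp.single w (1 : ℂ) ∈ mergeInvariant n ⊔ C by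
      rw [codisjoint_iff.1 hC.codisjoint]; trivial)
  set u : Words n := ∑ p ∈ Finset.range k, Finsupp.single (wd n (markedWord k p)) (1 : ℂ) with hu
  have huQ : u ∈ mergeInvariant n := by
    intro x x' hx hx' h
    rw [hu, sum_markedWord_apply hk hx, sum_markedWord_apply hk hx', h]
  have hsum : ∀ j < k, descOp n q k j (Finsupp.single w 1) = descOp n q k j a + descOp n q k j b :=
    fun j _ => by rw [← hab, map_add]
  have hu' : u = ∑ j ∈ Finset.range k, descOp n q k j a + ∑ j ∈ Finset.range k, descOp n q k j b := by
    rw [← Finset.sum_add_distrib, hu, ← Finset.sum_range_reflect]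
    refine Finset.sum_congr rfl fun j hj => ?_
    rw [← hsum j (Finset.mem_range.1 hj), hw, descOp_single hk (Finset.mem_range.1 hj)]
  have hQ := Submodule.sum_mem (mergeInvariant n) (t := Finset.range k)
    (f := fun j => descOp n q k j a) fun j hj => descOp_mem
      (fun i hi v hv => opT_mem_mergeInvariant hi hv) hk (Finset.mem_range.1 hj) ha
  have hCb := Submodule.sum_mem C (t := Finset.range k)
    (f := fun j => descOp n q k j b) fun j hj => descOp_mem hCT hk (Finset.mem_range.1 hj) hb
  have hb0 : ∑ j ∈ Finset.range k, descOp n q k j b = 0 := by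
    refine Submodule.disjoint_def.1 hC.disjoint _ ?_ hCb
    have := Submodule.sub_mem _ huQ hQ
    rwa [hu', add_sub_cancel_left] at this
  have h1 : u w = 1 := by
    rw [hu, sum_markedWord_apply hk hwc, if_pos]
    intro m hm
    rw [merge, hw, ext_wd _ hm]
    simp only [markedWord]
    split_ifs <;> omega
  rw [hu', hb0, add_zero, Finsupp.finsetSum_apply, Finset.sum_congr rfl fun j hj =>
    descOp_apply_of_mem_mergeInvariant (q := q) hk (Finset.mem_range.1 hj) ha, ← Finset.sum_mul,
    ← qInt_natCast, h0, zero_mul] at h1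
  exact zero_ne_one h1

end Semisimple


/-! ### Positive parameters -/

section Positive

variable {n : ℕ} {q : ℝ}

theorem qNonzero_of_pos (hq : 0 < q) (n : ℕ) : QNonzero n (q : ℂ) := by
  intro k hk _
  rw [qInt_natCast]
  have : (0 : ℝ) < ∑ i ∈ Finset.range k, q ^ i :=
    Finset.sum_pos (fun i _ => pow_pos hq i) ⟨0, Finset.mem_range.2 hk⟩
  have h2 : (∑ i ∈ Finset.range k, (q : ℂ) ^ i) = ((∑ i ∈ Finset.range k, q ^ i : ℝ) : ℂ) := by
    push_cast; rfl
  rw [h2]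
  exact Complex.ofReal_ne_zero.2 this.ne'

/-- The power of `q` given by the number of inversions. -/
def invWeight (q : ℝ) (w : Fin n → ℕ) : ℂ :=
  pairProd (fun _ => 0) (fun x y => if y < x then (q : ℂ) else 1) w

theorem invWeight_eq (hq : 0 < q) (w : Fin n → ℕ) : ∃ a : ℝ, 0 < a ∧ invWeight q w = a := by
  refine ⟨∏ x : Fin n × Fin n with x.1 < x.2 ∧ 0 = 0, if w x.2 < w x.1 then q else 1,
    Finset.prod_pos fun x _ => by split_ifs <;> linarith, ?_⟩
  rw [invWeight, pairProd]
  push_cast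
  refine Finset.prod_congr rfl fun x _ => ?_
  split_ifs <;> simp

/-- The weighted Hermitian form on words. -/
def form (q : ℝ) (u v : Words n) : ℂ := u.sum fun w a => star a * (invWeight q w * v w)

theorem form_add_left (u u' v : Words n) : form q (u + u') v = form q u v + form q u' v :=
  Finsupp.sum_add_index' (by simp) (by intros; rw [star_add, add_mul])

theorem form_smul_left (c : ℂ) (u v : Words n) : form q (c • u) v = star c * form q u v := by
  rw [form, Finsupp.sum_smul_index (by simp), form, Finsupp.mul_sum]
  refine Finsupp.sum_congr fun w _ => ?_
  rw [star_mul']; ring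

theorem form_single (w : Fin n → ℕ) (v : Words n) :
    form q (Finsupp.single w 1) v = invWeight q w * v w := by
  rw [form, Finsupp.sum_single_index] <;> simp

theorem form_add_right (u v v' : Words n) : form q u (v + v') = form q u v + form q u v' := by
  rw [form, form, form, ← Finsupp.sum_add]
  refine Finsupp.sum_congr fun w _ => ?_
  rw [Finsupp.add_apply]; ring

theorem form_zero_left (v : Words n) : form q 0 v = 0 := Finsupp.sum_zero_index

theorem form_zero_right (v : Words n) : form q v 0 = 0 := by simp [form]

theorem form_self (hq : 0 < q) {u : Words n} (h : form q u u = 0) : u = 0 := by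
  have h1 : (form q u u).re = ∑ w ∈ u.support, (invWeight q w).re * Complex.normSq (u w) := by
    rw [form, Finsupp.sum, Complex.re_sum]
    refine Finset.sum_congr rfl fun w _ => ?_
    obtain ⟨a, -, ha⟩ := invWeight_eq hq w
    rw [ha, show star (u w) * ((a : ℂ) * u w) = (a : ℂ) * (star (u w) * u w) by ring,
      Complex.star_def, ← Complex.normSq_eq_conj_mul_self, ← Complex.ofReal_mul]
    simp
  rw [h, Complex.zero_re] at h1
  refine Finsupp.ext fun w => ?_
  by_contra hw
  have hw' : w ∈ u.support := Finsupp.mem_support_iff.2 hw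
  have hpos : ∀ w : Fin n → ℕ, 0 < (invWeight q w).re := fun w => by
    obtain ⟨a, ha, e⟩ := invWeight_eq hq w
    rw [e]; exact ha
  have := (Finset.sum_eq_zero_iff_of_nonneg fun w _ =>
    mul_nonneg (hpos w).le (Complex.normSq_nonneg _)).1 h1.symm w hw'
  exact (mul_pos (hpos w) (Complex.normSq_pos.2 hw)).ne' this

/-- The weights of a word and of the word with an ascent exchanged differ by the factor `q`, which
balances the coefficients `1` and `q` of the two exchanges. -/
theorem form_opT {i : ℕ} (hi : i + 1 < n) (u v : Words n) :
    form q (opT n q i u) v = form q u (opT n q i v) := by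
  induction u using Finsupp.induction_linear with
  | zero => rw [map_zero, form_zero_left, form_zero_left]
  | add f g hf hg => rw [map_add, form_add_left, hf, hg, form_add_left]
  | single w c =>
    have e : Finsupp.single w c = c • Finsupp.single w (1 : ℂ) := by simp
    rw [e, map_smul, form_smul_left, form_smul_left, opT_single hi, form_add_left, form_smul_left,
      form_smul_left, form_single, form_single, form_single, opT_apply hi]
    congr 1
    obtain ⟨F, h1, h2⟩ := pairProd_swapWord (fun _ => 0)
      (fun x y => if y < x then (q : ℂ) else 1) hi rfl w
    rw [invWeight, invWeight, h1, h2]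
    have hsA : ∀ a b, star (cA (q : ℂ) a b) = cA (q : ℂ) a b := by
      intro a b; rw [cA]; split_ifs <;> simp
    have hsB : ∀ a b, star (cB (q : ℂ) a b) = cB (q : ℂ) a b := by
      intro a b; rw [cB]; split_ifs <;> simp
    rw [hsA, hsB, cA, cB, cB]
    split_ifs <;> first | omega | ring

/-- Adjointness of two elements of the Hecke algebra. -/
def IsAdjoint (q : ℝ) (x y : Hecke n q) : Prop :=
  ∀ u v : Words n, form q (rightMul x u) v = form q u (rightMul y v)

theorem isAdjoint_descProd {i m : ℕ} (him : i ≤ m) (hm : m < n) :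
    IsAdjoint q (descProd n q i m) (ascProd n q i m) := by
  induction m, him using Nat.le_induction with
  | base => intro u v; rw [descProd_self, ascProd_self, rightMul_one]; rfl
  | succ m him ih =>
    intro u v
    rw [descProd_succ _ _ him, ascProd_succ _ _ him, rightMul_mul, rightMul_mul, ih (by omega)]
    exact form_opT hm _ _

theorem isAdjoint_sum {s : Finset ℕ} {x y : ℕ → Hecke n q} (h : ∀ i ∈ s, IsAdjoint q (x i) (y i)) :
    IsAdjoint q (∑ i ∈ s, x i) (∑ i ∈ s, y i) := by
  classical
  induction s using Finset.induction_on with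
  | empty => intro u v; simp [rightMul, form_zero_left, form_zero_right]
  | insert a s ha ih =>
    intro u v
    rw [Finset.sum_insert ha, Finset.sum_insert ha, rightMul_add, rightMul_add,
      LinearMap.add_apply, LinearMap.add_apply, form_add_left, form_add_right,
      h a (Finset.mem_insert_self _ _), ih fun i hi => h i (Finset.mem_insert_of_mem hi)]

theorem isAdjoint_bottomToRandom :
    IsAdjoint q (bottomToRandom n q n) (randomToBottom n q n) := by
  refine isAdjoint_sum fun i hi => isAdjoint_descProd ?_ ?_ <;>
  · have := Finset.mem_range.1 hi; omega

theorem form_star (hq : 0 < q) (u v : Words n) : star (form q u v) = form q v u := by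
  induction u using Finsupp.induction_linear with
  | zero => rw [form_zero_left, form_zero_right, star_zero]
  | add f g hf hg => rw [form_add_left, star_add, hf, hg, form_add_right]
  | single w c =>
    have e : Finsupp.single w c = c • Finsupp.single w (1 : ℂ) := by simp
    have hr : ∀ c : ℂ, form q v (c • Finsupp.single w 1) = c * form q v (Finsupp.single w 1) := by
      intro c
      rw [form, form, Finsupp.mul_sum]
      refine Finsupp.sum_congr fun w _ => ?_
      rw [Finsupp.smul_apply, smul_eq_mul]; ring
    rw [e, form_smul_left, hr, star_mul', star_star, form_single]
    congr 1
    clear hr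
    induction v using Finsupp.induction_linear with
    | zero => rw [form_zero_left]; simp
    | add f g hf hg => rw [form_add_left, ← hf, ← hg, Finsupp.add_apply, mul_add, star_add]
    | single w' c' =>
      obtain ⟨a, -, ha⟩ := invWeight_eq hq w
      have e : Finsupp.single w' c' = c' • Finsupp.single w' (1 : ℂ) := by simp
      rw [e, form_smul_left, form_single, Finsupp.smul_apply, smul_eq_mul]
      by_cases h : w' = w
      · subst h; simp [ha, mul_comm]
      · simp [h, Ne.symm h]

theorem isAdjoint_randomToRandom (hq : 0 < q) :
    IsAdjoint q (randomToRandom n q) (randomToRandom n q) := by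
  intro u v
  have h : ∀ u v : Words n, form q (rightMul (randomToBottom n q n) u) v =
      form q u (rightMul (bottomToRandom n q n) v) := by
    intro u v
    rw [← form_star hq, ← isAdjoint_bottomToRandom, form_star hq]
  rw [randomToRandom, rightMul_mul, rightMul_mul, isAdjoint_bottomToRandom, h]

theorem exists_ker_add {V : Type*} [AddCommGroup V] [Module ℂ V] [FiniteDimensional ℂ V]
    (f : V →ₗ[ℂ] V) (hf : ∀ v, f (f v) = 0 → f v = 0) (v : V) : ∃ a b, f a = 0 ∧ v = a + f b := by
  have hd : Disjoint (LinearMap.ker f) (LinearMap.range f) := by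
    rw [Submodule.disjoint_def]
    rintro _ h ⟨y, rfl⟩
    exact hf y h
  have htop := Submodule.eq_top_of_disjoint _ _
    (by rw [add_comm, LinearMap.finrank_range_add_finrank_ker]) hd
  obtain ⟨a, ha, _, ⟨b, rfl⟩, h⟩ := Submodule.mem_sup.1
    (show v ∈ LinearMap.ker f ⊔ LinearMap.range f by rw [htop]; trivial)
  exact ⟨a, b, ha, h.symm⟩

/-- Finite dimensional invariant subspaces are the sum of the kernel of random-to-random and of the
image of bottom-to-random. -/
theorem exists_ker_add_bottomToRandom (hq : 0 < q) {S : Submodule ℂ (Words n)}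
    [FiniteDimensional ℂ S] (hS : ∀ i, i + 1 < n → ∀ v ∈ S, opT n q i v ∈ S) {v : Words n}
    (hv : v ∈ S) : ∃ a ∈ S, ∃ b ∈ S, rightMul (randomToRandom n (q : ℂ)) a = 0 ∧
      v = a + rightMul (bottomToRandom n (q : ℂ) n) b := by
  have hinv := rightMul_mem hS (randomToRandom n (q : ℂ))
  -- Self-adjointness gives `⟨vR, vR⟩ = ⟨v, vRR⟩`, and the form is definite, so `R` and `R²` have
  -- the same kernel. In finite dimension the subspace is then the sum of the kernel and the image
  -- of `R`.
  have hker : ∀ v : S, (rightMul (randomToRandom n (q : ℂ))).restrict hinv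
      ((rightMul (randomToRandom n (q : ℂ))).restrict hinv v) = 0 →
      (rightMul (randomToRandom n (q : ℂ))).restrict hinv v = 0 := by
    intro v hv
    refine Subtype.ext (form_self hq ?_)
    have h2 := congrArg Subtype.val hv
    rw [LinearMap.coe_restrict_apply, isAdjoint_randomToRandom hq]
    simp only [LinearMap.coe_restrict_apply, ZeroMemClass.coe_zero] at h2
    rw [h2, form_zero_right]
  obtain ⟨a, b, ha, hab⟩ := exists_ker_add (V := S) _ hker ⟨v, hv⟩
  -- The image part `b R` equals `(b B*) B`, which supplies the witness.
  refine ⟨a, a.2, rightMul (randomToBottom n (q : ℂ) n) b, rightMul_mem hS _ _ b.2,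
    congrArg Subtype.val ha, ?_⟩
  have := congrArg Subtype.val hab
  rw [← rightMul_mul]
  exact this

end Positive


/-! ### Tableaux and lattice words -/

section Tableaux

variable {mu la : YoungDiagram} {q : ℂ}

/-- The rows of the entries of a tableau. -/
def rowWord (t : SkewSYT mu la) : ℕ → ℕ := fun m => (t.cell (m + 1)).1

theorem YoungDiagram_card_bot : (⊥ : YoungDiagram).card = 0 := by simp [YoungDiagram.card]

theorem SYT.mem_Ioc {m : ℕ} (hm : m < la.card) :
    m + 1 ∈ Set.Ioc (⊥ : YoungDiagram).card la.card := by
  rw [YoungDiagram_card_bot]; exact ⟨by omega, hm⟩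

theorem SYT.cell_mem (t : SYT la) {m : ℕ} (hm : m < la.card) : t.cell (m + 1) ∈ la.cells := by
  have := SkewSYT.cell_mem t (SYT.mem_Ioc hm)
  simpa using this

theorem SYT.entry_cell (t : SYT la) {m : ℕ} (hm : m < la.card) :
    t.entry (t.cell (m + 1)) = m + 1 := SkewSYT.entry_cell t (SYT.mem_Ioc hm)

theorem SkewSYT.cell_eq (t : SkewSYT mu la) {c : ℕ × ℕ} (hc : c ∈ la.cells \ mu.cells) :
    t.cell (t.entry c) = c :=
  t.bij.injOn (Function.invFunOn_mem ⟨c, hc, rfl⟩) hc (Function.invFunOn_eq ⟨c, hc, rfl⟩)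

theorem SYT.cells_shape (t : SYT la) {k : ℕ} (hk : k ≤ la.card) :
    (t.shape k).cells = (Finset.range k).image fun m => t.cell (m + 1) := by
  ext c
  simp only [SkewSYT.shape, YoungDiagram.cells_bot, Finset.empty_union, Finset.sdiff_empty,
    Finset.mem_filter, Finset.mem_image, Finset.mem_range]
  constructor
  · rintro ⟨hc, he⟩
    have hc' : c ∈ la.cells \ (⊥ : YoungDiagram).cells := by simpa using hc
    have h1 : t.entry c ∈ Set.Ioc _ _ := t.bij.mapsTo hc'
    have h2 := h1.1
    refine ⟨t.entry c - 1, by omega, ?_⟩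
    rw [Nat.sub_add_cancel (by omega), SkewSYT.cell_eq t hc']
  · rintro ⟨m, hm, rfl⟩
    exact ⟨SYT.cell_mem t (by omega), by rw [SYT.entry_cell t (by omega)]; omega⟩

theorem SYT.cell_injOn (t : SYT la) {m m' : ℕ} (hm : m < la.card) (hm' : m' < la.card)
    (h : t.cell (m + 1) = t.cell (m' + 1)) : m = m' := by
  have := SYT.entry_cell t hm
  rw [h, SYT.entry_cell t hm'] at this
  omega

theorem SYT.card_shape (t : SYT la) {k : ℕ} (hk : k ≤ la.card) : (t.shape k).card = k := by
  rw [YoungDiagram.card, SYT.cells_shape t hk, Finset.card_image_of_injOn, Finset.card_range]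
  intro m hm m' hm' h
  simp only [Finset.coe_range, Set.mem_Iio] at hm hm'
  exact SYT.cell_injOn t (by omega) (by omega) h

theorem SYT.cnt_rowWord (t : SYT la) {k : ℕ} (hk : k ≤ la.card) :
    cnt (rowWord t) k = (t.shape k).rowLen := by
  funext i
  rw [YoungDiagram.rowLen_eq_card, YoungDiagram.row, SYT.cells_shape t hk, Finset.filter_image,
    Finset.card_image_of_injOn]
  · rfl
  · intro m hm m' hm' h
    simp only [Finset.coe_filter, Finset.mem_range, Set.mem_ofPred_eq] at hm hm'
    exact SYT.cell_injOn t (by omega) (by omega) h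

theorem SYT.shape_card (t : SYT la) : t.shape la.card = la := by
  ext c
  simp only [SkewSYT.shape, YoungDiagram.cells_bot, Finset.empty_union, Finset.sdiff_empty,
    Finset.mem_filter, and_iff_left_iff_imp]
  intro hc
  exact (t.bij.mapsTo (by simpa using hc)).2

theorem SYT.isLattice (t : SYT la) : IsLattice la.card (rowWord t) := by
  intro k hk i
  rw [SYT.cnt_rowWord t hk]
  exact YoungDiagram.rowLen_anti _ i (i + 1) (Nat.le_succ i)

theorem SYT.cnt_card (t : SYT la) : cnt (rowWord t) la.card = la.rowLen := by
  rw [SYT.cnt_rowWord t le_rfl, SYT.shape_card]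

theorem SYT.content_eq (t : SYT la) {m : ℕ} (hm : m < la.card) :
    content t (m + 1) = cont (rowWord t) m := by
  rw [content, cont, SYT.cnt_rowWord t hm.le]
  congr 2
  obtain ⟨i, j, hc⟩ : ∃ i j, t.cell (m + 1) = (i, j) := ⟨_, _, rfl⟩
  have hmem := SYT.cell_mem t hm
  have he := SYT.entry_cell t hm
  rw [rowWord, hc]
  rw [hc] at hmem he
  simp only
  have key : ∀ x, x < (t.shape m).rowLen i ↔ x < j := by
    intro x
    rw [← YoungDiagram.mem_iff_lt_rowLen, ← YoungDiagram.mem_cells]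
    simp only [SkewSYT.shape, YoungDiagram.cells_bot, Finset.empty_union, Finset.sdiff_empty,
      Finset.mem_filter]
    have hsd : ∀ c, c ∈ la.cells → c ∈ la.cells \ (⊥ : YoungDiagram).cells := by simp
    constructor
    · rintro ⟨h1, h2⟩
      by_contra h
      rcases (not_lt.1 h).eq_or_lt with rfl | h
      · omega
      · have := t.row_lt i j x h (hsd _ hmem) (hsd _ h1)
        omega
    · intro h
      have h1 : (i, x) ∈ la.cells := by
        rw [YoungDiagram.mem_cells] at hmem ⊢
        exact la.up_left_mem le_rfl h.le hmem
      have := t.row_lt i x j h (hsd _ h1) (hsd _ hmem)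
      exact ⟨h1, by omega⟩
  have h1 := (key j).not
  have h2 := (key ((t.shape m).rowLen i))
  omega

theorem rightMul_youngIdempotent (t : SYT la) :
    rightMul (youngIdempotent q t) = proj q (opT la.card q) (rowWord t) la.card := by
  have key : ∀ k ≤ la.card, rightMul (((List.Ico 1 (k + 1)).map fun m =>
      Polynomial.aeval (jucysMurphy la.card q m)
        (∏ x ∈ ((contents m).image (qInt q)).erase (qInt q (content t m)),
          Polynomial.C (qInt q (content t m) - x)⁻¹ * (Polynomial.X - Polynomial.C x))).prod) =
      proj q (opT la.card q) (rowWord t) k := by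
    intro k hk
    induction k with
    | zero => simp [rightMul_one, proj]
    | succ k ih =>
      rw [List.Ico.succ_top (by omega), List.map_append, List.prod_append, rightMul_mul',
        ih (by omega), List.map_singleton, List.prod_singleton, rightMul_aeval,
        jucysMurphy_eq _ _ hk, rightMul_murphy, SYT.content_eq t hk]
      rfl
  exact key _ le_rfl

theorem seminormalUnit_eq (t : SYT la) : seminormalUnit q t = unit la.card q (rowWord t) := by
  rw [seminormalUnit, rightMul_youngIdempotent]; rfl

/-- Every lattice word with content given by the rows of a diagram is that of a tableau. -/
theorem exists_tableau {r : ℕ → ℕ} (hr : IsLattice la.card r) (hc : cnt r la.card = la.rowLen) :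
    ∃ t : SYT la, ∀ m < la.card, rowWord t m = r m := by
  -- The `m`-th letter occupies the first free column of its row.
  set e : ℕ → ℕ × ℕ := fun m => (r m, cnt r m (r m)) with he
  have hmono : ∀ m m', m < m' → r m = r m' → cnt r m (r m) < cnt r m' (r m') := by
    intro m m' h h'
    have := cnt_mono r (show m + 1 ≤ m' by omega) (r m)
    rw [cnt_succ, if_pos rfl] at this
    rw [← h']; omega
  have hinj : Set.InjOn e (Finset.range la.card) := by
    intro m _ m' _ h
    obtain ⟨h1, h2⟩ := Prod.mk.inj h
    rcases lt_trichotomy m m' with h3 | h3 | h3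
    · have := hmono m m' h3 h1; omega
    · exact h3
    · have := hmono m' m h3 h1.symm; omega
  have hmaps : Set.MapsTo e (Finset.range la.card) la.cells := by
    intro m hm
    simp only [Finset.coe_range, Set.mem_Iio] at hm
    rw [Finset.mem_coe, YoungDiagram.mem_cells, he]
    simp only
    rw [YoungDiagram.mem_iff_lt_rowLen, ← hc]
    have := cnt_mono r (show m + 1 ≤ la.card by omega) (r m)
    rw [cnt_succ, if_pos rfl] at this
    omega
  have hsurj := Finset.surjOn_of_injOn_of_card_le _ hmaps hinj (by simp [YoungDiagram.card])
  have hsurj' : ∀ c : ℕ × ℕ, c ∈ (la.cells : Set (ℕ × ℕ)) →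
      ∃ m, m ∈ (Finset.range la.card : Set ℕ) ∧ e m = c := fun c hc => hsurj hc
  choose! f hf hef using hsurj'
  have hfe : ∀ m < la.card, f (e m) = m := fun m hm => by
    have hm' : m ∈ (Finset.range la.card : Set ℕ) := by simpa using hm
    exact hinj (hf _ (hmaps hm')) hm' (hef _ (hmaps hm'))
  have hf' : ∀ c ∈ la.cells, f c < la.card ∧ r (f c) = c.1 ∧ cnt r (f c) (r (f c)) = c.2 := by
    intro c hc
    refine ⟨by simpa using hf _ (Finset.mem_coe.2 hc), ?_, ?_⟩
    · exact congrArg Prod.fst (hef _ (Finset.mem_coe.2 hc))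
    · exact congrArg Prod.snd (hef _ (Finset.mem_coe.2 hc))
  let t : SYT la :=
    { entry := fun c => if c ∈ la.cells then f c + 1 else 0
      bij := by
        rw [YoungDiagram_card_bot]
        simp only [YoungDiagram.cells_bot, Finset.sdiff_empty]
        refine ⟨fun c hc => ?_, fun c hc d hd h => ?_, fun k hk => ?_⟩
        · simp only [if_pos (Finset.mem_coe.1 hc)]
          have := (hf' c hc).1
          exact ⟨by omega, this⟩
        · simp only [if_pos (Finset.mem_coe.1 hc), if_pos (Finset.mem_coe.1 hd)] at h
          rw [← hef _ hc, ← hef _ hd, Nat.succ_injective h]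
        · have hk' : k - 1 < la.card := by have := hk.1; have := hk.2; omega
          have hm : e (k - 1) ∈ (la.cells : Set (ℕ × ℕ)) := hmaps (by simpa using hk')
          refine ⟨e (k - 1), hm, ?_⟩
          simp only [if_pos (Finset.mem_coe.1 hm), hfe _ hk']
          have := hk.1; omega
      row_lt := by
        intro i j₁ j₂ hj h1 h2
        rw [YoungDiagram.cells_bot, Finset.sdiff_empty] at h1 h2
        rw [if_pos h1, if_pos h2]
        obtain ⟨-, a1, b1⟩ := hf' _ h1
        obtain ⟨-, a2, b2⟩ := hf' _ h2
        simp only at a1 b1 a2 b2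
        rw [a1] at b1
        rw [a2] at b2
        by_contra h
        have := cnt_mono r (show f (i, j₂) ≤ f (i, j₁) by omega) i
        omega
      col_lt := by
        intro i₁ i₂ j hi h1 h2
        rw [YoungDiagram.cells_bot, Finset.sdiff_empty] at h1 h2
        rw [if_pos h1, if_pos h2]
        obtain ⟨l1, a1, b1⟩ := hf' _ h1
        obtain ⟨l2, a2, b2⟩ := hf' _ h2
        simp only at a1 b1 a2 b2
        rw [a1] at b1
        rw [a2] at b2
        by_contra h
        have hne : f (i₁, j) ≠ f (i₂, j) := fun h => by rw [h, a2] at a1; omega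
        have h3 := cnt_mono r (show f (i₂, j) + 1 ≤ f (i₁, j) by omega) i₁
        have h4 := hr.antitone (show f (i₂, j) + 1 ≤ la.card by omega) hi.le
        rw [cnt_succ r _ i₂, if_pos a2] at h4
        omega
      zero := fun c hc => if_neg fun h => hc (by simpa using h) }
  refine ⟨t, fun m hm => ?_⟩
  have h1 : e m ∈ la.cells := hmaps (by simpa using hm)
  have h2 : t.entry (e m) = m + 1 := by
    show (if e m ∈ la.cells then f (e m) + 1 else 0) = m + 1
    rw [if_pos h1, hfe m hm]
  rw [rowWord, ← h2, SkewSYT.cell_eq t (by simpa using h1)]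

/-- The diagram with rows counted by a lattice word. -/
theorem exists_diagram {j : ℕ} {r : ℕ → ℕ} (hr : IsLattice j r) :
    ∃ mu : YoungDiagram, mu.rowLen = cnt r j ∧ mu.card = j := by
  have hmem : ∀ c : ℕ × ℕ, c ∈ ((Finset.range j) ×ˢ (Finset.range j)).filter
      (fun c => c.2 < cnt r j c.1) ↔ c.2 < cnt r j c.1 := by
    rintro ⟨i, x⟩
    rw [Finset.mem_filter, Finset.mem_product, Finset.mem_range, Finset.mem_range]
    refine ⟨fun h => h.2, fun h => ⟨⟨?_, ?_⟩, h⟩⟩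
    · have h0 : 0 < cnt r j i := by simp only at h; omega
      rw [cnt, Finset.card_pos] at h0
      obtain ⟨m, hm⟩ := h0
      rw [Finset.mem_filter, Finset.mem_range] at hm
      have := hr.le hm.1
      simp only
      omega
    · exact h.trans_le (cnt_le r j i)
  let mu : YoungDiagram :=
    { cells := ((Finset.range j) ×ˢ (Finset.range j)).filter fun c => c.2 < cnt r j c.1
      isLowerSet := by
        rintro ⟨i, x⟩ ⟨i', x'⟩ h hc
        rw [Finset.mem_coe, hmem] at hc ⊢
        obtain ⟨h1, h2⟩ := Prod.mk_le_mk.1 h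
        have := hr.antitone le_rfl h1
        simp only at hc ⊢
        omega }
  have hrow : mu.rowLen = cnt r j := by
    funext i
    have key : ∀ x, x < mu.rowLen i ↔ x < cnt r j i := fun x => by
      rw [← YoungDiagram.mem_iff_lt_rowLen, ← YoungDiagram.mem_cells]
      exact hmem (i, x)
    have h1 := key (mu.rowLen i)
    have h2 := key (cnt r j i)
    omega
  refine ⟨mu, hrow, ?_⟩
  have h1 := SkewSYT.sum_rowLen mu j
  rw [hrow, sum_cnt, Finset.filter_true_of_mem, Finset.filter_true_of_mem, Finset.card_range] at h1
  · exact h1.symm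
  · intro c hc
    have := (Finset.mem_filter.1 hc).1
    rw [Finset.mem_product, Finset.mem_range] at this
    exact this.1
  · intro m hm
    have := Finset.mem_range.1 hm
    exact (hr.le this).trans_lt this

theorem rowWord_glue (h : mu ≤ la) (t : SkewSYT mu la) (s : SYT mu) {m : ℕ} (hm : m < la.card) :
    rowWord (SkewSYT.glue h t s) m = if m < mu.card then rowWord s m else rowWord t m := by
  have hsub := YoungDiagram.cells_subset_iff.2 h
  have key : ∀ c, c ∈ la.cells → SkewSYT.glueEntry t s c = m + 1 →
      (SkewSYT.glue h t s).cell (m + 1) = c := by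
    intro c hc he
    rw [← he]
    exact SkewSYT.cell_eq (SkewSYT.glue h t s) (by simpa using hc)
  split_ifs with hmu
  · have h1 := SYT.cell_mem s hmu
    rw [rowWord, key _ (hsub h1), rowWord]
    rw [SkewSYT.glueEntry, if_pos h1, SYT.entry_cell s hmu]
  · have hm' : m + 1 ∈ Set.Ioc mu.card la.card := ⟨by omega, hm⟩
    have h1 := Finset.mem_sdiff.1 (t.cell_mem hm')
    rw [rowWord, key _ h1.1, rowWord]
    rw [SkewSYT.glueEntry, if_neg h1.2, t.entry_cell hm']

theorem shape_glue (h : mu ≤ la) (t : SkewSYT mu la) (s : SYT mu) {k : ℕ} (hk : mu.card ≤ k) :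
    (SkewSYT.glue h t s).shape k = t.shape k := by
  have hsub := YoungDiagram.cells_subset_iff.2 h
  ext c
  simp only [SkewSYT.shape, YoungDiagram.cells_bot, Finset.empty_union, Finset.sdiff_empty,
    Finset.mem_filter, Finset.mem_union, Finset.mem_sdiff]
  show c ∈ la.cells ∧ SkewSYT.glueEntry t s c ≤ k ↔ _
  by_cases hc : c ∈ mu.cells
  · have h1 : s.entry c ≤ mu.card := (s.bij.mapsTo (by simpa using hc)).2
    simp only [SkewSYT.glueEntry, hc, if_true, true_or, iff_true]
    exact ⟨hsub hc, h1.trans hk⟩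
  · simp only [SkewSYT.glueEntry, hc, if_false, false_or, not_false_eq_true, and_true]

end Tableaux


/-! ### Specht modules and concatenation -/

section Specht

variable {n : ℕ} {q : ℂ}

theorem mem_specht {la : YoungDiagram} {r : ℕ → ℕ} (hr : IsLattice la.card r)
    (hc : cnt r la.card = la.rowLen) : unit la.card q r ∈ specht q la := by
  obtain ⟨t, ht⟩ := exists_tableau hr hc
  refine Submodule.subset_span ⟨t, ?_⟩
  exact (seminormalUnit_eq t).trans (unit_congr ht)

theorem finiteDimensional_specht (q : ℂ) (la : YoungDiagram) :
    FiniteDimensional ℂ (specht q la) := by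
  have : specht q la ≤ Submodule.span ℂ
      ((latticeWords la.card).image fun r => unit la.card q r : Finset (Words la.card)) := by
    classical
    refine Submodule.span_le.2 ?_
    rintro _ ⟨t, rfl⟩
    obtain ⟨s, hs, hts⟩ := exists_mem_latticeWords (SYT.isLattice t)
    refine Submodule.subset_span ?_
    rw [Finset.mem_coe, Finset.mem_image]
    exact ⟨s, hs, ((seminormalUnit_eq t).trans (unit_congr hts)).symm⟩
  exact Submodule.finiteDimensional_of_le this

theorem opT_mem_specht (hq : q ≠ 0) {la : YoungDiagram} (hN : QNonzero la.card q) {k : ℕ}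
    (hk : k + 1 < la.card) {v : Words la.card} (hv : v ∈ specht q la) :
    opT la.card q k v ∈ specht q la := by
  have S := isSemisimpleFamily_opT hq hN
  induction hv using Submodule.span_induction with
  | zero => rw [map_zero]; exact Submodule.zero_mem _
  | add x y _ _ hx hy => rw [map_add]; exact Submodule.add_mem _ hx hy
  | smul c x _ hx => rw [map_smul]; exact Submodule.smul_mem _ c hx
  | mem x hx =>
    obtain ⟨t, rfl⟩ := hx
    simp only [seminormalUnit_eq]
    have hr := SYT.isLattice t
    have hc := SYT.cnt_card t
    generalize rowWord t = r at hr hc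
    by_cases hs : Swappable r k
    · have hcs : cnt (sw k r) la.card = la.rowLen := by rw [cnt_sw_of_ge _ (by omega), hc]
      have hsr := hr.sw hs.2
      have m1 := mem_specht (q := q) hr hc
      have m2 := mem_specht (q := q) hsr hcs
      rcases lt_or_gt_of_ne hs.1 with h | h
      · rw [sub_eq_iff_eq_add.1 (unit_sw hq hN hr hk hs h).symm]
        exact Submodule.add_mem _ m2 (Submodule.smul_mem _ _ m1)
      -- When the exchange goes up in dominance, the unit of `r` is expressed through that of `sw k
      -- r`. The resulting square of the generator is removed by the quadratic relation.
      · have e := unit_sw hq hN hsr hk (hs.sw (by omega) hr)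
          (by rw [sw_left, sw_right]; exact h)
        rw [sw_sw] at e
        have e2 := sub_eq_iff_eq_add.1 e.symm
        have hquad := LinearMap.congr_fun ((isHeckeFamily_opT la.card q).quad k hk)
          (unit la.card q (sw k r))
        rw [Module.End.mul_apply, LinearMap.add_apply, LinearMap.smul_apply,
          LinearMap.smul_apply, Module.End.one_apply] at hquad
        have m3 : opT la.card q k (unit la.card q (sw k r)) ∈ specht q la := by
          rw [e2]; exact Submodule.add_mem _ m1 (Submodule.smul_mem _ _ m2)
        rw [e, map_sub, map_smul, hquad]
        exact Submodule.sub_mem _ (Submodule.add_mem _ (Submodule.smul_mem _ _ m3)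
          (Submodule.smul_mem _ _ m2)) (Submodule.smul_mem _ _ m3)
    · rw [S.T_eq le_rfl hr hk hs (unit_mem hq hN hr)]
      exact Submodule.smul_mem _ _ (mem_specht hr hc)

/-- The operator which appends the letters `ρ k, …, ρ (n - 1)` to a word of length `k`. -/
def append (k n : ℕ) (ρ : ℕ → ℕ) : Words k →ₗ[ℂ] Words n :=
  Finsupp.lmapDomain ℂ ℂ fun w m => if h : m.1 < k then w ⟨m.1, h⟩ else ρ m.1

variable {k : ℕ} {ρ : ℕ → ℕ}

theorem Phi_eq {mu la : YoungDiagram} (t : SkewSYT mu la) :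
    Phi t = append mu.card la.card (rowWord t) := rfl

theorem append_single (w : Fin k → ℕ) (c : ℂ) : append k n ρ (Finsupp.single w c) =
    Finsupp.single (wd n fun m => if m < k then ext w m else ρ m) c := by
  rw [append, Finsupp.lmapDomain_apply, Finsupp.mapDomain_single]
  congr 1
  funext m
  simp only [wd]
  split_ifs with h
  · rw [ext_of_lt _ h]
  · rfl

theorem append_injective (hk : k ≤ n) : Function.Injective (append k n ρ) := by
  refine Finsupp.mapDomain_injective fun w w' h => funext fun m => ?_
  have := congrFun h ⟨m, m.2.trans_le hk⟩
  simpa using this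

theorem append_opT (hk : k ≤ n) {i : ℕ} (hi : i + 1 < k) (v : Words k) :
    append k n ρ (opT k q i v) = opT n q i (append k n ρ v) := by
  induction v using Finsupp.induction_linear with
  | zero => simp
  | add f g hf hg => rw [map_add, map_add, hf, hg, map_add, map_add]
  | single w c =>
    have e : Finsupp.single w c = c • Finsupp.single w (1 : ℂ) := by simp
    have hin : i + 1 < n := by omega
    rw [e, map_smul, map_smul, map_smul, map_smul, opT_single hi, append_single, opT_single hin,
      map_add, map_smul, map_smul, append_single, append_single, ext_wd _ hin,
      ext_wd _ (show i < n by omega), if_pos hi, if_pos (show i < k by omega)]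
    congr 4
    rw [← wd_ext (swapWord ⟨i, hin⟩ _), ext_swapWord]
    funext m
    have hm := m.2
    simp only [wd]
    rw [ext_swapWord]
    by_cases e1 : (m : ℕ) = i
    · rw [e1, sw_left, sw_left, ext_wd _ hin, if_pos (by omega), if_pos hi]
    · by_cases e2 : (m : ℕ) = i + 1
      · rw [e2, sw_right, sw_right, ext_wd _ (by omega), if_pos hi, if_pos (by omega)]
      · rw [sw_of_ne _ e1 e2, sw_of_ne _ e1 e2, ext_wd _ hm]

theorem append_rightMul (hk : k ≤ n) (x : Hecke k q) (v : Words k) :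
    append k n ρ (rightMul x v) = rightMul (heckeIncl q hk x) (append k n ρ v) := by
  induction x using hecke_induction generalizing v with
  | h1 => rw [map_one, rightMul_one, rightMul_one]; rfl
  | hadd x y hx hy =>
    rw [map_add, rightMul_add, rightMul_add, LinearMap.add_apply, LinearMap.add_apply, map_add,
      hx, hy]
  | hsmul c x hx =>
    rw [map_smul, rightMul_smul, rightMul_smul, LinearMap.smul_apply, LinearMap.smul_apply,
      map_smul, hx]
  | hmul x i hi hx =>
    rw [map_mul, rightMul_mul, rightMul_mul, heckeIncl_heckeT hk hi, ← hx]
    exact append_opT hk hi _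

theorem append_murphy (hk : k ≤ n) {m : ℕ} (hm : m < k) (v : Words k) :
    append k n ρ (murphy q (opT k q) m v) = murphy q (opT n q) m (append k n ρ v) := by
  rw [← rightMul_murphy, append_rightMul hk, heckeIncl_murphy hk hm, rightMul_murphy]

theorem append_mem_jmSpace (hk : k ≤ n) {r : ℕ → ℕ} {l : ℕ} (hl : l ≤ k) {v : Words k}
    (hv : v ∈ jmSpace q (opT k q) r l) : append k n ρ v ∈ jmSpace q (opT n q) r l := by
  intro m hm
  rw [← append_murphy hk (by omega), hv m hm, map_smul]

theorem append_aeval (hk : k ≤ n) {m : ℕ} (hm : m < k) (p : Polynomial ℂ) (v : Words k) :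
    append k n ρ (Polynomial.aeval (murphy q (opT k q) m) p v) =
      Polynomial.aeval (murphy q (opT n q) m) p (append k n ρ v) := by
  rw [← rightMul_murphy, ← rightMul_aeval, append_rightMul hk, ← rightMul_murphy,
    ← rightMul_aeval, ← heckeIncl_murphy hk hm, Polynomial.aeval_algHom_apply]

theorem append_proj (hk : k ≤ n) {r : ℕ → ℕ} {l : ℕ} (hl : l ≤ k) (v : Words k) :
    append k n ρ (proj q (opT k q) r l v) = proj q (opT n q) r l (append k n ρ v) := by
  induction l with
  | zero => rfl
  | succ l ih => rw [proj_succ, proj_succ, append_aeval hk hl, ih (by omega)]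

/-- Concatenation of the first `k` letters of `s` with the later letters of `ρ`. -/
def splice (k : ℕ) (s ρ : ℕ → ℕ) : ℕ → ℕ := fun m => if m < k then s m else ρ m

theorem splice_of_lt {k m : ℕ} {s ρ : ℕ → ℕ} (h : m < k) : splice k s ρ m = s m := if_pos h

theorem splice_of_ge {k m : ℕ} {s ρ : ℕ → ℕ} (h : k ≤ m) : splice k s ρ m = ρ m :=
  if_neg h.not_gt

theorem append_unit (hk : k ≤ n) (s : ℕ → ℕ) : append k n ρ (unit k q s) =
    proj q (opT n q) (splice k s ρ) k (Finsupp.single (wd n (splice k s ρ)) 1) := by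
  rw [unit, append_proj hk le_rfl, append_single, proj_congr (r := s) (r' := splice k s ρ)
    fun x hx => by rw [splice, if_pos hx]]
  congr 2
  funext m
  simp only [wd, splice]
  split_ifs with h
  · rw [ext_wd _ h]
  · rfl

theorem rightMul_heckeIncl_mem_genAlg {m : ℕ} (hm : m + 1 ≤ n) (x : Hecke (m + 1) q) :
    rightMul (heckeIncl q hm x) ∈ genAlg (opT n q) m := by
  induction x using hecke_induction with
  | h1 => rw [map_one, rightMul_one]; exact Subalgebra.one_mem _
  | hadd x y hx hy => rw [map_add, rightMul_add]; exact Subalgebra.add_mem _ hx hy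
  | hsmul c x hx => rw [map_smul, rightMul_smul]; exact Subalgebra.smul_mem _ hx c
  | hmul x i hi hx =>
    rw [map_mul, rightMul_mul', heckeIncl_heckeT hm hi]
    exact Subalgebra.mul_mem _ (T_mem_genAlg (by omega)) hx

theorem heckeIncl_heckeIncl {a b c : ℕ} (hab : a ≤ b) (hbc : b ≤ c) (x : Hecke a q) :
    heckeIncl q hbc (heckeIncl q hab x) = heckeIncl q (hab.trans hbc) x := by
  induction x using hecke_induction with
  | h1 => rw [map_one, map_one, map_one]
  | hadd x y hx hy => rw [map_add, map_add, map_add, hx, hy]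
  | hsmul c x hx => rw [map_smul, map_smul, map_smul, hx]
  | hmul x i hi hx =>
    rw [map_mul, map_mul, map_mul, hx, heckeIncl_heckeT hab hi, heckeIncl_heckeT _ hi,
      heckeIncl_heckeT hbc (by omega)]

/-- The isotypic projector acts on the eigenspaces of Jucys-Murphy elements by `0` and `1`. -/
theorem IsIsotypicProjector.apply (hq : q ≠ 0) (hN : QNonzero n q) {nu : YoungDiagram}
    {e : Hecke nu.card q} (he : IsIsotypicProjector q nu e) (h0 : 0 < nu.card) (hn : nu.card ≤ n)
    {s : ℕ → ℕ} (hs : IsLattice nu.card s) :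
    ∃ c : ℂ, (∀ v ∈ jmSpace q (opT n q) s nu.card, rightMul (heckeIncl q hn e) v = c • v) ∧
      (cnt s nu.card = nu.rowLen → c = 1) ∧ (cnt s nu.card ≠ nu.rowLen → c = 0) := by
  have S := isSemisimpleFamily_opT hq hN
  obtain ⟨c, hc⟩ : ∃ c : ℂ, ∀ v ∈ jmSpace q (opT n q) s nu.card,
      rightMul (heckeIncl q hn e) v = c • v := by
    have hcent := he.central
    clear he
    revert e
    generalize nu.card = m at *
    intro e hcent
    obtain ⟨m, rfl⟩ : ∃ l, m = l + 1 := ⟨m - 1, by omega⟩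
    refine S.central_scalar (by omega) hs (rightMul_heckeIncl_mem_genAlg hn e) fun i hi => ?_
    show opT n q i * _ = _ * opT n q i
    rw [opT, ← rightMul_mul', ← rightMul_mul', ← heckeIncl_heckeT hn (show i + 1 < m + 1 by omega),
      ← map_mul, ← map_mul, hcent]
  -- The scalar is read off on the seminormal unit of `s`, with zeros appended. It does not vanish,
  -- and its membership in a Specht module decides between `1` and `0`.
  have hu : append nu.card n 0 (unit nu.card q s) ≠ 0 := fun h =>
    unit_ne_zero hq (hN.mono hn) hs (append_injective hn (h.trans (map_zero _).symm))
  have h1 := hc _ (append_mem_jmSpace hn (ρ := 0) le_rfl (unit_mem hq (hN.mono hn) hs))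
  rw [← append_rightMul] at h1
  refine ⟨c, hc, fun hcnt => ?_, fun hcnt => ?_⟩
  · rw [he.act_self _ (mem_specht hs hcnt)] at h1
    have h2 : (1 - c) • append nu.card n 0 (unit nu.card q s) = 0 := by
      rw [sub_smul, one_smul, ← h1, sub_self]
    exact (sub_eq_zero.1 ((smul_eq_zero.1 h2).resolve_right hu)).symm
  · obtain ⟨rho, hrho, hcard⟩ := exists_diagram hs
    have hne : rho ≠ nu := by rintro rfl; exact hcnt hrho.symm
    have hs' : IsLattice rho.card s := by rw [hcard]; exact hs
    have hn' : rho.card ≤ n := by rw [hcard]; exact hn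
    have h2 := he.act_other rho hcard hne _ (mem_specht hs' (by rw [hcard, hrho]))
    have hu' : append rho.card n 0 (unit rho.card q s) ≠ 0 := fun h =>
      unit_ne_zero hq (hN.mono hn') hs' (append_injective hn' (h.trans (map_zero _).symm))
    have h3 := hc (append rho.card n 0 (unit rho.card q s)) (by
      rw [← hcard]
      exact append_mem_jmSpace hn' le_rfl (unit_mem hq (hN.mono hn') hs'))
    rw [← heckeIncl_heckeIncl hcard.ge hn' e, ← append_rightMul, h2, map_zero] at h3
    exact (smul_eq_zero.1 h3.symm).resolve_right hu'

end Specht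


/-! ### Existence of the isotypic projectors -/

section Isotypic

variable {n : ℕ} {q : ℂ}

/-- The cells of a partition on a given diagonal form an initial segment of it, so their number
determines them. -/
theorem eq_of_card_diagonal {nu rho : YoungDiagram}
    (h : ∀ d : ℤ, Finset.card {c ∈ nu.cells | (c.2 : ℤ) - c.1 = d} =
      Finset.card {c ∈ rho.cells | (c.2 : ℤ) - c.1 = d}) : nu = rho := by
  have key : ∀ nu rho : YoungDiagram,
      (∀ d : ℤ, Finset.card {c ∈ nu.cells | (c.2 : ℤ) - c.1 = d} =
        Finset.card {c ∈ rho.cells | (c.2 : ℤ) - c.1 = d}) → nu ≤ rho := by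
    intro nu rho h
    rw [← YoungDiagram.cells_subset_iff]
    intro c hc
    by_contra hcr
    refine (Finset.card_lt_card ((Finset.ssubset_iff_of_subset ?_).2 ⟨c, ?_, ?_⟩)).ne'
      (h ((c.2 : ℤ) - c.1))
    · intro x hx
      rw [Finset.mem_filter] at hx ⊢
      refine ⟨nu.isLowerSet ?_ hc, hx.2⟩
      by_contra hxc
      refine hcr (rho.isLowerSet ?_ hx.1)
      rw [Prod.le_def] at hxc ⊢
      omega
    · exact Finset.mem_filter.2 ⟨hc, rfl⟩
    · exact fun h => hcr (Finset.mem_filter.1 h).1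
  exact le_antisymm (key _ _ h) (key _ _ fun d => (h d).symm)

/-- The polynomial whose roots are the `q`-contents of the cells of a diagram. -/
def contentPoly (q : ℂ) (nu : YoungDiagram) : Polynomial ℂ :=
  ∏ c ∈ nu.cells, (Polynomial.X - Polynomial.C (qInt q ((c.2 : ℤ) - c.1)))

theorem contentPoly_injective (hq : Function.Injective (qInt q)) :
    Function.Injective (contentPoly q) := by
  intro nu rho h
  have hroots : ∀ nu : YoungDiagram, (contentPoly q nu).roots =
      (nu.cells.val.map fun c => (c.2 : ℤ) - c.1).map (qInt q) := by
    intro nu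
    have := Polynomial.roots_multiset_prod_X_sub_C
      (nu.cells.val.map fun c => qInt q ((c.2 : ℤ) - c.1))
    rw [Multiset.map_map] at this
    rw [Multiset.map_map]
    exact this
  have h1 := congrArg Polynomial.roots h
  rw [hroots, hroots] at h1
  have h2 := Multiset.map_injective hq h1
  refine eq_of_card_diagonal fun d => ?_
  have h3 := congrArg (Multiset.count d) h2
  rw [Multiset.count_map, Multiset.count_map] at h3
  simp only [Finset.card_def, Finset.filter_val, eq_comm (a := d)] at h3 ⊢
  exact h3

/-- The polynomial whose roots are the `q`-contents of a lattice word. -/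
def wordPoly (q : ℂ) (r : ℕ → ℕ) (k : ℕ) : Polynomial ℂ :=
  ∏ m ∈ Finset.range k, (Polynomial.X - Polynomial.C (qInt q (cont r m)))

theorem wordPoly_rowWord {la : YoungDiagram} (t : SYT la) :
    wordPoly q (rowWord t) la.card = contentPoly q la := by
  have h : la.cells = (Finset.range la.card).image fun m => t.cell (m + 1) := by
    rw [← SYT.cells_shape t le_rfl, SYT.shape_card]
  rw [wordPoly, contentPoly, h, Finset.prod_image]
  · refine Finset.prod_congr rfl fun m hm => ?_
    rw [← SYT.content_eq t (by simpa using hm)]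
    rfl
  · intro m hm m' hm' e
    exact SYT.cell_injOn t (by simpa using hm) (by simpa using hm') e

theorem rightMul_murphyChar {r : ℕ → ℕ} {k : ℕ} (x : ℂ) {v : Words n}
    (hv : v ∈ jmSpace q (opT n q) r k) :
    rightMul (murphyChar q (heckeT n q) x k) v = (wordPoly q r k).eval x • v := by
  induction k with
  | zero => simp [murphyChar, rightMul_one, wordPoly]
  | succ k ih =>
    obtain ⟨h1, h2⟩ := mem_jmSpace_succ.1 hv
    have hsub : ∀ a b : Hecke n q, rightMul (a - b) = rightMul a - rightMul b := by
      intro a b; simp [rightMul]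
    rw [murphyChar, rightMul_mul, ih h1, map_smul, hsub, rightMul_smul, rightMul_one,
      LinearMap.sub_apply, rightMul_murphy, h2, wordPoly, wordPoly, Finset.prod_range_succ,
      Polynomial.eval_mul, Polynomial.eval_sub, Polynomial.eval_X, Polynomial.eval_C,
      mul_smul, sub_smul]
    rfl

theorem heckeIncl_murphyChar {m : ℕ} (hmn : m ≤ n) {k : ℕ} (hk : k ≤ m) (x : ℂ) :
    heckeIncl q hmn (murphyChar q (heckeT m q) x k) = murphyChar q (heckeT n q) x k := by
  induction k with
  | zero => exact map_one _
  | succ k ih =>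
    rw [murphyChar, murphyChar, map_mul, ih (by omega), map_sub, map_smul, map_one,
      heckeIncl_murphy hmn hk]

theorem mul_comm_of_commute_heckeT {x : Hecke n q} (h : ∀ i, i + 1 < n → Commute (heckeT n q i) x)
    (y : Hecke n q) : y * x = x * y := by
  induction y using hecke_induction with
  | h1 => rw [one_mul, mul_one]
  | hadd y z hy hz => rw [add_mul, mul_add, hy, hz]
  | hsmul c y hy => rw [smul_mul_assoc, mul_smul_comm, hy]
  | hmul y i hi hy => rw [mul_assoc, (h i hi).eq, ← mul_assoc, hy, mul_assoc]

/-- The central element `∏ (x - J_k)` acts on a Specht module by the value at `x` of its content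
polynomial. Distinct partitions have distinct content polynomials, so for a suitable `x` the value
for `nu` differs from all others. A Lagrange polynomial in the central element is then the
projector. -/
theorem exists_isIsotypicProjector (hq : q ≠ 0) (hinj : Function.Injective (qInt q))
    (nu : YoungDiagram) : ∃ e, IsIsotypicProjector q nu e := by
  classical
  have hN : ∀ n, QNonzero n q := fun n k hk _ h => by
    have := hinj (h.trans (qInt_zero q).symm)
    omega
  set P := contentPoly q nu with hP
  set G : Finset (Polynomial ℂ) :=
    ((latticeWords nu.card).image fun r => wordPoly q r nu.card).erase P with hG
  -- A product of nonzero polynomials is nonzero, so a single `x` separates `P` from all the others.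
  obtain ⟨x, hx⟩ : ∃ x, (∏ p ∈ G, (P - p)).eval x ≠ 0 := by
    by_contra h
    push Not at h
    have h0 : ∏ p ∈ G, (P - p) = 0 := Polynomial.funext fun x => by rw [h x, Polynomial.eval_zero]
    obtain ⟨p, hp, hp0⟩ := Finset.prod_eq_zero_iff.1 h0
    exact (Finset.mem_erase.1 hp).1 (sub_eq_zero.1 hp0).symm
  rw [Polynomial.eval_prod, Finset.prod_ne_zero_iff] at hx
  set L : Polynomial ℂ := ∏ p ∈ G, Polynomial.C (P.eval x - p.eval x)⁻¹ *
    (Polynomial.X - Polynomial.C (p.eval x)) with hL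
  have hL1 : L.eval (P.eval x) = 1 := by
    rw [hL, Polynomial.eval_prod]
    refine Finset.prod_eq_one fun p hp => ?_
    have := hx p hp
    rw [Polynomial.eval_sub] at this
    simp [inv_mul_cancel₀ this]
  have hL0 : ∀ p ∈ G, L.eval (p.eval x) = 0 := by
    intro p hp
    rw [hL, Polynomial.eval_prod]
    exact Finset.prod_eq_zero hp (by simp)
  have hact : ∀ rho : YoungDiagram, ∀ v ∈ specht q rho,
      rightMul (Polynomial.aeval (murphyChar q (heckeT rho.card q) x rho.card) L) v =
        L.eval ((contentPoly q rho).eval x) • v := by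
    intro rho v hv
    induction hv using Submodule.span_induction with
    | zero => rw [map_zero, smul_zero]
    | add y z _ _ hy hz => rw [map_add, hy, hz, smul_add]
    | smul c y _ hy => rw [map_smul, hy, smul_comm]
    | mem y hy =>
      obtain ⟨t, rfl⟩ := hy
      have h1 := rightMul_murphyChar x (unit_mem hq (hN _) (SYT.isLattice t))
      rw [← seminormalUnit_eq, wordPoly_rowWord] at h1
      rw [rightMul_aeval]
      exact aeval_of_eigen h1 L
  refine ⟨Polynomial.aeval (murphyChar q (heckeT nu.card q) x nu.card) L, ?_, ?_, ?_⟩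
  · refine mul_comm_of_commute_heckeT fun i hi => ?_
    have hc := (isHeckeFamily_heckeT nu.card q).commute_murphyChar hq x hi
    induction L using Polynomial.induction_on' with
    | add p s hp hs => rw [map_add]; exact hp.add_right hs
    | monomial k c =>
      rw [Polynomial.aeval_monomial]
      exact Commute.mul_right (Algebra.commutes c _).symm (hc.pow_right k)
  · intro v hv
    rw [hact nu v hv, ← hP, hL1, one_smul]
  · intro rho h hne v hv
    rw [← Polynomial.aeval_algHom_apply, heckeIncl_murphyChar h.ge le_rfl, ← h, hact rho v hv]
    by_cases hv0 : v = 0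
    · rw [hv0, smul_zero]
    have hSYT : Nonempty (SYT rho) := by
      by_contra hemp
      rw [not_nonempty_iff] at hemp
      have : specht q rho = ⊥ := by
        rw [specht, Set.range_eq_empty, Submodule.span_empty]
      rw [this] at hv
      exact hv0 ((Submodule.mem_bot ℂ).1 hv)
    obtain ⟨t⟩ := hSYT
    obtain ⟨s, hs, hts⟩ := exists_mem_latticeWords (SYT.isLattice t)
    rw [hL0, zero_smul]
    rw [hG, Finset.mem_erase]
    refine ⟨fun e => hne (contentPoly_injective hinj e), Finset.mem_image.2 ⟨s, h ▸ hs, ?_⟩⟩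
    rw [← wordPoly_rowWord t, wordPoly, wordPoly, h]
    refine Finset.prod_congr rfl fun m hm => ?_
    rw [Finset.mem_range, ← h] at hm
    rw [cont_congr fun y hy => (hts y (by omega)).symm]

theorem isIsotypicProjector (hq : q ≠ 0) (hinj : Function.Injective (qInt q))
    (nu : YoungDiagram) : IsIsotypicProjector q nu (isotypicProjector q nu) := by
  rw [isotypicProjector, dif_pos (exists_isIsotypicProjector hq hinj nu)]
  exact (exists_isIsotypicProjector hq hinj nu).choose_spec

theorem qInt_injective_of_pos {q : ℝ} (hq : 0 < q) : Function.Injective (qInt (q : ℂ)) := by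
  intro a b h
  have hq' : (q : ℂ) ≠ 0 := Complex.ofReal_ne_zero.2 hq.ne'
  exact (qNonzero_of_pos hq (a - b).natAbs).inj hq' (by omega) (by omega) h

/-- The idempotent of a skew tableau maps concatenations of seminormal units to seminormal units. -/
theorem rightMul_skewIdempotent {mu la : YoungDiagram} (hq : q ≠ 0)
    (hinj : Function.Injective (qInt q)) (h : mu ≤ la) (t : SkewSYT mu la) (s : SYT mu) :
    rightMul (skewIdempotent q h t) (Phi t (seminormalUnit q s)) =
      seminormalUnit q (SkewSYT.glue h t s) := by
  have hN : QNonzero la.card q := fun k hk _ h => by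
    have := hinj (h.trans (qInt_zero q).symm)
    omega
  have S := isSemisimpleFamily_opT hq hN
  have hcard : mu.card ≤ la.card := Finset.card_le_card (YoungDiagram.cells_subset_iff.2 h)
  set g := SkewSYT.glue h t s with hg
  set r := rowWord g with hr
  have hlat : IsLattice la.card r := SYT.isLattice g
  have key : ∀ k, mu.card ≤ k → k ≤ la.card →
      rightMul (((List.Ico (mu.card + 1) (k + 1)).map fun k =>
        heckeIncl q (t.card_shape_le h k) (isotypicProjector q (t.shape k))).prod)
        (Phi t (seminormalUnit q s)) =
      proj q (opT la.card q) r k (Finsupp.single (wd la.card r) 1) := by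
    intro k hk
    induction k, hk using Nat.le_induction with
    | base =>
      intro _
      rw [List.Ico.self_empty, List.map_nil, List.prod_nil, rightMul_one, Phi_eq,
        seminormalUnit_eq, Module.End.one_apply, append_unit hcard]
      have e : ∀ m < la.card, splice mu.card (rowWord s) (rowWord t) m = r m := fun m hm => by
        rw [hr, rowWord_glue h t s hm, splice]
      rw [proj_congr fun m hm => e m (by omega)]
      congr 2
      exact funext fun m => e m m.2
    | succ k hk ih =>
      intro hk'
      rw [List.Ico.succ_top (by omega), List.map_append, List.prod_append, rightMul_mul,
        ih (by omega), List.map_singleton, List.prod_singleton]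
      have hrk := hlat.mono (show k ≤ la.card by omega)
      have hrk1 := hlat.mono hk'
      have hshape : (t.shape (k + 1)).card = k + 1 := by
        rw [← shape_glue h t s (by omega)]; exact SYT.card_shape g hk'
      have hrow : cnt r (k + 1) = (t.shape (k + 1)).rowLen := by
        rw [hr, SYT.cnt_rowWord g hk', hg, shape_glue h t s (by omega)]
      set v := proj q (opT la.card q) r k (Finsupp.single (wd la.card r) 1) with hv
      have hvm : v ∈ jmSpace q (opT la.card q) r k := S.proj_mem (by omega) hrk _
      obtain ⟨r0, hr0, hrr0⟩ := exists_mem_latticeWords hrk1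
      have hscal : ∀ x, IsLattice (k + 1) x → ∃ c : ℂ,
          (∀ v ∈ jmSpace q (opT la.card q) x (k + 1),
            rightMul (heckeIncl q (t.card_shape_le h (k + 1))
              (isotypicProjector q (t.shape (k + 1)))) v = c • v) ∧
          (cnt x (k + 1) = cnt r (k + 1) → c = 1) ∧ (cnt x (k + 1) ≠ cnt r (k + 1) → c = 0) := by
        intro x hx
        obtain ⟨c, h1, h2, h3⟩ := (isIsotypicProjector hq hinj (t.shape (k + 1))).apply hq hN
          (by omega) (t.card_shape_le h (k + 1)) (s := x) (by rw [hshape]; exact hx)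
        refine ⟨c, fun v hv => h1 v (by rw [hshape]; exact hv), fun hc => h2 ?_, fun hc => h3 ?_⟩
        · rw [hshape, hc, hrow]
        · rw [hshape, ← hrow]; exact hc
      -- The vector `v` has components only at words that agree with `r` in the first `k` letters.
      -- Among their one-letter extensions, the projector keeps exactly the one whose shape is that
      -- of `r`.
      rw [← S.sum_proj hk' v, map_sum, Finset.sum_eq_single r0]
      · obtain ⟨c, h1, h2, -⟩ := hscal r0 (isLattice_of_mem hr0)
        rw [h1 _ (S.proj_mem hk' (isLattice_of_mem hr0) _), h2 (cnt_congr hrr0).symm, one_smul,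
          ← proj_congr hrr0, proj_succ, proj_of_mem hvm, proj_succ]
      · intro x hx hne
        have hxl := isLattice_of_mem hx
        obtain ⟨c, h1, -, h3⟩ := hscal x hxl
        rw [h1 _ (S.proj_mem hk' hxl _)]
        by_cases hxr : ∃ m < k, x m ≠ r m
        · rw [proj_succ, proj_of_mem_of_ne hq hN (by omega) (hxl.mono (Nat.le_succ k)) hrk hxr hvm,
            map_zero, smul_zero]
        · push Not at hxr
          rw [h3, zero_smul]
          intro hc
          refine hne (eq_of_mem_latticeWords hx hr0 fun m hm => ?_)
          rw [← hrr0 m hm]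
          rcases Nat.lt_succ_iff_lt_or_eq.1 hm with hm | rfl
          · exact hxr m hm
          · have := congrFun hc (r m)
            rw [cnt_succ, cnt_succ, cnt_congr hxr, if_pos rfl] at this
            by_contra hxm
            rw [if_neg hxm] at this
            omega
      · intro h; exact absurd hr0 h
  rw [seminormalUnit_eq g]
  exact key la.card hcard le_rfl

/-- Every factor of the skew idempotent is central in an algebra `H_k(q)` that contains `B_{|mu|}`.
The tableau `s` serves only to compute the sizes of the shapes. -/
theorem commute_skewIdempotent {mu la : YoungDiagram} (hq : q ≠ 0)
    (hinj : Function.Injective (qInt q)) (h : mu ≤ la) (s : SYT mu) (t : SkewSYT mu la) :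
    bottomToRandom la.card q mu.card * skewIdempotent q h t =
      skewIdempotent q h t * bottomToRandom la.card q mu.card := by
  refine Commute.list_prod_right _ _ fun x hx => ?_
  obtain ⟨k, hk, rfl⟩ := List.mem_map.1 hx
  rw [List.Ico.mem] at hk
  have hshape : (t.shape k).card = k := by
    rw [← shape_glue h t s (by omega)]; exact SYT.card_shape _ (by omega)
  rw [← heckeIncl_bottomToRandom (t.card_shape_le h k) (show mu.card ≤ _ by omega)]
  show _ * _ = _ * _
  rw [← map_mul, ← map_mul, (isIsotypicProjector hq hinj (t.shape k)).central]

end Isotypic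

/-! ### Straightening -/

section Straightening

variable {n : ℕ} {q : ℂ}

theorem rightMul_cProd_opT {i j : ℕ} (hi : i + 1 < n) (hj : j ≤ i) (v : Words n) :
    rightMul (cProd n q j) (opT n q i v) = q • rightMul (cProd n q j) v := by
  rw [opT, ← rightMul_mul, heckeT_mul_cProd hi hj, rightMul_smul]; rfl

theorem rightMul_cProd_unit_sw (hq : q ≠ 0) (hN : QNonzero n q) {r : ℕ → ℕ} (hr : IsLattice n r)
    {j k : ℕ} (hj : j ≤ k) (hk : k + 1 < n) (hs : Swappable r k) (h : r k < r (k + 1)) :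
    rightMul (cProd n q j) (unit n q (sw k r)) =
      (q - tau q r k) • rightMul (cProd n q j) (unit n q r) := by
  rw [unit_sw hq hN hr hk hs h, map_sub, map_smul, rightMul_cProd_opT hk hj, sub_smul]

theorem cnt_splice {j m : ℕ} {s r : ℕ → ℕ} (h : cnt s j = cnt r j) (hm : j ≤ m) :
    cnt (splice j s r) m = cnt r m := by
  induction m, hm using Nat.le_induction with
  | base => rw [← h]; exact cnt_congr fun x hx => if_pos hx
  | succ m hm ih =>
    funext i
    rw [cnt_succ, cnt_succ, ih, splice_of_ge hm]

theorem cont_splice {j m : ℕ} {s r : ℕ → ℕ} (h : cnt s j = cnt r j) (hm : j ≤ m) :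
    cont (splice j s r) m = cont r m := by
  rw [cont, cont, cnt_splice h hm, splice_of_ge hm]

theorem isLattice_splice {j : ℕ} {s r : ℕ → ℕ} (hs : IsLattice j s) (hr : IsLattice n r)
    (h : cnt s j = cnt r j) : IsLattice n (splice j s r) := by
  intro k hk i
  rcases le_total j k with hjk | hjk
  · rw [cnt_splice h hjk]; exact hr k hk i
  · rw [cnt_congr (r := splice j s r) (r' := s) fun x hx => splice_of_lt (by omega)]; exact hs k hjk i

theorem sw_splice {j k : ℕ} (hk : j ≤ k) (s r : ℕ → ℕ) :
    sw k (splice j s r) = splice j s (sw k r) := by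
  funext m
  by_cases e1 : m = k
  · rw [e1, sw_left, splice_of_ge (by omega), splice_of_ge hk, sw_left]
  · by_cases e2 : m = k + 1
    · rw [e2, sw_right, splice_of_ge hk, splice_of_ge (by omega), sw_right]
    · rw [sw_of_ne _ e1 e2, splice, splice, sw_of_ne _ e1 e2]

/-- The constant `q - τ` depends only on the contents of two cells outside the inner shape, which do
not change with `s`. According to the direction of the exchange, `α` is this constant or its
inverse. -/
theorem straightening_sw (hq : q ≠ 0) (hN : QNonzero n q) {r : ℕ → ℕ} (hr : IsLattice n r)
    {j k : ℕ} (hj : j ≤ k) (hk : k + 1 < n) (hsr : IsLattice n (sw k r)) (hne : r k ≠ r (k + 1)) :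
    ∃ α : ℂ, ∀ s, IsLattice j s → cnt s j = cnt r j →
      rightMul (cProd n q j) (unit n q (splice j s r)) =
        α • rightMul (cProd n q j) (unit n q (splice j s (sw k r))) := by
  have key : ∀ r, IsLattice n r → Swappable r k → r k < r (k + 1) → ∀ s, IsLattice j s →
      cnt s j = cnt r j → rightMul (cProd n q j) (unit n q (splice j s (sw k r))) =
      (q - tau q r k) • rightMul (cProd n q j) (unit n q (splice j s r)) := by
    intro r hr hsw h s hs hc
    have e1 : splice j s r k = r k := if_neg (by omega)
    have e2 : splice j s r (k + 1) = r (k + 1) := if_neg (by omega)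
    rw [← sw_splice hj, rightMul_cProd_unit_sw hq hN (isLattice_splice hs hr hc) hj hk _
      (by rw [e1, e2]; exact h), tau, tau, cont_splice hc hj, cont_splice hc (by omega)]
    rw [Swappable, e1, e2, cnt_splice hc hj]
    exact hsw
  have hs : Swappable r k := ⟨hne, IsLattice.addable_of_sw hk hsr⟩
  rcases lt_or_gt_of_ne hne with h | h
  · refine ⟨(q - tau q r k)⁻¹, fun s hsl hc => ?_⟩
    rw [key r hr hs h s hsl hc, inv_smul_smul₀ (q_sub_tau_ne_zero hq hN hr hk hs)]
  · refine ⟨q - tau q (sw k r) k, fun s hsl hc => ?_⟩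
    have := key (sw k r) hsr (hs.sw (by omega) hr) (by rw [sw_left, sw_right]; exact h) s hsl
      (by rw [cnt_sw_of_le _ hj]; exact hc)
    rwa [sw_sw] at this

/-- Straightening for lattice words. -/
theorem straightening (hq : q ≠ 0) (hN : QNonzero n q) {j : ℕ} {r r' : ℕ → ℕ} (hr : IsLattice n r)
    (hr' : IsLattice n r') (hjn : j ≤ n) (hag : ∀ x < j, r x = r' x) (hc : cnt r n = cnt r' n) :
    ∃ α : ℂ, ∀ s, IsLattice j s → cnt s j = cnt r j →
      rightMul (cProd n q j) (unit n q (splice j s r)) =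
        α • rightMul (cProd n q j) (unit n q (splice j s r')) := by
  set R : (ℕ → ℕ) → (ℕ → ℕ) → Prop := fun r r' => cnt r j = cnt r' j ∧
    ∃ α : ℂ, ∀ s, IsLattice j s → cnt s j = cnt r j →
      rightMul (cProd n q j) (unit n q (splice j s r)) =
        α • rightMul (cProd n q j) (unit n q (splice j s r')) with hR
  set r'' : ℕ → ℕ := fun x => if x < n then r' x else r x with hr''
  have hag' : ∀ x < n, r' x = r'' x := fun x hx => by simp [hr'', hx]
  have h := lattice_connected R (fun r => ⟨rfl, 1, fun s _ _ => by rw [one_smul]⟩)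
    (fun a b c ⟨h1, α, hα⟩ ⟨h2, β, hβ⟩ => ⟨h1.trans h2, α * β, fun s hs hc => by
      rw [hα s hs hc, hβ s hs (hc.trans h1), mul_smul]⟩) (j := j) (n := n)
    (fun r k hj hk hr hsr hne => ⟨(cnt_sw_of_le r hj).symm,
      straightening_sw hq hN hr hj hk hsr hne⟩) hr (hr'.congr hag') (fun x hx => by
        rcases hx with hx | hx
        · rw [← hag' x (by omega), hag x hx]
        · simp [hr'', show ¬ x < n by omega]) (hc.trans (cnt_congr hag'))
  obtain ⟨-, α, hα⟩ := h
  refine ⟨α, fun s hs hc => ?_⟩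
  rw [hα s hs hc, unit_congr (r := splice j s r'') (r' := splice j s r') fun x hx => ?_]
  simp only [splice]
  split_ifs
  · rfl
  · exact (hag' x hx).symm

theorem straightening_tableau {mu la : YoungDiagram} (h : mu ≤ la) (hq : q ≠ 0)
    (hN : QNonzero la.card q) (t t' : SkewSYT mu la) : ∃ α : ℂ, ∀ s : SYT mu,
    rightMul (cProd la.card q mu.card) (seminormalUnit q (SkewSYT.glue h t s)) =
      α • rightMul (cProd la.card q mu.card) (seminormalUnit q (SkewSYT.glue h t' s)) := by
  have hcard : mu.card ≤ la.card := Finset.card_le_card (YoungDiagram.cells_subset_iff.2 h)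
  -- Any one inner tableau turns the skew fillings into lattice words. The constant obtained from it
  -- then serves all other inner tableaux.
  by_cases hne : Nonempty (SYT mu)
  · obtain ⟨s0⟩ := hne
    have hg : ∀ (t : SkewSYT mu la) (x : ℕ), x < mu.card →
        rowWord (SkewSYT.glue h t s0) x = rowWord s0 x := fun t x hx => by
      rw [rowWord_glue h t s0 (by omega), if_pos hx]
    obtain ⟨α, hα⟩ := straightening hq hN (SYT.isLattice (SkewSYT.glue h t s0))
      (SYT.isLattice (SkewSYT.glue h t' s0)) hcard (fun x hx => by rw [hg t x hx, hg t' x hx])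
      (by rw [SYT.cnt_card, SYT.cnt_card])
    refine ⟨α, fun s => ?_⟩
    have e : ∀ t : SkewSYT mu la, seminormalUnit q (SkewSYT.glue h t s) = unit la.card q
        (splice mu.card (rowWord s) (rowWord (SkewSYT.glue h t s0))) := by
      intro t
      rw [seminormalUnit_eq]
      refine unit_congr fun x hx => ?_
      rw [rowWord_glue h t s hx, splice, rowWord_glue h t s0 hx]
      split_ifs <;> rfl
    rw [e, e]
    refine hα _ (SYT.isLattice s) ?_
    rw [SYT.cnt_card, cnt_congr (hg t), SYT.cnt_card]
  · exact ⟨0, fun s => absurd ⟨s⟩ hne⟩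

end Straightening


/-! ### The spanning set -/

section Spanning

variable {q : ℂ}

theorem rightMul_mem_specht (hq : q ≠ 0) {la : YoungDiagram} (hN : QNonzero la.card q)
    (x : Hecke la.card q) {v : Words la.card} (hv : v ∈ specht q la) :
    rightMul x v ∈ specht q la :=
  rightMul_mem (fun _ hi _ hv => opT_mem_specht hq hN hi hv) x v hv

theorem skewIdempotent_mem_specht (hq : q ≠ 0) (hinj : Function.Injective (qInt q))
    {mu la : YoungDiagram} (h : mu ≤ la) (t : SkewSYT mu la) {v : Words mu.card}
    (hv : v ∈ specht q mu) : rightMul (skewIdempotent q h t) (Phi t v) ∈ specht q la := by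
  induction hv using Submodule.span_induction with
  | zero => rw [map_zero, map_zero]; exact Submodule.zero_mem _
  | add x y _ _ hx hy => rw [map_add, map_add]; exact Submodule.add_mem _ hx hy
  | smul c x _ hx => rw [map_smul, map_smul]; exact Submodule.smul_mem _ c hx
  | mem x hx =>
    obtain ⟨s, rfl⟩ := hx
    simp only [rightMul_skewIdempotent hq hinj h t s]
    exact Submodule.subset_span ⟨_, rfl⟩

/-- A tableau and a smaller degree determine a subdiagram, a tableau of that shape and a
straightening constant. -/
theorem exists_straightening (hq : q ≠ 0) {la : YoungDiagram} (hN : QNonzero la.card q)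
    (t : SYT la) {j : ℕ} (hj : j ≤ la.card) : ∃ (mu : YoungDiagram) (h : mu ≤ la) (s : SYT mu)
    (α : ℂ), mu.card = j ∧ rightMul (cProd la.card q j) (seminormalUnit q t) =
      α • rightMul (cProd la.card q j)
        (seminormalUnit q (SkewSYT.glue h (SkewSYT.maxTableau h) s)) := by
  have hr := SYT.isLattice t
  obtain ⟨mu, hmu, rfl⟩ := exists_diagram (hr.mono hj)
  have h : mu ≤ la := by
    rw [← YoungDiagram.cells_subset_iff]
    rintro ⟨i, x⟩ hx
    rw [YoungDiagram.mem_cells, YoungDiagram.mem_iff_lt_rowLen] at hx ⊢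
    rw [hmu] at hx
    rw [← SYT.cnt_card t]
    exact hx.trans_le (cnt_mono _ hj i)
  obtain ⟨s, hs⟩ := exists_tableau (la := mu) (hr.mono hj) hmu.symm
  set g := SkewSYT.glue h (SkewSYT.maxTableau h) s with hg
  have hag : ∀ x < mu.card, rowWord t x = rowWord g x := fun x hx => by
    rw [hg, rowWord_glue h _ s (by omega), if_pos hx, hs x hx]
  obtain ⟨α, hα⟩ := straightening hq hN hr (SYT.isLattice g) hj hag
    (by rw [SYT.cnt_card, SYT.cnt_card])
  refine ⟨mu, h, s, α, rfl, ?_⟩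
  have := hα (rowWord t) (hr.mono hj) rfl
  rw [seminormalUnit_eq, seminormalUnit_eq,
    unit_congr (r := rowWord t) (r' := splice mu.card (rowWord t) (rowWord t)), this,
    unit_congr (r := splice mu.card (rowWord t) (rowWord g)) (r' := rowWord g)]
  · intro x hx
    rw [splice]
    split_ifs with hxm
    · exact hag x hxm
    · rfl
  · intro x hx
    rw [splice, ite_self]

theorem append_bottomToRandom {mu la : YoungDiagram} (h : mu ≤ la) (t : SkewSYT mu la)
    (v : Words mu.card) : Phi t (rightMul (bottomToRandom mu.card q mu.card) v) =
      rightMul (bottomToRandom la.card q mu.card) (Phi t v) := by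
  have hcard : mu.card ≤ la.card := Finset.card_le_card (YoungDiagram.cells_subset_iff.2 h)
  rw [Phi_eq, append_rightMul hcard, heckeIncl_bottomToRandom hcard le_rfl]

theorem spanningSet_subset (hq : q ≠ 0) (hinj : Function.Injective (qInt q))
    {κ : (mu : YoungDiagram) → Set (Words mu.card)} {la : YoungDiagram}
    (hN : QNonzero la.card q) (hκ : ∀ mu ≤ la, IsKernelBasis q mu (κ mu)) :
    Submodule.span ℂ (spanningSet q κ la) ≤ specht q la := by
  refine Submodule.span_le.2 ?_
  rintro _ ⟨mu, h, u, hu, rfl⟩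
  refine rightMul_mem_specht hq hN _ (skewIdempotent_mem_specht hq hinj h _ ?_)
  have := (hκ mu h).2 ▸ Submodule.subset_span hu
  exact this.1

theorem span_spanningSet {q : ℝ} (hq : 0 < q) {κ : (mu : YoungDiagram) → Set (Words mu.card)}
    {la : YoungDiagram} (hκ : ∀ mu ≤ la, IsKernelBasis (q : ℂ) mu (κ mu)) :
    Submodule.span ℂ (spanningSet (q : ℂ) κ la) = specht (q : ℂ) la := by
  have hq' : (q : ℂ) ≠ 0 := Complex.ofReal_ne_zero.2 hq.ne'
  have hinj := qInt_injective_of_pos hq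
  have hN : ∀ n, QNonzero n (q : ℂ) := qNonzero_of_pos hq
  refine le_antisymm (spanningSet_subset hq' hinj (hN _) hκ) ?_
  set X := Submodule.span ℂ (spanningSet (q : ℂ) κ la) with hX
  have hker : ∀ (mu : YoungDiagram) (h : mu ≤ la), ∀ a ∈ specht (q : ℂ) mu,
      rightMul (randomToRandom mu.card (q : ℂ)) a = 0 →
      rightMul (cProd la.card (q : ℂ) mu.card) (rightMul (skewIdempotent (q : ℂ) h
        (SkewSYT.maxTableau h)) (Phi (SkewSYT.maxTableau h) a)) ∈ X := by
    intro mu h a ha h0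
    have ha' : a ∈ Submodule.span ℂ (κ mu) := by
      rw [(hκ mu h).2]; exact ⟨ha, h0⟩
    clear ha h0
    induction ha' using Submodule.span_induction with
    | zero => rw [map_zero, map_zero, map_zero]; exact Submodule.zero_mem _
    | add x y _ _ hx hy => rw [map_add, map_add, map_add]; exact Submodule.add_mem _ hx hy
    | smul c x _ hx => rw [map_smul, map_smul, map_smul]; exact Submodule.smul_mem _ c hx
    | mem x hx => exact Submodule.subset_span ⟨mu, h, x, hx, rfl⟩
  -- the reduction from the image of `C_j` to the image of `C_{j-1}`
  have hstep : ∀ j ≤ la.card, ∀ v ∈ specht (q : ℂ) la,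
      ∃ b ∈ specht (q : ℂ) la, rightMul (cProd la.card (q : ℂ) j) v -
        rightMul (bottomToRandom la.card (q : ℂ) j * cProd la.card (q : ℂ) j) b ∈ X := by
    intro j hj v hv
    induction hv using Submodule.span_induction with
    | zero => exact ⟨0, Submodule.zero_mem _, by simp⟩
    | add x y _ _ hx hy =>
      obtain ⟨b, hb, h1⟩ := hx
      obtain ⟨c, hc, h2⟩ := hy
      refine ⟨b + c, Submodule.add_mem _ hb hc, ?_⟩
      rw [map_add, map_add, add_sub_add_comm]
      exact Submodule.add_mem _ h1 h2
    | smul c x _ hx =>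
      obtain ⟨b, hb, h1⟩ := hx
      refine ⟨c • b, Submodule.smul_mem _ c hb, ?_⟩
      rw [map_smul, map_smul, ← smul_sub]
      exact Submodule.smul_mem _ c h1
    | mem x hx =>
      obtain ⟨t, rfl⟩ := hx
      obtain ⟨mu, h, s, α, rfl, hα⟩ := exists_straightening hq' (hN _) t hj
      have := finiteDimensional_specht (q : ℂ) mu
      obtain ⟨a, ha, b, hb, h0, hab⟩ := exists_ker_add_bottomToRandom hq
        (fun i hi v hv => opT_mem_specht hq' (hN _) hi hv)
        (show seminormalUnit (q : ℂ) s ∈ specht (q : ℂ) mu from Submodule.subset_span ⟨s, rfl⟩)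
      set y := rightMul (skewIdempotent (q : ℂ) h (SkewSYT.maxTableau h))
        (Phi (SkewSYT.maxTableau h) b) with hy
      refine ⟨α • y, Submodule.smul_mem _ _ (skewIdempotent_mem_specht hq' hinj h _ hb), ?_⟩
      -- Moving `B_j` past the idempotents of the outer part places it in front of `C_j`.
      have e : rightMul (skewIdempotent (q : ℂ) h (SkewSYT.maxTableau h))
          (Phi (SkewSYT.maxTableau h) (rightMul (bottomToRandom mu.card (q : ℂ) mu.card) b)) =
          rightMul (bottomToRandom la.card (q : ℂ) mu.card) y := by
        rw [append_bottomToRandom h, ← rightMul_mul, commute_skewIdempotent hq' hinj h s,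
          rightMul_mul]
      simp only
      rw [hα, ← rightMul_skewIdempotent hq' hinj h _ s, hab, map_add, map_add, map_add, e,
        map_smul, rightMul_mul, ← smul_sub, add_sub_cancel_right]
      exact Submodule.smul_mem _ _ (hker mu h a ha h0)
  have hmain : ∀ j ≤ la.card, ∀ v ∈ specht (q : ℂ) la,
      rightMul (cProd la.card (q : ℂ) j) v ∈ X := by
    intro j
    induction j with
    | zero =>
      intro hj v hv
      -- The descent ends here: `B_0` is an empty sum, so no remainder is left.
      obtain ⟨b, -, h⟩ := hstep 0 hj v hv
      rw [bottomToRandom, Finset.sum_range_zero, zero_mul, rightMul_zero, LinearMap.zero_apply,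
        sub_zero] at h
      exact h
    | succ j ih =>
      intro hj v hv
      obtain ⟨b, hb, h⟩ := hstep (j + 1) hj v hv
      rw [← cProd_eq_mul hj] at h
      exact (Submodule.sub_mem_iff_left _ (ih (by omega) b hb)).1 h
  intro v hv
  have := hmain la.card le_rfl v hv
  rwa [cProd_self, rightMul_one] at this

end Spanning

end QShuffle

end

/-! ### The two statements of the theorem -/

theorem mainTheorem9 :
    (∀ (q : ℂ) (la mu : YoungDiagram) (h : mu ≤ la), q ≠ 0 →
      IsSemisimpleRing (QShuffle.Hecke la.card q) →
      ∀ t : QShuffle.SkewSYT mu la, ∃ α : ℂ, ∀ s : QShuffle.SYT mu,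
        QShuffle.rightMul (QShuffle.cProd la.card q mu.card)
            (QShuffle.seminormalUnit q (QShuffle.SkewSYT.glue h t s)) =
          α • QShuffle.rightMul (QShuffle.cProd la.card q mu.card)
            (QShuffle.seminormalUnit q
              (QShuffle.SkewSYT.glue h (QShuffle.SkewSYT.maxTableau h) s))) ∧
    (∀ (q : ℝ) (la : YoungDiagram), 0 < q →
      ∀ κ : (mu : YoungDiagram) → Set (QShuffle.Words mu.card),
        (∀ mu ≤ la, QShuffle.IsKernelBasis (q : ℂ) mu (κ mu)) →
        Submodule.span ℂ (QShuffle.spanningSet (q : ℂ) κ la) = QShuffle.specht (q : ℂ) la) := by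
  refine ⟨fun q la mu h hq hss t => ?_, fun q la hq κ hκ => QShuffle.span_spanningSet hq hκ⟩
  exact QShuffle.straightening_tableau h hq QShuffle.qNonzero_of_isSemisimpleRing t _
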